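/- An acyclic edge coloring of a finite simple graph $G$ is an assignment of colors to the edges of $G$ such that distinct edges with a common endpoint receive different colors and every cycle of $G$ receives more than two colors. A randomized algorithm is a program for a random access machine that operates on natural numbers with unit-cost instructions (constants, copying, addition, truncated subtraction, indirect reading and writing of memory cells, zero tests for branches and loops) and that can flip independent fair coins; its running time is the number of steps that it makes. Theorem 6.1. There are a randomized algorithm and a polynomial $p$ with the following property. Let $G$ be a finite simple graph with $n$ edges and maximum degree $\Delta$, with vertices $0,\dots,v-1$, given to the algorithm by $v$, $n$ and a list of its edges (in any order, each edge as a pair of endpoints in any order). Then the expected running time of the algorithm on $G$ is at most $p(n)$ (in particular it halts with probability $1$), and whenever it halts, its output is an acyclic edge coloring of $G$ with colors from a set of $16\Delta$ colors. -/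

import Mathlib

open scoped ENNReal

/-! ## Acyclic edge colorings -/

namespace SimpleGraph

/-- An edge coloring `c` of `G` with colors in `K` is acyclic if it is proper (distinct edges with
a common endpoint receive distinct colors) and every cycle of `G` receives more than two colors. -/
structure IsAcyclicEdgeColoring {V K : Type*} (G : SimpleGraph V) (c : G.EdgeLabeling K) :
    Prop where
  proper : ∀ e f : G.edgeSet, e ≠ f → (∃ v, v ∈ (e : Sym2 V) ∧ v ∈ (f : Sym2 V)) → c e ≠ c f
  acyclic : ∀ (u : V) (w : G.Walk u u), w.IsCycle →
    2 < (c '' {e : G.edgeSet | (e : Sym2 V) ∈ w.edges}).encard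

/-- The list `es` of ordered pairs of vertices lists every edge of `G` exactly once, in an
arbitrary order and with an arbitrary choice of which endpoint comes first. -/
structure IsEdgeListing {V : Type*} (G : SimpleGraph V) (es : List (V × V)) : Prop where
  nodup : (es.map fun p => s(p.1, p.2)).Nodup
  mem_iff : ∀ e : Sym2 V, e ∈ es.map (fun p => s(p.1, p.2)) ↔ e ∈ G.edgeSet

end SimpleGraph

/-! ## A randomized random access machine

The machine has registers `0, 1, 2, …` and arrays `0, 1, 2, …` (each with cells `0, 1, 2, …`), all
holding natural numbers; a program mentions only finitely many registers and arrays. The arithmetic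
instructions are addition and truncated subtraction (no multiplication, no shifts), so that the
length of the binary expansion of the largest number in the machine grows by at most one per step,
and unit-cost time is polynomially related to time on a Turing machine. The only source of
randomness is an instruction that flips a fair coin. -/

namespace RandRAM

/-- Programs of the machine. -/
inductive Cmd : Type
  /-- do nothing -/
  | skip : Cmd
  /-- `const r k`: put the constant `k` into register `r` -/
  | const (r k : ℕ) : Cmd
  /-- `copy r a`: `r := a` -/
  | copy (r a : ℕ) : Cmd
  /-- `add r a b`: `r := a + b` -/
  | add (r a b : ℕ) : Cmd
  /-- `sub r a b`: `r := max (a - b) 0` -/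
  | sub (r a b : ℕ) : Cmd
  /-- `load r A i`: `r := A[i]`, where `i` is a register and `A` is an array -/
  | load (r A i : ℕ) : Cmd
  /-- `store A i r`: `A[i] := r`, where `i` is a register and `A` is an array -/
  | store (A i r : ℕ) : Cmd
  /-- `flip r`: put the outcome, `0` or `1`, of a new coin flip into register `r` -/
  | flip (r : ℕ) : Cmd
  /-- run the first program, then the second one -/
  | seq (p q : Cmd) : Cmd
  /-- `ite r p q`: if register `r` is not `0` then run `p`, else run `q` -/
  | ite (r : ℕ) (p q : Cmd) : Cmd
  /-- `loop r p`: while register `r` is not `0`, run `p` -/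
  | loop (r : ℕ) (p : Cmd) : Cmd

/-- The memory of the machine, with the number of coins that have been used so far. -/
structure State : Type where
  /-- contents of the registers -/
  reg : ℕ → ℕ
  /-- `arr A i` is the content of cell `i` of array `A` -/
  arr : ℕ → ℕ → ℕ
  /-- number of coin flips made so far -/
  used : ℕ

/-- Put `x` into register `r`. -/
def State.setReg (s : State) (r x : ℕ) : State :=
  { s with reg := Function.update s.reg r x }

/-- Put `x` into cell `i` of array `A`. -/
def State.setArr (s : State) (A i x : ℕ) : State :=
  { s with arr := Function.update s.arr A (Function.update (s.arr A) i x) }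

/-- A configuration: the commands that remain to be executed (the first one comes next) and the
current memory. -/
structure Config : Type where
  todo : List Cmd
  state : State

/-- One step of the machine, where `ω j` is the outcome of the `j`-th coin flip. Every elementary
instruction, every evaluation of the test of a conditional or of a loop, and every unfolding of a
sequence takes one step. A configuration in which nothing remains to be executed is final. -/
def step (ω : ℕ → Bool) : Config → Config
  | ⟨[], s⟩ => ⟨[], s⟩
  | ⟨.skip :: K, s⟩ => ⟨K, s⟩
  | ⟨.const r k :: K, s⟩ => ⟨K, s.setReg r k⟩
  | ⟨.copy r a :: K, s⟩ => ⟨K, s.setReg r (s.reg a)⟩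
  | ⟨.add r a b :: K, s⟩ => ⟨K, s.setReg r (s.reg a + s.reg b)⟩
  | ⟨.sub r a b :: K, s⟩ => ⟨K, s.setReg r (s.reg a - s.reg b)⟩
  | ⟨.load r A i :: K, s⟩ => ⟨K, s.setReg r (s.arr A (s.reg i))⟩
  | ⟨.store A i r :: K, s⟩ => ⟨K, s.setArr A (s.reg i) (s.reg r)⟩
  | ⟨.flip r :: K, s⟩ => ⟨K, { s.setReg r (ω s.used).toNat with used := s.used + 1 }⟩
  | ⟨.seq p q :: K, s⟩ => ⟨p :: q :: K, s⟩
  | ⟨.ite r p q :: K, s⟩ => if s.reg r ≠ 0 then ⟨p :: K, s⟩ else ⟨q :: K, s⟩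
  | ⟨.loop r p :: K, s⟩ => if s.reg r ≠ 0 then ⟨p :: .loop r p :: K, s⟩ else ⟨K, s⟩

/-- The configuration that the program `P`, started in memory `s`, has reached after `t` steps
when the coin flips are `ω`. -/
def run (P : Cmd) (s : State) (ω : ℕ → Bool) (t : ℕ) : Config :=
  (step ω)^[t] ⟨[P], s⟩

/-- The program has halted after at most `t` steps. -/
def HaltedBy (P : Cmd) (s : State) (ω : ℕ → Bool) (t : ℕ) : Prop :=
  (run P s ω t).todo = []

/-- The number of steps that the program makes, which is `∞` if it does not halt. -/
noncomputable def runningTime (P : Cmd) (s : State) (ω : ℕ → Bool) : ℝ≥0∞ :=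
  ⨅ (t : ℕ) (_ : HaltedBy P s ω t), (t : ℝ≥0∞)

/-- The law of an infinite sequence of independent fair coin flips. -/
noncomputable def coinMeasure : MeasureTheory.Measure (ℕ → Bool) :=
  MeasureTheory.Measure.infinitePi fun _ : ℕ => (PMF.uniformOfFintype Bool).toMeasure

/-- The expected number of steps of the program `P` started in memory `s`. -/
noncomputable def expectedTime (P : Cmd) (s : State) : ℝ≥0∞ :=
  ∫⁻ ω, runningTime P s ω ∂coinMeasure

/-- The initial memory for a graph with vertices `0, …, v - 1` that is given by the list `es` of
its edges: register `0` holds the number of vertices, register `1` holds the number of edges, cell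
`i` of array `0` and cell `i` of array `1` hold the endpoints of the `i`-th edge, and everything
else is `0`. -/
def graphInput {v : ℕ} (es : List (Fin v × Fin v)) : State where
  reg r := if r = 0 then v else if r = 1 then es.length else 0
  arr A i :=
    if A = 0 then (es.map fun p => (p.1 : ℕ)).getD i 0
    else if A = 1 then (es.map fun p => (p.2 : ℕ)).getD i 0
    else 0
  used := 0

/-- The memory `s` contains the edge coloring `c` of `G`: for every `i`, cell `i` of array `2` holds
the color of the `i`-th edge in the list `es`. -/
def HoldsColoring {v k : ℕ} {G : SimpleGraph (Fin v)} (es : List (Fin v × Fin v))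
    (c : G.EdgeLabeling (Fin k)) (s : State) : Prop :=
  ∀ (i : ℕ) (hi : i < es.length) (h : s(es[i].1, es[i].2) ∈ G.edgeSet),
    s.arr 2 i = (c ⟨s(es[i].1, es[i].2), h⟩ : ℕ)

end RandRAM

/-! The algorithm maintains a partial edge coloring that is proper and in which no cycle is
completely colored with at most two colors. A round takes the least uncolored edge e and a uniformly
random color a. If a already occurs next to e, nothing changes. If a closes two-colored cycles, one
of them is chosen and all its edges, e included, lose their colors, except two consecutive ones.
Otherwise e keeps a. Both invariants survive (`proper_round`, `noBichromaticCycle_round`), so a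
complete coloring is acyclic.

If Δ is the maximum degree and 2^i ≤ Δ < 2^(i+1), the number of colors is K = 2^(4+i) ≤ 16Δ. Being a
power of two, K allows a color to be drawn exactly with 4 + i coins. Put H = K/2, so that H ≥ 4Δ.

Termination is an entropy compression argument, phrased as a contracting potential. Every round
leaves a record, a list of edges whose entries from index 2 on are those that end up uncolored.
Colors along a two-colored cycle have period two, so the new coloring and the record give back the
coloring just after e received a (`Undo.unique`); the earlier set of colored edges determines e,
hence also the earlier coloring and a. Let A(S) bound the probability of each single incomplete
coloring whose set of colored edges is S. Since a is uniform and independent of the past, the bounds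
after the next round are 1/K times the sums of A over the pairs of an earlier set and a record that
lead to the given set (`measure_process_succ_le`).

The potential Σ_S H^|S| A(S) gains a factor H for coloring e and loses H^d for uncoloring d edges,
while K = 2H contributes 1/(2H). There is one record of success, there are at most 2Δ records of a
conflict with d = 1, and at most Δ^d records of a cycle with d uncolored edges, d ≥ 2, because the
last two edges of the cycle are forced. The total weight is at most 1 + 1/2 + 1/12 = 19/12, so every
round multiplies the potential by at most 19/24 (`sum_tags_le`, `sum_push_le`). At most K^|S|
colorings belong to S, so the coloring is incomplete after t rounds with probability at most 2^n
(19/24)^t, and the expected number of rounds is at most 3n + 5.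

On the machine, everything inside a round and the initialization use counted loops only. They are
described by a denotational semantics and a polynomial time bound (`runs_compile`); the only
open-ended loop is the one over the rounds. -/

namespace RandRAM

/-! ### Composing runs of the machine -/

theorem State.setReg_reg (s : State) (r x r' : ℕ) :
    (s.setReg r x).reg r' = if r' = r then x else s.reg r' := by
  simp [State.setReg, Function.update_apply]

@[simp] theorem State.setReg_arr (s : State) (r x : ℕ) : (s.setReg r x).arr = s.arr := rfl

@[simp] theorem State.setReg_used (s : State) (r x : ℕ) : (s.setReg r x).used = s.used := rfl

@[simp] theorem State.setArr_reg (s : State) (A i x : ℕ) : (s.setArr A i x).reg = s.reg := rfl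

@[simp] theorem State.setArr_used (s : State) (A i x : ℕ) : (s.setArr A i x).used = s.used := rfl

theorem State.setArr_arr (s : State) (A i x A' : ℕ) :
    (s.setArr A i x).arr A' = if A' = A then Function.update (s.arr A) i x else s.arr A' := by
  simp only [State.setArr, Function.update_apply]

/-- `Runs ω P s s' T`: in at most `T` steps the command `P` turns the memory `s` into `s'`,
whatever remains to be executed afterwards. -/
def Runs (ω : ℕ → Bool) (P : Cmd) (s s' : State) (T : ℕ) : Prop :=
  ∃ t ≤ T, ∀ K, (step ω)^[t] ⟨P :: K, s⟩ = ⟨K, s'⟩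

namespace Runs

variable {ω : ℕ → Bool} {P Q : Cmd} {s s' s'' : State} {T T' : ℕ}

theorem of_step (h : ∀ K, step ω ⟨P :: K, s⟩ = ⟨K, s'⟩) : Runs ω P s s' 1 :=
  ⟨1, le_rfl, h⟩

theorem mono (h : Runs ω P s s' T) (hT : T ≤ T') : Runs ω P s s' T' := by
  obtain ⟨t, ht, h⟩ := h
  exact ⟨t, ht.trans hT, h⟩

theorem seq (h : Runs ω P s s' T) (h' : Runs ω Q s' s'' T') :
    Runs ω (.seq P Q) s s'' (1 + T + T') := by
  obtain ⟨t, ht, h⟩ := h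
  obtain ⟨t', ht', h'⟩ := h'
  refine ⟨t' + (t + 1), by omega, fun K => ?_⟩
  rw [Function.iterate_add_apply, Function.iterate_succ_apply]
  simp only [step]
  rw [h, h']

theorem ite_pos {r : ℕ} (hr : s.reg r ≠ 0) (h : Runs ω P s s' T) :
    Runs ω (.ite r P Q) s s' (1 + T) := by
  obtain ⟨t, ht, h⟩ := h
  refine ⟨t + 1, by omega, fun K => ?_⟩
  rw [Function.iterate_succ_apply]
  simp only [step, if_pos hr]
  rw [h]

theorem ite_neg {r : ℕ} (hr : s.reg r = 0) (h : Runs ω Q s s' T) :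
    Runs ω (.ite r P Q) s s' (1 + T) := by
  obtain ⟨t, ht, h⟩ := h
  refine ⟨t + 1, by omega, fun K => ?_⟩
  rw [Function.iterate_succ_apply]
  simp only [step, hr, ne_eq, not_true_eq_false, if_false]
  rw [h]

theorem loop_done {r : ℕ} (hr : s.reg r = 0) : Runs ω (.loop r P) s s 1 :=
  of_step fun K => by simp [step, hr]

theorem loop_more {r : ℕ} (hr : s.reg r ≠ 0) (h : Runs ω P s s' T)
    (h' : Runs ω (.loop r P) s' s'' T') : Runs ω (.loop r P) s s'' (1 + T + T') := by
  obtain ⟨t, ht, h⟩ := h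
  obtain ⟨t', ht', h'⟩ := h'
  refine ⟨t' + (t + 1), by omega, fun K => ?_⟩
  rw [Function.iterate_add_apply, Function.iterate_succ_apply]
  simp only [step, if_pos hr]
  rw [h, h']

end Runs

/-! ### Programs with counted loops: semantics, frame rules, running time -/

/-- Programs whose loops are all counted: `rep i m p` runs `p` for the values
`reg m - 1, …, 1, 0` of the counter `reg i`. Register `3` is scratch space for the decrement. -/
inductive Prog : Type
  | skip : Prog
  | const (r k : ℕ) : Prog
  | copy (r a : ℕ) : Prog
  | add (r a b : ℕ) : Prog
  | sub (r a b : ℕ) : Prog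
  | load (r A i : ℕ) : Prog
  | store (A i r : ℕ) : Prog
  | flip (r : ℕ) : Prog
  | seq (p q : Prog) : Prog
  | ite (r : ℕ) (p q : Prog) : Prog
  | rep (i m : ℕ) (p : Prog) : Prog

namespace Prog

/-- Translation into machine programs. -/
def compile : Prog → Cmd
  | skip => .skip
  | const r k => .const r k
  | copy r a => .copy r a
  | add r a b => .add r a b
  | sub r a b => .sub r a b
  | load r A i => .load r A i
  | store A i r => .store A i r
  | flip r => .flip r
  | seq p q => .seq p.compile q.compile
  | ite r p q => .ite r p.compile q.compile
  | rep i m p =>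
    .seq (.copy i m) (.loop i (.seq (.const 3 1) (.seq (.sub i i 3) p.compile)))

/-- The effect of a program on the memory. -/
def den (ω : ℕ → Bool) : Prog → State → State
  | skip, s => s
  | const r k, s => s.setReg r k
  | copy r a, s => s.setReg r (s.reg a)
  | add r a b, s => s.setReg r (s.reg a + s.reg b)
  | sub r a b, s => s.setReg r (s.reg a - s.reg b)
  | load r A i, s => s.setReg r (s.arr A (s.reg i))
  | store A i r, s => s.setArr A (s.reg i) (s.reg r)
  | flip r, s => { s.setReg r (ω s.used).toNat with used := s.used + 1 }
  | seq p q, s => den ω q (den ω p s)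
  | ite r p q, s => if s.reg r ≠ 0 then den ω p s else den ω q s
  | rep i m p, s =>
    (fun s' => den ω p ((s'.setReg 3 1).setReg i (s'.reg i - 1)))^[s.reg m]
      (s.setReg i (s.reg m))

/-- The registers that a program may change. -/
def regs : Prog → List ℕ
  | skip => []
  | const r _ => [r]
  | copy r _ => [r]
  | add r _ _ => [r]
  | sub r _ _ => [r]
  | load r _ _ => [r]
  | store _ _ _ => []
  | flip r => [r]
  | seq p q => p.regs ++ q.regs
  | ite _ p q => p.regs ++ q.regs
  | rep i _ p => 3 :: i :: p.regs

/-- The arrays that a program may change. -/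
def arrs : Prog → List ℕ
  | store A _ _ => [A]
  | seq p q => p.arrs ++ q.arrs
  | ite _ p q => p.arrs ++ q.arrs
  | rep _ _ p => p.arrs
  | _ => []

/-- A program without coin flips. -/
def flipFree : Prog → Bool
  | flip _ => false
  | seq p q => p.flipFree && q.flipFree
  | ite _ p q => p.flipFree && q.flipFree
  | rep _ _ p => p.flipFree
  | _ => true

/-- The registers that bound the numbers of iterations of the loops of a program. -/
def bounds : Prog → List ℕ
  | seq p q => p.bounds ++ q.bounds
  | ite _ p q => p.bounds ++ q.bounds
  | rep _ m p => m :: p.bounds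
  | _ => []

/-- No loop body changes the counter of its loop. -/
def WF : Prog → Bool
  | seq p q => p.WF && q.WF
  | ite _ p q => p.WF && q.WF
  | rep i _ p => (i != 3) && !(p.regs.contains i) && p.WF
  | _ => true

/-- A bound for the running time, as a polynomial in a bound for the loop lengths. -/
noncomputable def cost : Prog → Polynomial ℕ
  | seq p q => 1 + p.cost + q.cost
  | ite _ p q => 1 + p.cost + q.cost
  | rep _ _ p => Polynomial.X * (6 + p.cost) + 3
  | _ => 1

variable {ω : ℕ → Bool}

/-- Frame rule for registers. It is governed by the syntactic list `regs`, so the side conditions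
for concrete programs are settled by `decide`. -/
theorem den_reg (p : Prog) : ∀ (s : State) (r : ℕ), r ∉ p.regs → (p.den ω s).reg r = s.reg r := by
  induction p with
  | seq p q hp hq =>
    intro s r hr
    simp only [regs, List.mem_append, not_or] at hr
    rw [den, hq _ _ hr.2, hp _ _ hr.1]
  | ite r' p q hp hq =>
    intro s r hr
    simp only [regs, List.mem_append, not_or] at hr
    rw [den]
    split_ifs
    · exact hp _ _ hr.1
    · exact hq _ _ hr.2
  | rep i m p hp =>
    intro s r hr
    simp only [regs, List.mem_cons, not_or] at hr
    rw [den]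
    generalize s.reg m = k
    have : ∀ (k : ℕ) (s' : State), ((fun s' => den ω p
        ((s'.setReg 3 1).setReg i (s'.reg i - 1)))^[k] s').reg r = s'.reg r := by
      intro k
      induction k with
      | zero => intro s'; rfl
      | succ k ih =>
        intro s'
        rw [Function.iterate_succ_apply, ih, hp _ _ hr.2.2]
        simp [State.setReg_reg, hr.1, hr.2.1]
    rw [this]
    simp [State.setReg_reg, hr.2.1]
  | _ => intro s r hr; simp_all [regs, den, State.setReg_reg]

theorem den_arr (p : Prog) : ∀ (s : State) (A : ℕ), A ∉ p.arrs → (p.den ω s).arr A = s.arr A := by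
  induction p with
  | seq p q hp hq =>
    intro s r hr
    simp only [arrs, List.mem_append, not_or] at hr
    rw [den, hq _ _ hr.2, hp _ _ hr.1]
  | ite r' p q hp hq =>
    intro s r hr
    simp only [arrs, List.mem_append, not_or] at hr
    rw [den]
    split_ifs
    · exact hp _ _ hr.1
    · exact hq _ _ hr.2
  | rep i m p hp =>
    intro s r hr
    rw [den]
    have : ∀ (k : ℕ) (s' : State), ((fun s' => den ω p
        ((s'.setReg 3 1).setReg i (s'.reg i - 1)))^[k] s').arr r = s'.arr r := by
      intro k
      induction k with
      | zero => intro s'; rfl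
      | succ k ih =>
        intro s'
        rw [Function.iterate_succ_apply, ih, hp _ _ hr]
        rfl
    rw [this]
    rfl
  | _ => intro s r hr; simp_all [arrs, den, State.setArr_arr]

theorem den_used (p : Prog) : ∀ (s : State), p.flipFree → (p.den ω s).used = s.used := by
  induction p with
  | seq p q hp hq =>
    intro s hr
    simp only [flipFree, Bool.and_eq_true] at hr
    rw [den, hq _ hr.2, hp _ hr.1]
  | ite r' p q hp hq =>
    intro s hr
    simp only [flipFree, Bool.and_eq_true] at hr
    rw [den]
    split_ifs
    · exact hp _ hr.1
    · exact hq _ hr.2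
  | rep i m p hp =>
    intro s hr
    rw [den]
    have : ∀ (k : ℕ) (s' : State), ((fun s' => den ω p
        ((s'.setReg 3 1).setReg i (s'.reg i - 1)))^[k] s').used = s'.used := by
      intro k
      induction k with
      | zero => intro s'; rfl
      | succ k ih =>
        intro s'
        rw [Function.iterate_succ_apply, ih, hp _ hr]
        rfl
    rw [this]
    rfl
  | _ => intro s hr; simp_all [flipFree, den]

/-- Iterating the body of a counted loop under an invariant. -/
theorem den_rep_induction {i m : ℕ} {p : Prog} {s : State} (hi : i ∉ p.regs) (I : ℕ → State → Prop)
    (hI : ∀ j s' r x, r = 3 ∨ r = i → I j s' → I j (s'.setReg r x))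
    (h0 : I (s.reg m) s)
    (hstep : ∀ j s', j < s.reg m → (∀ r, r ∉ (rep i m p).regs → s'.reg r = s.reg r) →
      (∀ A, A ∉ p.arrs → s'.arr A = s.arr A) → s'.reg i = j → I (j + 1) s' → I j (den ω p s')) :
    I 0 (den ω (.rep i m p) s) := by
  -- Induction on the number k of completed iterations, after which the counter is `reg m - k`. The
  -- frame facts are carried along because `hstep` may use them.
  have key : ∀ k ≤ s.reg m, ∀ s', s' =
      ((fun s' => den ω p ((s'.setReg 3 1).setReg i (s'.reg i - 1)))^[k]
        (s.setReg i (s.reg m))) →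
      I (s.reg m - k) s' ∧ s'.reg i = s.reg m - k ∧
      (∀ r, r ∉ (rep i m p).regs → s'.reg r = s.reg r) ∧
      (∀ A, A ∉ p.arrs → s'.arr A = s.arr A) := by
    intro k
    induction k with
    | zero =>
      rintro _ _ rfl
      refine ⟨hI _ _ _ _ (.inr rfl) h0, by simp [State.setReg_reg], fun r hr => ?_, fun A _ => rfl⟩
      simp only [regs, List.mem_cons, not_or] at hr
      simp [State.setReg_reg, hr.2.1]
    | succ k ih =>
      rintro hk _ rfl
      obtain ⟨h1, h2, h3, h4⟩ := ih (by omega) _ rfl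
      rw [Function.iterate_succ_apply']
      generalize (fun s' => den ω p ((s'.setReg 3 1).setReg i (s'.reg i - 1)))^[k]
        (s.setReg i (s.reg m)) = s' at h1 h2 h3 h4
      have e : s.reg m - k = (s.reg m - (k + 1)) + 1 := by omega
      rw [e] at h1 h2
      simp only [h2, Nat.add_sub_cancel]
      have h3' : ∀ r, r ∉ (rep i m p).regs →
          ((s'.setReg 3 1).setReg i (s.reg m - (k + 1))).reg r = s.reg r := by
        intro r hr
        rw [← h3 r hr]
        simp only [regs, List.mem_cons, not_or] at hr
        simp [State.setReg_reg, hr.1, hr.2.1]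
      refine ⟨hstep _ _ (by omega) h3' h4 (by simp [State.setReg_reg])
        (hI _ _ _ _ (.inr rfl) (hI _ _ _ _ (.inl rfl) h1)), ?_, fun r hr => ?_, fun A hA => ?_⟩
      · rw [den_reg _ _ _ hi]; simp [State.setReg_reg]
      · rw [den_reg, h3' r hr]
        simp only [regs, List.mem_cons, not_or] at hr
        exact hr.2.2
      · rw [den_arr _ _ _ hA]; exact h4 A hA
  have := (key _ le_rfl _ rfl).1
  rw [Nat.sub_self] at this
  exact this

/-- The compiled program has the effect that `den` describes, within the time given by `cost`. -/
theorem runs_compile (p : Prog) : p.WF → ∀ (N : ℕ) (s : State),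
    (∀ m ∈ p.bounds, m ∉ p.regs ∧ s.reg m ≤ N) →
    Runs ω p.compile s (p.den ω s) (p.cost.eval N) := by
  induction p with
  | seq p q hp hq =>
    intro hwf N s hb
    simp only [WF, Bool.and_eq_true] at hwf
    simp only [bounds, regs, List.mem_append, not_or] at hb
    simp only [cost, Polynomial.eval_add, Polynomial.eval_one]
    refine Runs.seq (hp hwf.1 N s fun m hm => ?_) (hq hwf.2 N _ fun m hm => ?_)
    · exact ⟨(hb m (.inl hm)).1.1, (hb m (.inl hm)).2⟩
    · refine ⟨(hb m (.inr hm)).1.2, ?_⟩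
      rw [den_reg _ _ _ (hb m (.inr hm)).1.1]
      exact (hb m (.inr hm)).2
  | ite r p q hp hq =>
    intro hwf N s hb
    simp only [WF, Bool.and_eq_true] at hwf
    simp only [bounds, regs, List.mem_append, not_or] at hb
    simp only [cost, Polynomial.eval_add, Polynomial.eval_one, compile, den]
    split_ifs with h
    · refine (Runs.ite_pos h (hp hwf.1 N s fun m hm => ?_)).mono (by omega)
      exact ⟨(hb m (.inl hm)).1.1, (hb m (.inl hm)).2⟩
    · refine (Runs.ite_neg (by simpa using h) (hq hwf.2 N s fun m hm => ?_)).mono (by omega)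
      exact ⟨(hb m (.inr hm)).1.2, (hb m (.inr hm)).2⟩
  | rep i m p hp =>
    intro hwf N s hb
    simp only [WF, Bool.and_eq_true, bne_iff_ne, Bool.not_eq_true', List.contains_eq_mem,
      decide_eq_false_iff_not] at hwf
    obtain ⟨⟨hi3, hip⟩, hwf⟩ := hwf
    simp only [bounds, regs, List.mem_cons, not_or] at hb
    simp only [cost, Polynomial.eval_add, Polynomial.eval_mul, Polynomial.eval_X,
      Polynomial.eval_ofNat, compile, den]
    -- An iteration makes at most `5 + cost` steps (loop test, two unfoldings, constant, decrement,
    -- body), so 6 leaves slack; the final 1 is the failing test.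
    have main : ∀ (k : ℕ) (s' : State), s'.reg i = k → (∀ m' ∈ p.bounds, s'.reg m' ≤ N) →
        Runs ω (.loop i (.seq (.const 3 1) (.seq (.sub i i 3) p.compile))) s'
          ((fun s' => den ω p ((s'.setReg 3 1).setReg i (s'.reg i - 1)))^[k] s')
          (k * (6 + p.cost.eval N) + 1) := by
      intro k
      induction k with
      | zero => intro s' hs' _; simpa using Runs.loop_done hs'
      | succ k ih =>
        intro s' hs' hb'
        rw [Function.iterate_succ_apply]
        have hle : ∀ m' ∈ p.bounds,
            ((s'.setReg 3 1).setReg i (s'.reg i - 1)).reg m' ≤ N := by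
          intro m' hm'
          have := hb m' (.inr hm')
          simp only [State.setReg_reg, this.1.1, this.1.2.1, if_false]
          exact hb' m' hm'
        have h1 : Runs ω (.seq (.const 3 1) (.seq (.sub i i 3) p.compile)) s'
            (den ω p ((s'.setReg 3 1).setReg i (s'.reg i - 1)))
            (1 + 1 + (1 + 1 + p.cost.eval N)) := by
          refine Runs.seq (s' := s'.setReg 3 1) (Runs.of_step fun K => rfl) ?_
          refine Runs.seq (s' := (s'.setReg 3 1).setReg i (s'.reg i - 1))
            (Runs.of_step fun K => ?_) ?_
          · simp [step, State.setReg_reg, hi3]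
          · exact hp hwf N _ fun m' hm' => ⟨(hb m' (.inr hm')).1.2.2, hle m' hm'⟩
        refine (Runs.loop_more (by omega) h1 (ih _ ?_ ?_)).mono ?_
        · rw [den_reg _ _ _ hip]; simp [State.setReg_reg, hs']
        · intro m' hm'
          rw [den_reg _ _ _ (hb m' (.inr hm')).1.2.2]
          exact hle m' hm'
        · ring_nf; omega
    refine (Runs.seq (s' := s.setReg i (s.reg m)) (Runs.of_step fun K => rfl)
      (main (s.reg m) _ (by simp [State.setReg_reg]) ?_)).mono ?_
    · intro m' hm'
      have := hb m' (.inr hm')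
      simp only [State.setReg_reg, this.1.2.1, if_false]
      exact this.2
    · have := Nat.mul_le_mul_right (6 + p.cost.eval N) (hb m (.inl rfl)).2
      omega
  | _ =>
    intro _ N s _
    simp only [cost, Polynomial.eval_one]
    exact Runs.of_step fun K => rfl

end Prog

end RandRAM

/-! ## The algorithm on partial colorings -/

/-- One plus the least `j < n` with `P j`, or `0` if there is no such `j`. -/
noncomputable def firstIdx (n : ℕ) (P : ℕ → Prop) : ℕ :=
  open Classical in if h : ∃ j, j < n ∧ P j then Nat.find h + 1 else 0

section firstIdx

variable {n : ℕ} {P Q : ℕ → Prop}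

theorem firstIdx_eq_zero : firstIdx n P = 0 ↔ ∀ j < n, ¬ P j := by
  unfold firstIdx
  split_ifs with h
  · simpa using h
  · simpa using h

theorem firstIdx_eq_succ {j : ℕ} :
    firstIdx n P = j + 1 ↔ j < n ∧ P j ∧ ∀ i < j, ¬ P i := by
  classical
  unfold firstIdx
  split_ifs with h
  · rw [Nat.add_right_cancel_iff, Nat.find_eq_iff]
    constructor
    · rintro ⟨⟨h1, h2⟩, h3⟩
      exact ⟨h1, h2, fun i hi hp => h3 i hi ⟨hi.trans h1, hp⟩⟩
    · rintro ⟨h1, h2, h3⟩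
      exact ⟨⟨h1, h2⟩, fun i hi hp => h3 i hi hp.2⟩
  · push Not at h
    constructor
    · exact fun h' => h'.elim
    · rintro ⟨h1, h2, -⟩
      exact absurd h2 (h j h1)

theorem firstIdx_spec {j : ℕ} (h : firstIdx n P = j + 1) : j < n ∧ P j :=
  ⟨(firstIdx_eq_succ.1 h).1, (firstIdx_eq_succ.1 h).2.1⟩

theorem firstIdx_ne_zero : firstIdx n P ≠ 0 ↔ ∃ j < n, P j := by
  rw [ne_eq, firstIdx_eq_zero]; push Not; rfl

theorem firstIdx_pred_spec (h : firstIdx n P ≠ 0) :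
    firstIdx n P - 1 < n ∧ P (firstIdx n P - 1) :=
  firstIdx_spec (by omega)

theorem firstIdx_eq_of_unique {j : ℕ} (hj : j < n) (h : P j) (hu : ∀ i < n, P i → i = j) :
    firstIdx n P = j + 1 :=
  firstIdx_eq_succ.2 ⟨hj, h, fun i hi hp => hi.ne (hu i (hi.trans hj) hp)⟩

theorem firstIdx_congr (h : ∀ j < n, (P j ↔ Q j)) : firstIdx n P = firstIdx n Q := by
  rcases hq : firstIdx n Q with _ | j
  · rw [firstIdx_eq_zero] at hq ⊢
    exact fun j hj => (h j hj).not.2 (hq j hj)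
  · rw [firstIdx_eq_succ] at hq ⊢
    exact ⟨hq.1, (h j hq.1).2 hq.2.1, fun i hi => (h i (hi.trans hq.1)).not.2 (hq.2.2 i hi)⟩

end firstIdx

/-! ### Edge arrays, alternating walks, one round of the algorithm -/

/-- A list of edges `0, …, n - 1`, the `i`-th of which joins `U i` and `W i`. -/
structure EdgeArray : Type where
  n : ℕ
  U : ℕ → ℕ
  W : ℕ → ℕ

/-- A position of an alternating walk: it has just traversed the edge `p - 1`, has arrived at the
vertex `w`, and looks for an edge of color `y`; the next color after that is `z`. -/
structure WalkPos : Type where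
  p : ℕ
  w : ℕ
  y : ℕ
  z : ℕ

namespace EdgeArray

/-- The edge `j` has endpoint `w`. -/
def Inc (E : EdgeArray) (j w : ℕ) : Prop := E.U j = w ∨ E.W j = w

/-- The endpoint of the edge `j` other than `w`. -/
def other (E : EdgeArray) (j w : ℕ) : ℕ := E.U j + E.W j - w

/-- One step of the alternating walk that starts at the edge `e`. -/
noncomputable def advance (E : EdgeArray) (c : ℕ → ℕ) (e : ℕ) (s : WalkPos) : WalkPos :=
  if s.p = e + 1 then s
  else if firstIdx E.n (fun j => c j = s.y ∧ E.Inc j s.w) = 0 then s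
  else ⟨firstIdx E.n fun j => c j = s.y ∧ E.Inc j s.w,
    E.other ((firstIdx E.n fun j => c j = s.y ∧ E.Inc j s.w) - 1) s.w, s.z, s.y⟩

/-- The position after `i` steps of the alternating walk that goes from `e` over `W e` to `j`. -/
noncomputable def trace (E : EdgeArray) (c : ℕ → ℕ) (e j i : ℕ) : WalkPos :=
  (E.advance c e)^[i] ⟨j + 1, E.other j (E.W e), c e, c j⟩

/-- The alternating walk from `e` over `W e` to `j` returns to `e`. -/
def Closes (E : EdgeArray) (c : ℕ → ℕ) (e j : ℕ) : Prop :=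
  c j ≠ 0 ∧ j ≠ e ∧ E.Inc j (E.W e) ∧ (E.trace c e j E.n).p = e + 1

/-- Remove the colors of all but the first two edges of the walk from `e` over `W e` to `j`. -/
noncomputable def uncolor (E : EdgeArray) (c : ℕ → ℕ) (e j : ℕ) : ℕ → ℕ :=
  open Classical in fun q => if ∃ i, 2 ≤ i ∧ i ≤ E.n ∧ (E.trace c e j i).p = q + 1 then 0 else c q

/-- Some edge at an endpoint of `e` has color `a`. -/
def Conflict (E : EdgeArray) (c : ℕ → ℕ) (e a j : ℕ) : Prop :=
  c j = a ∧ (E.Inc j (E.U e) ∨ E.Inc j (E.W e))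

/-- One round: try to give the edge `e` the color `a`. -/
noncomputable def round (E : EdgeArray) (c : ℕ → ℕ) (e a : ℕ) : ℕ → ℕ :=
  if firstIdx E.n (E.Conflict c e a) ≠ 0 then c
  else if firstIdx E.n (E.Closes (Function.update c e a) e) = 0 then Function.update c e a
  else E.uncolor (Function.update c e a) e
    (firstIdx E.n (E.Closes (Function.update c e a) e) - 1)

/-- No loops, no multiple edges. -/
structure Simple (E : EdgeArray) : Prop where
  loopless : ∀ i < E.n, E.U i ≠ E.W i
  inj : ∀ i < E.n, ∀ j < E.n, ∀ w w', w ≠ w' → E.Inc i w → E.Inc i w' → E.Inc j w → E.Inc j w' →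
    i = j

/-- Colored edges of the same color have no common endpoint (`0` means uncolored). -/
def Proper (E : EdgeArray) (c : ℕ → ℕ) : Prop :=
  ∀ i < E.n, ∀ j < E.n, ∀ w, c i ≠ 0 → c i = c j → E.Inc i w → E.Inc j w → i = j

open Classical in
/-- The edges at the vertex `w`. -/
noncomputable def star (E : EdgeArray) (w : ℕ) : Finset ℕ :=
  (Finset.range E.n).filter fun j => E.Inc j w

theorem mem_star {E : EdgeArray} {w j : ℕ} : j ∈ E.star w ↔ j < E.n ∧ E.Inc j w := by
  simp [star]

variable {E : EdgeArray} {c : ℕ → ℕ} {e : ℕ}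

theorem inc_other {j w : ℕ} (h : E.Inc j w) : E.Inc j (E.other j w) := by
  unfold Inc other at *
  omega

theorem Simple.other_ne (hE : E.Simple) {j w : ℕ} (hj : j < E.n) (h : E.Inc j w) :
    E.other j w ≠ w := by
  have := hE.loopless j hj
  unfold Inc other at *
  omega

theorem eq_or_eq_other {j w x : ℕ} (h : E.Inc j w) (hx : E.Inc j x) : x = w ∨ x = E.other j w := by
  unfold Inc other at *
  omega

theorem eq_other_of_ne {j w x : ℕ} (h : E.Inc j w) (hx : E.Inc j x) (hne : x ≠ w) :
    x = E.other j w :=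
  (eq_or_eq_other h hx).resolve_left hne

theorem advance_end {s : WalkPos} (h : s.p = e + 1) : E.advance c e s = s := by
  simp [advance, h]

theorem trace_zero {j : ℕ} :
    E.trace c e j 0 = ⟨j + 1, E.other j (E.W e), c e, c j⟩ := rfl

theorem trace_succ {j i : ℕ} : E.trace c e j (i + 1) = E.advance c e (E.trace c e j i) :=
  Function.iterate_succ_apply' _ _ _

/-- A walk that has closed or is stuck rests forever, which lets the machine always run exactly n
steps without testing for the end. -/
theorem trace_fixed {j i k : ℕ} (h : E.advance c e (E.trace c e j i) = E.trace c e j i)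
    (hk : i ≤ k) : E.trace c e j k = E.trace c e j i := by
  induction k, hk using Nat.le_induction with
  | base => rfl
  | succ k _ ih => rw [trace_succ, ih, h]

/-! ### Structure of closed alternating walks -/

/-- The alternating closed walk behind `Closes`. -/
structure IsAltWalk (E : EdgeArray) (c : ℕ → ℕ) (e m : ℕ) (p w : ℕ → ℕ) : Prop where
  w_zero : w 0 = E.W e
  p_last : p m = e
  p_ne : ∀ i < m, p i ≠ e
  p_lt : ∀ i ≤ m, p i < E.n
  inc : ∀ i ≤ m, E.Inc (p i) (w i)
  w_succ : ∀ i ≤ m, w (i + 1) = E.other (p i) (w i)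
  color : ∀ i, i + 2 ≤ m → c (p (i + 2)) = c (p i)
  color_one : 0 < m → c (p 1) = c e
  color_zero : c (p 0) ≠ c e
  ne_zero : ∀ i ≤ m, c (p i) ≠ 0

/-- Cut the trace at its first return to e. Before that time it can never be stuck, and the
remembered pair of colors alternates, which gives the period two of the colors. Here `p i` is the
i-th edge and `w i` the vertex from which it is entered. -/
theorem exists_isAltWalk (hc : E.Proper c) {j : ℕ} (he : e < E.n) (hce : c e ≠ 0) (hj : j < E.n)
    (h : E.Closes c e j) :
    ∃ (m : ℕ) (p w : ℕ → ℕ), E.IsAltWalk c e m p w ∧ m ≤ E.n ∧ p 0 = j ∧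
      (∀ i ≤ m, (E.trace c e j i).p = p i + 1) ∧
      (∀ i, m ≤ i → (E.trace c e j i).p = e + 1) := by
  classical
  obtain ⟨hcj, hje, hinc, hn⟩ := h
  have hex : ∃ i, (E.trace c e j i).p = e + 1 := ⟨_, hn⟩
  set m := Nat.find hex with hm
  have hmp : (E.trace c e j m).p = e + 1 := Nat.find_spec hex
  have hlt : ∀ i < m, (E.trace c e j i).p ≠ e + 1 := fun i hi => Nat.find_min hex hi
  have hmn : m ≤ E.n := Nat.find_min' hex hn
  have hend : ∀ i, m ≤ i → E.trace c e j i = E.trace c e j m := fun i hi =>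
    trace_fixed (advance_end hmp) hi
  -- A position that does not move would be kept forever, so the trace would never reach e.
  have hmove : ∀ i < m, ∃ q, q < E.n ∧ c q = (E.trace c e j i).y ∧ E.Inc q (E.trace c e j i).w ∧
      E.trace c e j (i + 1) = ⟨q + 1, E.other q (E.trace c e j i).w, (E.trace c e j i).z,
        (E.trace c e j i).y⟩ := by
    intro i hi
    have hne : E.advance c e (E.trace c e j i) ≠ E.trace c e j i := by
      intro h
      have := trace_fixed h hi.le
      exact hlt i hi (by rw [← this, hmp])
    rw [trace_succ]
    unfold advance at hne ⊢
    rw [if_neg (hlt i hi)] at hne ⊢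
    split_ifs at hne ⊢ with h0
    · exact absurd rfl hne
    · obtain ⟨h1, h2, h3⟩ := firstIdx_pred_spec h0
      refine ⟨_, h1, h2, h3, ?_⟩
      congr 1
      omega
  have hinv : ∀ i ≤ m, (E.trace c e j i).p - 1 < E.n ∧ (E.trace c e j i).p ≠ 0 ∧
      c ((E.trace c e j i).p - 1) = (E.trace c e j i).z ∧
      ((E.trace c e j i).y ≠ 0 ∧ (E.trace c e j i).z ≠ 0) := by
    intro i hi
    induction i with
    | zero => simp [trace_zero, hj, hcj, hce]
    | succ i ih =>
      obtain ⟨q, h1, h2, h3, h4⟩ := hmove i hi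
      obtain ⟨-, -, -, h5, h6⟩ := ih (by omega)
      rw [h4]
      simp [h1, h2, h5, h6]
  refine ⟨m, fun i => (E.trace c e j i).p - 1,
    fun i => if i = 0 then E.W e else (E.trace c e j (i - 1)).w, ⟨?_, ?_, ?_, ?_, ?_, ?_, ?_, ?_,
    ?_, ?_⟩, hmn, ?_, ?_, ?_⟩
  · simp
  · simp [hmp]
  · intro i hi h
    have := hlt i hi
    have := hinv i hi.le
    omega
  · exact fun i hi => (hinv i hi).1
  · intro i hi
    rcases i with _ | i
    · simpa [trace_zero] using hinc
    · obtain ⟨q, h1, h2, h3, h4⟩ := hmove i hi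
      simpa [h4] using h3
  · intro i hi
    rcases i with _ | i
    · simp [trace_zero]
    · obtain ⟨q, h1, h2, h3, h4⟩ := hmove i hi
      simp [h4]
  · intro i hi
    have h2 := (hinv (i + 2) hi).2.2.1
    have h0 := (hinv i (by omega)).2.2.1
    obtain ⟨q, -, -, -, h4⟩ := hmove (i + 1) (by omega)
    obtain ⟨q', -, -, -, h4'⟩ := hmove i (by omega)
    rw [h2, h0, h4, h4']
  · intro h0
    have h2 := (hinv 1 h0).2.2.1
    obtain ⟨q', -, -, -, h4'⟩ := hmove 0 (by omega)
    rw [h2, h4']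
    simp [trace_zero]
  · simp only [trace_zero, Nat.add_sub_cancel]
    exact fun h => hje (hc j hj e he _ hcj h hinc (.inr rfl))
  · intro i hi
    have := hinv i hi
    rw [this.2.2.1]
    exact this.2.2.2.2
  · simp [trace_zero]
  · intro i hi
    have := (hinv i hi).2.1
    change (E.trace c e j i).p = (E.trace c e j i).p - 1 + 1
    omega
  · intro i hi
    rw [hend i hi, hmp]

namespace IsAltWalk

variable {m : ℕ} {p w : ℕ → ℕ}

/-- Exactly two colors occur, alternately; parity of indices therefore stands for equality of colors
in all arguments below. -/
theorem color_eq (h : E.IsAltWalk c e m p w) {i j : ℕ} (hi : i ≤ m) (hj : j ≤ m) :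
    c (p i) = c (p j) ↔ i % 2 = j % 2 := by
  have key : ∀ i ≤ m, c (p i) = c (p (i % 2)) := by
    intro i
    induction i using Nat.twoStepInduction with
    | zero => simp
    | one => simp
    | more i ih _ =>
      intro hi
      rw [h.color i hi, ih (by omega)]
      congr 2
      omega
  have h01 : 0 < m → c (p 0) ≠ c (p 1) := fun h0 => by
    rw [h.color_one h0]; exact h.color_zero
  rw [key i hi, key j hj]
  rcases Nat.mod_two_eq_zero_or_one i with h1 | h1 <;>
    rcases Nat.mod_two_eq_zero_or_one j with h2 | h2 <;> rw [h1, h2] <;> simp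
  · exact h01 (by omega)
  · exact (h01 (by omega)).symm

theorem inc_succ (h : E.IsAltWalk c e m p w) {i : ℕ} (hi : i ≤ m) : E.Inc (p i) (w (i + 1)) := by
  rw [h.w_succ i hi]
  exact inc_other (h.inc i hi)

/-- The edges of an alternating walk are distinct. -/
theorem injOn (h : E.IsAltWalk c e m p w) (hE : E.Simple) (hc : E.Proper c) :
    ∀ j ≤ m, ∀ i < j, p i ≠ p j := by
  have he : e < E.n := by have := h.p_lt m le_rfl; rwa [h.p_last] at this
  intro j
  induction j using Nat.strong_induction_on with
  | _ j ih =>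
  intro hj i hij heq
  have hpar := (h.color_eq (hij.le.trans hj) hj).1 (by rw [heq])
  have hi2 : i + 2 ≤ j := by omega
  obtain ⟨k, rfl⟩ : ∃ k, j = k + 1 := ⟨j - 1, by omega⟩
  have hk : E.Inc (p k) (w (k + 1)) := h.inc_succ (by omega)
  have hk' : E.Inc (p i) (w (k + 1)) := by rw [heq]; exact h.inc _ hj
  -- Let j = k + 1 be minimal with a repetition `p i = p j`. The vertex `w j` is one of the two ends
  -- of `p i`. At that end `p k` has the same color as the neighbor of `p i` on the walk (`p (i -
  -- 1)`, or e when i = 0, or `p (i + 1)`), so by properness they coincide. This is an earlier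
  -- repetition, an early return to e, or, when k = i + 1, an edge with equal ends.
  rcases eq_or_eq_other (h.inc i (by omega)) hk' with hw | hw
  · rcases i with _ | i
    · have : p k = e := by
        refine hc _ (h.p_lt k (by omega)) _ he _ (h.ne_zero k (by omega)) ?_
          (by rw [hw, h.w_zero] at hk; exact hk) (.inr rfl)
        rw [← h.color_one (by omega)]
        exact (h.color_eq (by omega) (by omega)).2 (by omega)
      exact h.p_ne k (by omega) this
    · refine ih k (by omega) (by omega) i (by omega) ?_
      refine hc _ (h.p_lt i (by omega)) _ (h.p_lt k (by omega)) (w (i + 1))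
        (h.ne_zero _ (by omega)) ((h.color_eq (by omega) (by omega)).2 (by omega))
        (h.inc_succ (by omega)) ?_
      rwa [hw] at hk
  · rw [← h.w_succ i (by omega)] at hw
    have heq' : p (i + 1) = p k := by
      refine hc _ (h.p_lt _ (by omega)) _ (h.p_lt k (by omega)) (w (i + 1))
        (h.ne_zero _ (by omega)) ((h.color_eq (by omega) (by omega)).2 (by omega))
        (h.inc _ (by omega)) ?_
      rwa [hw] at hk
    rcases Nat.lt_or_ge (i + 1) k with hlt | hge
    · exact ih k (by omega) (by omega) (i + 1) hlt heq'
    · obtain rfl : k = i + 1 := by omega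
      have := hE.other_ne (h.p_lt (i + 1) (by omega)) (h.inc (i + 1) (by omega))
      rw [← h.w_succ (i + 1) (by omega)] at this
      exact this hw

theorem eq_of_eq (h : E.IsAltWalk c e m p w) (hE : E.Simple) (hc : E.Proper c) {i j : ℕ}
    (hi : i ≤ m) (hj : j ≤ m) (hij : p i = p j) : i = j := by
  rcases lt_trichotomy i j with hlt | heq | hgt
  · exact absurd hij (h.injOn hE hc j hj i hlt)
  · exact heq
  · exact absurd hij.symm (h.injOn hE hc i hi j hgt)

/-- Since `p 1` and `p m = e` have the same color, m is odd. If m were 1, then `p 0` and e would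
join the same two vertices. Consequently e lies beyond the two edges that keep their colors. -/
theorem three_le (h : E.IsAltWalk c e m p w) (hE : E.Simple) : 3 ≤ m := by
  have he : e < E.n := by have := h.p_lt m le_rfl; rwa [h.p_last] at this
  have h0 : m ≠ 0 := by
    rintro rfl
    exact h.color_zero (by rw [h.p_last])
  have hodd : m % 2 = 1 := by
    have := (h.color_eq (i := 1) (by omega) le_rfl).1 (by rw [h.color_one (by omega), h.p_last])
    omega
  have h1 : m ≠ 1 := by
    rintro rfl
    refine h.p_ne 0 (by omega) (hE.inj _ (h.p_lt 0 (by omega)) _ he (w 0) (w 1) ?_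
      (h.inc 0 (by omega)) (h.inc_succ (by omega)) ?_ ?_)
    · rw [h.w_succ 0 (by omega)]
      exact (hE.other_ne (h.p_lt 0 (by omega)) (h.inc 0 (by omega))).symm
    · rw [h.w_zero]; exact .inr rfl
    · rw [← h.p_last]; exact h.inc 1 le_rfl
  omega

/-- The walk arrives at `e` from the endpoint `U e`. -/
theorem w_last (h : E.IsAltWalk c e m p w) (hE : E.Simple) (hc : E.Proper c) : w m = E.U e := by
  have hm := h.three_le hE
  have hinc := h.inc m le_rfl
  rw [h.p_last] at hinc
  refine (hinc.resolve_right fun hW => ?_).symm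
  have hpar : m % 2 = 1 := by
    have := (h.color_eq (i := 1) (by omega) le_rfl).1 (by rw [h.color_one (by omega), h.p_last])
    omega
  -- If e were entered from `W e`, then `p (m - 1)` and `p 0` would be edges at `W e` of the same
  -- color, hence equal, which contradicts the distinctness of the edges.
  have : p 0 = p (m - 1) := by
    refine hc _ (h.p_lt _ (by omega)) _ (h.p_lt _ (by omega)) (E.W e) (h.ne_zero 0 (by omega))
      ((h.color_eq (by omega) (by omega)).2 (by omega)) ?_ ?_
    · rw [← h.w_zero]; exact h.inc 0 (by omega)
    · have := h.inc_succ (i := m - 1) (by omega)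
      rwa [Nat.sub_add_cancel (by omega), ← hW] at this
  have := h.eq_of_eq hE hc (by omega) (by omega) this
  omega

end IsAltWalk

end EdgeArray

/-! ### Records of rounds: reversibility and counting -/

namespace EdgeArray

/-- `c` results from `c₁` by removing the colors of the edges `l[2], l[3], …`, and `c₁` can be
recovered from `c` and `l`, since the colors along `l` have period two. -/
structure Undo (E : EdgeArray) (c₁ c : ℕ → ℕ) (l : List ℕ) : Prop where
  result : ∀ q, c q = if q ∈ l.drop 2 then 0 else c₁ q
  periodic : ∀ i (h : i + 2 < l.length), c₁ l[i + 2] = c₁ l[i]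
  keep : ∀ i (h : i < l.length), i < 2 → l[i] ∉ l.drop 2
  nodup : (l.drop 2).Nodup
  colored : ∀ q ∈ l.drop 2, q < E.n ∧ c₁ q ≠ 0

variable {E : EdgeArray} {c : ℕ → ℕ} {e : ℕ}

/-- The first two edges of l keep their colors, so these can be read off from c; period two then
transports them to all erased edges, and off l nothing was erased. -/
theorem Undo.unique {c₁ c₁' : ℕ → ℕ} {l : List ℕ} (h : E.Undo c₁ c l) (h' : E.Undo c₁' c l) :
    c₁ = c₁' := by
  have key : ∀ i (hi : i < l.length), c₁ l[i] = c₁' l[i] := by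
    intro i
    induction i using Nat.strong_induction_on with
    | _ i ih =>
    intro hi
    rcases Nat.lt_or_ge i 2 with h2 | h2
    · have h1 := h.result l[i]
      have h1' := h'.result l[i]
      rw [if_neg (h.keep i hi h2)] at h1 h1'
      rw [← h1, h1']
    · obtain ⟨k, rfl⟩ := Nat.exists_eq_add_of_le' h2
      rw [h.periodic k hi, h'.periodic k hi]
      exact ih k (by omega) _
  funext q
  by_cases hq : q ∈ l.drop 2
  · obtain ⟨i, hi, rfl⟩ := List.getElem_of_mem (List.mem_of_mem_drop hq)
    exact key i hi
  · have h1 := h.result q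
    have h1' := h'.result q
    rw [if_neg hq] at h1 h1'
    rw [← h1, h1']

/-- The edge sequences of the walks of length `d` from the vertex `w`. -/
noncomputable def walks (E : EdgeArray) : ℕ → ℕ → Finset (List ℕ)
  | _, 0 => {[]}
  | w, d + 1 => (E.star w).biUnion fun j => (E.walks (E.other j w) d).image (List.cons j)

/-- The last vertex of the walk from `w` along a list of edges. -/
def endpoint (E : EdgeArray) : ℕ → List ℕ → ℕ
  | w, [] => w
  | w, j :: l => E.endpoint (E.other j w) l

/-- The edge that joins two given vertices. -/
noncomputable def join (E : EdgeArray) (x u : ℕ) : ℕ :=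
  firstIdx E.n (fun j => E.Inc j x ∧ E.Inc j u) - 1

/-- The possible records of a round that colors the edge `e`: success, a conflict with an adjacent
edge, or a two-colored cycle through `e`. -/
noncomputable def tags (E : EdgeArray) (e : ℕ) : Finset (List ℕ) :=
  insert [] ((E.star (E.U e) ∪ E.star (E.W e)).image (fun f => [f, f, e]) ∪
    (Finset.Icc 2 E.n).biUnion fun d =>
      (E.walks (E.W e) d).image fun l => l ++ [E.join (E.endpoint (E.W e) l) (E.U e), e])

theorem length_of_mem_walks {d w : ℕ} {l : List ℕ} (h : l ∈ E.walks w d) : l.length = d := by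
  induction d generalizing w l with
  | zero => simp_all [walks]
  | succ d ih =>
    simp only [walks, Finset.mem_biUnion, Finset.mem_image] at h
    obtain ⟨j, -, l', hl', rfl⟩ := h
    simp [ih hl']

theorem card_walks_le {Δ : ℕ} (hΔ : ∀ w, (E.star w).card ≤ Δ) (d w : ℕ) :
    (E.walks w d).card ≤ Δ ^ d := by
  induction d generalizing w with
  | zero => simp [walks]
  | succ d ih =>
    rw [walks, pow_succ']
    refine (Finset.card_biUnion_le_card_mul _ _ (Δ ^ d) fun j _ =>
      Finset.card_image_le.trans (ih _)).trans ?_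
    exact Nat.mul_le_mul_right _ (hΔ w)

/-- Connects the indexed walks above with the finite set that is counted; the end vertex is needed
to reconstruct the closing edge. -/
theorem map_mem_walks {p w : ℕ → ℕ} {d : ℕ} (hlt : ∀ i < d, p i < E.n)
    (hinc : ∀ i < d, E.Inc (p i) (w i)) (hw : ∀ i < d, w (i + 1) = E.other (p i) (w i)) :
    (List.range d).map p ∈ E.walks (w 0) d ∧ E.endpoint (w 0) ((List.range d).map p) = w d := by
  induction d generalizing p w with
  | zero => simp [walks, endpoint]
  | succ d ih =>
    have := ih (p := fun i => p (i + 1)) (w := fun i => w (i + 1))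
      (fun i hi => hlt _ (by omega)) (fun i hi => hinc _ (by omega)) (fun i hi => hw _ (by omega))
    simp only [zero_add, hw 0 (by omega)] at this
    rw [List.range_succ_eq_map, List.map_cons, List.map_map]
    refine ⟨?_, this.2⟩
    rw [walks, Finset.mem_biUnion]
    exact ⟨p 0, mem_star.2 ⟨hlt 0 (by omega), hinc 0 (by omega)⟩,
      Finset.mem_image_of_mem _ this.1⟩

theorem _root_.Finset.sum_union_le_real {ι : Type*} [DecidableEq ι] {f : ι → ℝ}
    (hf : ∀ i, 0 ≤ f i) (s t : Finset ι) : ∑ i ∈ s ∪ t, f i ≤ ∑ i ∈ s, f i + ∑ i ∈ t, f i := by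
  rw [← Finset.sum_union_inter]
  exact le_add_of_nonneg_right (Finset.sum_nonneg fun i _ => hf i)

theorem _root_.Finset.sum_biUnion_le_real {ι κ : Type*} [DecidableEq ι] [DecidableEq κ]
    {f : ι → ℝ} (hf : ∀ i, 0 ≤ f i) (s : Finset κ) (t : κ → Finset ι) :
    ∑ i ∈ s.biUnion t, f i ≤ ∑ k ∈ s, ∑ i ∈ t k, f i := by
  induction s using Finset.induction_on with
  | empty => simp
  | insert k s hk ih =>
    rw [Finset.biUnion_insert, Finset.sum_insert hk]
    exact (Finset.sum_union_le_real hf _ _).trans (by gcongr)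

/-- The total weight of the possible records of a round. -/
theorem sum_tags_le {Δ : ℕ} (hΔ : ∀ w, (E.star w).card ≤ Δ) {r : ℝ} (hr : 0 ≤ r)
    (hΔr : Δ * r ≤ 1 / 4) : ∑ l ∈ E.tags e, r ^ (l.length - 2) ≤ 19 / 12 := by
  have hf : ∀ l : List ℕ, 0 ≤ r ^ (l.length - 2) := fun l => pow_nonneg hr _
  -- Conflicts: at most 2Δ records, each of weight r.
  have h1 : ∑ l ∈ (E.star (E.U e) ∪ E.star (E.W e)).image (fun f => [f, f, e]),
      r ^ (l.length - 2) ≤ 1 / 2 := by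
    have : ∑ l ∈ (E.star (E.U e) ∪ E.star (E.W e)).image (fun f => [f, f, e]),
        r ^ (l.length - 2) ≤ ((E.star (E.U e) ∪ E.star (E.W e)).image
          (fun f => [f, f, e])).card • r := by
      refine Finset.sum_le_card_nsmul _ _ _ fun l hl => ?_
      obtain ⟨f, -, rfl⟩ := Finset.mem_image.1 hl
      simp
    refine this.trans ?_
    have hcard : ((E.star (E.U e) ∪ E.star (E.W e)).image (fun f => [f, f, e])).card ≤ Δ + Δ :=
      Finset.card_image_le.trans ((Finset.card_union_le _ _).trans
        (add_le_add (hΔ _) (hΔ _)))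
    have hcard' : (((E.star (E.U e) ∪ E.star (E.W e)).image
      (fun f => [f, f, e])).card : ℝ) ≤ Δ + Δ := by exact_mod_cast hcard
    rw [nsmul_eq_mul]
    nlinarith
  -- Cycles: at most Δ^d walks. The two forced edges at the end make the record d + 2 long, so its
  -- weight is r^d.
  have h2 : ∀ d ∈ Finset.Icc 2 E.n, ∑ l ∈ (E.walks (E.W e) d).image
      (fun l => l ++ [E.join (E.endpoint (E.W e) l) (E.U e), e]), r ^ (l.length - 2) ≤
      (1 / 4) ^ d := by
    intro d _
    have : ∑ l ∈ (E.walks (E.W e) d).image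
        (fun l => l ++ [E.join (E.endpoint (E.W e) l) (E.U e), e]), r ^ (l.length - 2) ≤
        ((E.walks (E.W e) d).image
        (fun l => l ++ [E.join (E.endpoint (E.W e) l) (E.U e), e])).card • r ^ d := by
      refine Finset.sum_le_card_nsmul _ _ _ fun l hl => ?_
      obtain ⟨l', hl', rfl⟩ := Finset.mem_image.1 hl
      simp [length_of_mem_walks hl']
    refine this.trans ?_
    rw [nsmul_eq_mul]
    calc _ ≤ (Δ : ℝ) ^ d * r ^ d := by
          gcongr
          exact_mod_cast Finset.card_image_le.trans (card_walks_le hΔ d _)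
      _ = (Δ * r) ^ d := (mul_pow _ _ _).symm
      _ ≤ _ := by gcongr
  -- The geometric tail (1/16)/(3/4) = 1/12; with 1 for success and 1/2 for conflicts it makes up
  -- 19/12.
  have h3 : ∀ n : ℕ, ∑ d ∈ Finset.Icc 2 n, ((1 : ℝ) / 4) ^ d ≤ 1 / 12 := by
    intro n
    have hg := geom_sum_Ico_le_of_lt_one (m := 2) (n := n + 1) (x := (1 / 4 : ℝ)) (by norm_num)
      (by norm_num)
    have : Finset.Ico 2 (n + 1) = Finset.Icc 2 n := by ext; simp
    rw [this] at hg
    refine hg.trans ?_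
    norm_num
  have h4 : ∑ l ∈ ({[]} : Finset (List ℕ)), r ^ (l.length - 2) = 1 := by simp
  rw [tags, Finset.insert_eq]
  refine (Finset.sum_union_le_real hf _ _).trans ?_
  refine (add_le_add_right ((Finset.sum_union_le_real hf _ _).trans (add_le_add h1
    ((Finset.sum_biUnion_le_real hf _ _).trans ((Finset.sum_le_sum h2).trans
      (h3 _))))) _).trans ?_
  rw [h4]
  norm_num

/-- The record lists all m + 1 edges of the cycle from j to e. It is a cycle tag with d = m - 1:
only the first m - 1 edges are free, because the next one must join the vertex reached to `U e` and
the last one is e. The number of free edges thus equals the number m - 1 of erased ones. -/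
theorem undo_uncolor (hE : E.Simple) (hc : E.Proper c) {j : ℕ} (he : e < E.n) (hce : c e ≠ 0)
    (hj : j < E.n) (h : E.Closes c e j) :
    ∃ l ∈ E.tags e, E.Undo c (E.uncolor c e j) l := by
  obtain ⟨m, p, w, hw, hmn, hp0, hp, hend⟩ := exists_isAltWalk hc he hce hj h
  have hm := hw.three_le hE
  have hwm := hw.w_last hE hc
  set l := (List.range (m + 1)).map p with hl
  have hlen : l.length = m + 1 := by simp [hl]
  have hget : ∀ i (hi : i < l.length), l[i] = p i := fun i hi => by simp [hl]
  have hdrop : ∀ q, q ∈ l.drop 2 ↔ ∃ i, 2 ≤ i ∧ i ≤ m ∧ p i = q := by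
    intro q
    rw [List.mem_drop_iff_getElem]
    constructor
    · rintro ⟨i, hi, rfl⟩
      exact ⟨i + 2, by omega, by omega, by rw [hget]; congr 1; omega⟩
    · rintro ⟨i, h2, him, rfl⟩
      exact ⟨i - 2, by omega, by simp only [hget]; congr 1; omega⟩
  refine ⟨l, ?_, ⟨?_, ?_, ?_, ?_, ?_⟩⟩
  · rw [tags, Finset.mem_insert, Finset.mem_union]
    refine .inr (.inr (Finset.mem_biUnion.2 ⟨m - 1, Finset.mem_Icc.2 ⟨by omega, by omega⟩,
      Finset.mem_image.2 ⟨(List.range (m - 1)).map p, ?_, ?_⟩⟩))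
    · rw [← hw.w_zero]
      exact (map_mem_walks (fun i hi => hw.p_lt i (by omega)) (fun i hi => hw.inc i (by omega))
        (fun i hi => hw.w_succ i (by omega))).1
    · have hend := (map_mem_walks (d := m - 1) (fun i hi => hw.p_lt i (by omega))
        (fun i hi => hw.inc i (by omega)) (fun i hi => hw.w_succ i (by omega))).2
      rw [← hw.w_zero, hend]
      have hinc := hw.inc (m - 1) (by omega)
      have hinc' := hw.inc_succ (i := m - 1) (by omega)
      have hne := hE.other_ne (hw.p_lt (m - 1) (by omega)) hinc
      rw [← hw.w_succ _ (by omega)] at hne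
      rw [Nat.sub_add_cancel (by omega), hwm] at hinc' hne
      have hjoin : E.join (w (m - 1)) (E.U e) = p (m - 1) := by
        rw [join, firstIdx_eq_of_unique (hw.p_lt (m - 1) (by omega)) ⟨hinc, hinc'⟩
          fun i hi hi' => hE.inj i hi _ (hw.p_lt (m - 1) (by omega)) _ _ hne hi'.2 hi'.1
            hinc' hinc, Nat.add_sub_cancel]
      rw [hjoin, hl]
      obtain ⟨k, rfl⟩ : ∃ k, m = k + 1 := ⟨m - 1, by omega⟩
      rw [List.range_succ, List.range_succ]
      simp [hw.p_last]
  · intro q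
    have hiff : (∃ i, 2 ≤ i ∧ i ≤ E.n ∧ (E.trace c e j i).p = q + 1) ↔ q ∈ l.drop 2 := by
      rw [hdrop]
      constructor
      · rintro ⟨i, h2, hin, hiq⟩
        -- After its return the trace rests on e, which is `p m` and is erased anyway since 2 ≤ m.
        rcases Nat.lt_or_ge m i with hmi | hmi
        · rw [hend i hmi.le] at hiq
          exact ⟨m, by omega, le_rfl, by rw [hw.p_last]; omega⟩
        · rw [hp i hmi] at hiq
          exact ⟨i, h2, hmi, by omega⟩
      · rintro ⟨i, h2, hin, rfl⟩
        exact ⟨i, h2, by omega, hp i hin⟩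
    by_cases hq : q ∈ l.drop 2
    · rw [if_pos hq]
      exact if_pos (hiff.2 hq)
    · rw [if_neg hq]
      exact if_neg (hiff.not.2 hq)
  · intro i hi
    rw [hget, hget]
    exact hw.color i (by omega)
  · intro i hi h2 hmem
    rw [hdrop, hget] at hmem
    obtain ⟨k, hk2, hkm, hk⟩ := hmem
    have := hw.eq_of_eq hE hc hkm (by omega) hk
    omega
  · refine List.Nodup.sublist (List.drop_sublist _ _) ?_
    rw [hl]
    refine List.Nodup.map_on (fun a ha b hb hab => ?_) List.nodup_range
    rw [List.mem_range] at ha hb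
    exact hw.eq_of_eq hE hc (by omega) (by omega) hab
  · intro q hq
    obtain ⟨i, -, him, rfl⟩ := (hdrop q).1 hq
    exact ⟨hw.p_lt i him, hw.ne_zero i him⟩

theorem proper_update (hc : E.Proper c) {a : ℕ} (h : firstIdx E.n (E.Conflict c e a) = 0) :
    E.Proper (Function.update c e a) := by
  rw [firstIdx_eq_zero] at h
  have key : ∀ j < E.n, ∀ w, c j = a → E.Inc j w → E.Inc e w → False := by
    intro j hj w hja hjw hew
    refine h j hj ⟨hja, ?_⟩
    rcases hew with rfl | rfl
    · exact .inl hjw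
    · exact .inr hjw
  intro i hi j hj w hi0 hij hiw hjw
  by_cases hie : i = e <;> by_cases hje : j = e
  · rw [hie, hje]
  · subst hie
    simp only [Function.update_self, Function.update_of_ne hje] at hij
    exact (key j hj w hij.symm hjw hiw).elim
  · subst hje
    simp only [Function.update_self, Function.update_of_ne hie] at hij
    exact (key i hi w hij hiw hjw).elim
  · simp only [Function.update_of_ne hie, Function.update_of_ne hje] at hi0 hij
    exact hc i hi j hj w hi0 hij hiw hjw

/-- Erasing colors cannot create a conflict, as 0 does not count as a color. -/
theorem Proper.of_le {c c' : ℕ → ℕ} (hc : E.Proper c) (h : ∀ q, c' q = 0 ∨ c' q = c q) :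
    E.Proper c' := by
  intro i hi j hj w hi0 hij hiw hjw
  have h1 := (h i).resolve_left hi0
  have h2 := (h j).resolve_left (by rwa [← hij])
  exact hc i hi j hj w (by rwa [← h1]) (by rw [← h1, hij, h2]) hiw hjw

theorem uncolor_eq_zero_or (c : ℕ → ℕ) (e j q : ℕ) :
    E.uncolor c e j q = 0 ∨ E.uncolor c e j q = c q := by
  unfold uncolor
  split_ifs <;> simp

/-- Every round leaves a record. -/
theorem exists_undo_round (hE : E.Simple) (hc : E.Proper c) {a : ℕ} (he : e < E.n)
    (hce : c e = 0) (ha : a ≠ 0) :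
    ∃ l ∈ E.tags e, E.Undo (Function.update c e a) (E.round c e a) l := by
  unfold round
  split_ifs with h1 h2
  · obtain ⟨hf, hfa, hfe⟩ := firstIdx_pred_spec h1
    generalize firstIdx E.n (E.Conflict c e a) - 1 = f at hf hfa hfe
    have hne : f ≠ e := by rintro rfl; exact ha (by rw [← hfa, hce])
    -- A conflict is treated as coloring e with a and erasing it again. Repeating f puts e at index
    -- 2, where period two reads its color a from the entry f at index 0, which still has it.
    refine ⟨[f, f, e], ?_, ⟨?_, ?_, ?_, ?_, ?_⟩⟩
    · rw [tags, Finset.mem_insert, Finset.mem_union]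
      refine .inr (.inl (Finset.mem_image_of_mem _ ?_))
      simp only [Finset.mem_union, mem_star]
      tauto
    · intro q
      by_cases hq : q = e <;> simp [hq, hce]
    · intro i hi
      obtain rfl : i = 0 := by simp at hi; omega
      simp [hne, hfa]
    · intro i hi h2
      interval_cases i <;> simpa
    · simp
    · simp [he, ha]
  · refine ⟨[], by simp [tags], ⟨by simp, by simp, by simp, by simp, by simp⟩⟩
  · rw [ne_eq, not_not] at h1
    exact undo_uncolor hE (proper_update hc h1) he (by simpa) (firstIdx_pred_spec h2).1
      (firstIdx_pred_spec h2).2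

theorem proper_round (hc : E.Proper c) (a : ℕ) : E.Proper (E.round c e a) := by
  unfold round
  split_ifs with h1 h2
  · exact hc
  · exact proper_update hc (by simpa using h1)
  · exact (proper_update hc (by simpa using h1)).of_le (uncolor_eq_zero_or _ _ _)

end EdgeArray

/-! ### No two-colored cycle ever survives a round -/

namespace EdgeArray

/-- The edge array `E` represents the graph `G`, where `ed i` is the `i`-th edge. -/
structure Represents {v : ℕ} (E : EdgeArray) (G : SimpleGraph (Fin v)) (ed : Fin E.n → Sym2 (Fin v)) :
    Prop where
  mem : ∀ i, ed i ∈ G.edgeSet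
  surj : ∀ f ∈ G.edgeSet, ∃ i, ed i = f
  inj : Function.Injective ed
  inc : ∀ (i : Fin E.n) (x : Fin v), E.Inc i x ↔ x ∈ ed i
  lt : ∀ i : Fin E.n, E.U i < v ∧ E.W i < v

/-- No cycle has only edges of two given colors. -/
def NoBichromaticCycle {v : ℕ} (E : EdgeArray) (G : SimpleGraph (Fin v))
    (ed : Fin E.n → Sym2 (Fin v)) (c : ℕ → ℕ) : Prop :=
  ∀ a b, a ≠ 0 → b ≠ 0 → ∀ (u : Fin v) (w : G.Walk u u), w.IsCycle →
    ∃ i : Fin E.n, ed i ∈ w.edges ∧ c i ≠ a ∧ c i ≠ b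

variable {v : ℕ} {E : EdgeArray} {G : SimpleGraph (Fin v)} {ed : Fin E.n → Sym2 (Fin v)}
  {c : ℕ → ℕ}

theorem Inc.lt (hR : E.Represents G ed) {i w : ℕ} (hi : i < E.n) (h : E.Inc i w) : w < v := by
  have := hR.lt ⟨i, hi⟩
  simp only at this
  rcases h with h | h <;> omega

theorem Represents.simple (hR : E.Represents G ed) : E.Simple where
  loopless i hi h := by
    have hU := hR.lt ⟨i, hi⟩
    have hm := hR.mem ⟨i, hi⟩
    have h1 := hR.inc ⟨i, hi⟩
    generalize ed ⟨i, hi⟩ = f at hm h1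
    induction f with
    | _ x y =>
      have hx := (h1 x).2 (by simp)
      have hy := (h1 y).2 (by simp)
      rw [SimpleGraph.mem_edgeSet] at hm
      refine hm.ne (Fin.ext ?_)
      unfold Inc at hx hy
      simp only at hx hy
      omega
  inj i hi j hj w w' hne h1 h2 h3 h4 := by
    have hw := h1.lt hR hi
    have hw' := h2.lt hR hi
    have e1 := (hR.inc ⟨i, hi⟩ ⟨w, hw⟩).1 h1
    have e2 := (hR.inc ⟨i, hi⟩ ⟨w', hw'⟩).1 h2
    have e3 := (hR.inc ⟨j, hj⟩ ⟨w, hw⟩).1 h3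
    have e4 := (hR.inc ⟨j, hj⟩ ⟨w', hw'⟩).1 h4
    have hne' : (⟨w, hw⟩ : Fin v) ≠ ⟨w', hw'⟩ := by simpa using hne
    have := hR.inj (((Sym2.mem_and_mem_iff hne').1 ⟨e1, e2⟩).trans
      ((Sym2.mem_and_mem_iff hne').1 ⟨e3, e4⟩).symm)
    simpa using this

theorem NoBichromaticCycle.of_le (h : E.NoBichromaticCycle G ed c) {c' : ℕ → ℕ}
    (hle : ∀ q, c' q = 0 ∨ c' q = c q) : E.NoBichromaticCycle G ed c' := by
  intro a b ha hb u w hw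
  obtain ⟨i, hi, hia, hib⟩ := h a b ha hb u w hw
  refine ⟨i, hi, ?_⟩
  rcases hle i with h0 | h0 <;> rw [h0]
  · exact ⟨ha.symm, hb.symm⟩
  · exact ⟨hia, hib⟩

/-- In a proper coloring a vertex has at most one edge of a given color, so the search for the least
such edge has no choice. -/
theorem advance_of_inc (hc : E.Proper c) {e i p w y z : ℕ} (hi : i < E.n) (hy : y ≠ 0)
    (hci : c i = y) (hw : E.Inc i w) (hp : p ≠ e) :
    E.advance c e ⟨p + 1, w, y, z⟩ = ⟨i + 1, E.other i w, z, y⟩ := by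
  have : firstIdx E.n (fun j => c j = y ∧ E.Inc j w) = i + 1 :=
    firstIdx_eq_of_unique hi ⟨hci, hw⟩ fun k hk h =>
      hc k hk i hi w (by rw [h.1]; exact hy) (by rw [h.1, hci]) h.2 hw
  simp [advance, this, hp]

/-- The alternating walk follows every two-colored path to an endpoint of `e`. -/
theorem iterate_advance_of_path (hR : E.Represents G ed) (hc : E.Proper c) {e : Fin E.n}
    {u : Fin v} (hu : u ∈ ed e) : ∀ {x : Fin v} (q : G.Walk x u), q.IsPath →
    ∀ (p : Fin E.n) (y z : ℕ), x ∈ ed p → c p = z → p ≠ e → ed p ∉ q.edges → ed e ∉ q.edges →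
      (∀ i, ed i ∈ q.edges → c i = y ∨ c i = z) → (c e = y ∨ c e = z) → y ≠ 0 → z ≠ 0 →
      ((E.advance c e)^[q.length + 1] ⟨p + 1, x, y, z⟩).p = e + 1 := by
  intro x q
  induction q with
  | nil =>
    intro _ p y z hx hpz hpe _ _ _ he hy hz
    have hey : c e = y := by
      refine he.resolve_right fun h => hpe (Fin.ext ?_)
      exact hc p p.2 e e.2 _ (by omega) (by omega) ((hR.inc p _).2 hx) ((hR.inc e _).2 hu)
    rw [SimpleGraph.Walk.length_nil, zero_add, Function.iterate_one,
      advance_of_inc hc e.2 hy hey ((hR.inc e _).2 hu) (fun h => hpe (Fin.ext h))]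
  | @cons x x' u h q ih =>
    intro hq p y z hx hpz hpe hp heq hcol he hy hz
    rw [SimpleGraph.Walk.cons_isPath_iff] at hq
    simp only [SimpleGraph.Walk.edges_cons, List.mem_cons, not_or] at hp heq hcol
    obtain ⟨i, hi⟩ := hR.surj s(x, x') h
    have hix : x ∈ ed i := by rw [hi]; simp
    have hix' : x' ∈ ed i := by rw [hi]; simp
    have hiy : c i = y := by
      refine (hcol i (.inl hi)).resolve_right fun h => hp.1 ?_
      rw [← hi]
      congr 1
      refine Fin.ext ?_
      exact hc p p.2 i i.2 _ (by omega) (by omega) ((hR.inc p _).2 hx) ((hR.inc i _).2 hix)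
    have hother : E.other i x = x' := by
      refine (eq_other_of_ne ((hR.inc i _).2 hix) ((hR.inc i _).2 hix') fun h' => ?_).symm
      exact h.ne (Fin.ext h'.symm)
    rw [SimpleGraph.Walk.length_cons, Function.iterate_succ_apply,
      advance_of_inc hc i.2 hy hiy ((hR.inc i _).2 hix) (fun h => hpe (Fin.ext h)), hother]
    refine ih hu hq.1 i z y hix' hiy ?_ ?_ heq.2 ?_ he.symm hz hy
    · rintro rfl; exact heq.1 hi
    · intro hmem
      rw [hi] at hmem
      exact hq.2 (SimpleGraph.Walk.fst_mem_support_of_mem_edges _ hmem)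
    · exact fun k hk => (hcol k (.inr hk)).symm

/-- Guarantees that n steps are enough for the alternating walk to return. -/
theorem Represents.length_le (hR : E.Represents G ed) {x y : Fin v} (q : G.Walk x y)
    (hq : q.IsPath) : q.length ≤ E.n := by
  classical
  rw [← q.length_edges, ← List.toFinset_card_of_nodup hq.isTrail.edges_nodup]
  calc _ ≤ (Finset.univ.image ed).card := by
        refine Finset.card_le_card fun f hf => ?_
        obtain ⟨i, hi⟩ := hR.surj f (q.edges_subset_edgeSet (List.mem_toFinset.1 hf))
        exact Finset.mem_image.2 ⟨i, Finset.mem_univ _, hi⟩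
    _ ≤ _ := Finset.card_image_le.trans (by simp)

/-- If coloring the edge `e` closes a two-colored cycle, then the algorithm notices. -/
theorem noBichromaticCycle_update (hR : E.Represents G ed) {e : Fin E.n} {a : ℕ}
    (h : E.NoBichromaticCycle G ed c) (hc : E.Proper (Function.update c e a))
    (hcl : firstIdx E.n (E.Closes (Function.update c e a) e) = 0) :
    E.NoBichromaticCycle G ed (Function.update c e a) := by
  classical
  intro a' b' ha' hb' u w hw
  by_contra! hcon
  have hcol : ∀ i, ed i ∈ w.edges →
      Function.update c (e : ℕ) a i = a' ∨ Function.update c (e : ℕ) a i = b' := fun i hi => by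
    by_cases h1 : Function.update c (e : ℕ) a i = a'
    · exact .inl h1
    · exact .inr (hcon i hi h1)
  by_cases hew : ed e ∈ w.edges
  · rw [firstIdx_eq_zero] at hcl
    generalize hc₁ : Function.update c (e : ℕ) a = c₁ at hcl hcol hc
    have hlt := hR.lt e
    have hne := hR.simple.loopless e e.2
    set x : Fin v := ⟨E.W e, hlt.2⟩ with hx
    set y : Fin v := ⟨E.U e, hlt.1⟩ with hy
    have hxe : x ∈ ed e := (hR.inc e x).1 (.inr rfl)
    have hye : y ∈ ed e := (hR.inc e y).1 (.inl rfl)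
    have hxy : x ≠ y := fun h' => hne (congrArg Fin.val h').symm
    have hed : ed e = s(x, y) := (Sym2.mem_and_mem_iff hxy).1 ⟨hxe, hye⟩
    have hxv : E.W e = x := rfl
    clear_value x y
    have hwH : ∀ f ∈ w.edges, f ∈ (SimpleGraph.fromEdgeSet {f | f ∈ w.edges}).edgeSet := by
      intro f hf
      rw [SimpleGraph.edgeSet_fromEdgeSet]
      exact ⟨hf, G.not_isDiag_of_mem_edgeSet (w.edges_subset_edgeSet hf)⟩
    -- Inside the graph formed by the edges of the cycle alone, e is not a bridge. This yields a
    -- path from `W e` to `U e` that uses only edges of the cycle other than e.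
    have hreach := (SimpleGraph.adj_and_reachable_delete_edges_iff_exists_cycle (v := x)
      (w := y)).2 ⟨u, w.transfer _ hwH, hw.transfer hwH, by
        rw [SimpleGraph.Walk.edges_transfer, ← hed]; exact hew⟩
    obtain ⟨q, hq⟩ := hreach.2.exists_isPath
    have hqe : ∀ f ∈ q.edges, f ∈ w.edges ∧ f ≠ ed e := by
      intro f hf
      have := q.edges_subset_edgeSet hf
      rw [SimpleGraph.edgeSet_deleteEdges, SimpleGraph.edgeSet_fromEdgeSet, ← hed] at this
      exact ⟨this.1.1, this.2⟩
    have hqG : ∀ f ∈ q.edges, f ∈ G.edgeSet := fun f hf => w.edges_subset_edgeSet (hqe f hf).1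
    have hq' := hq.transfer hqG
    have hedges := SimpleGraph.Walk.edges_transfer q hqG
    generalize q.transfer G hqG = r at hq' hedges
    rw [← hedges] at hqe
    have hrn := hR.length_le r hq'
    cases r with
    | nil => exact hxy rfl
    | @cons _ x' _ hadj r =>
      rw [SimpleGraph.Walk.cons_isPath_iff] at hq'
      simp only [SimpleGraph.Walk.edges_cons, List.mem_cons] at hqe
      obtain ⟨j, hj⟩ := hR.surj s(x, x') hadj
      have hjx : x ∈ ed j := by rw [hj]; simp
      have hjx' : x' ∈ ed j := by rw [hj]; simp
      have hje : j ≠ e := by rintro rfl; exact (hqe _ (.inl hj)).2 rfl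
      have hnz : ∀ i, ed i ∈ w.edges → c₁ i ≠ 0 := by
        intro i hi
        rcases hcol i hi with h1 | h1 <;> rw [h1] <;> assumption
      have hjw := (hqe _ (.inl hj)).1
      have hjc : c₁ j ≠ c₁ e := fun h' => hje (Fin.ext (hc j j.2 e e.2 _ (hnz j hjw) h'
        ((hR.inc j _).2 hjx) ((hR.inc e _).2 hxe)))
      -- The first edge j of the path and e have different colors, so these are the only two colors
      -- of the cycle.
      have hsub : ∀ i, ed i ∈ w.edges → c₁ i = c₁ e ∨ c₁ i = c₁ j := by
        intro i hi
        have h1 := hcol i hi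
        have h2 := hcol j hjw
        have h3 := hcol e hew
        omega
      have hother : E.other j x = x' := by
        refine (eq_other_of_ne ((hR.inc j _).2 hjx) ((hR.inc j _).2 hjx') fun h' => ?_).symm
        exact hadj.ne (Fin.ext h'.symm)
      have := iterate_advance_of_path hR hc hye r hq'.1 j (c₁ e) (c₁ j) hjx' rfl hje
        (fun hmem => by
          rw [hj] at hmem
          exact hq'.2 (SimpleGraph.Walk.fst_mem_support_of_mem_edges _ hmem))
        (fun hmem => (hqe _ (.inr hmem)).2 rfl)
        (fun i hi => hsub i (hqe _ (.inr hi)).1) (.inl rfl) (hnz e hew) (hnz j hjw)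
      rw [← hother, ← hxv] at this
      change (E.trace c₁ e j (r.length + 1)).p = e + 1 at this
      refine hcl j j.2 ⟨hnz j hjw, fun h' => hje (Fin.ext h'), hxv ▸ (hR.inc j _).2 hjx, ?_⟩
      rw [SimpleGraph.Walk.length_cons] at hrn
      -- The walk is back at e after at most n steps and rests there, so it is found at e after
      -- exactly n steps, as `Closes` demands.
      rw [trace_fixed (advance_end this) hrn, this]
  · obtain ⟨i, hi, hia, hib⟩ := h a' b' ha' hb' u w hw
    have hie : (i : ℕ) ≠ e := fun h' => hew (by rwa [← Fin.ext h'])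
    have := hcol i hi
    rw [Function.update_of_ne hie] at this
    tauto

/-- A conflict changes nothing and an accepted color closes no two-colored cycle. In the remaining
case e itself is erased, so the result arises from the old coloring c by erasing colors. -/
theorem noBichromaticCycle_round (hR : E.Represents G ed) (hc : E.Proper c)
    (h : E.NoBichromaticCycle G ed c) {e a : ℕ} (he : e < E.n) (hce : c e = 0) :
    E.NoBichromaticCycle G ed (E.round c e a) := by
  unfold round
  split_ifs with h1 h2
  · exact h
  · exact noBichromaticCycle_update (e := ⟨e, he⟩) hR h (proper_update hc (by simpa using h1)) h2
  · have : ∀ q, E.uncolor (Function.update c e a) e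
        (firstIdx E.n (E.Closes (Function.update c e a) e) - 1) q = 0 ∨
        E.uncolor (Function.update c e a) e
          (firstIdx E.n (E.Closes (Function.update c e a) e) - 1) q = c q := by
      rw [ne_eq, not_not] at h1
      obtain ⟨h3, h4⟩ := firstIdx_pred_spec h2
      generalize firstIdx E.n (E.Closes (Function.update c e a) e) - 1 = j at h3 h4
      intro q
      -- For a = 0 the update leaves c unchanged; for a ≠ 0 the structure of the closed walk shows
      -- that e is erased.
      by_cases ha : a = 0
      · have hup : Function.update c e a = c := by rw [ha, ← hce, Function.update_eq_self]
        rw [hup]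
        exact uncolor_eq_zero_or _ _ _ _
      by_cases hq : q = e
      · subst hq
        obtain ⟨m, p, w, hw, hmn, -, -, hend⟩ := exists_isAltWalk (proper_update hc h1) he
          (by simpa) h3 h4
        have := hw.three_le hR.simple
        left
        exact if_pos ⟨m, by omega, hmn, hend m le_rfl⟩
      · have := uncolor_eq_zero_or (E := E) (Function.update c e a) e j q
        rwa [Function.update_of_ne hq] at this
    exact h.of_le this

theorem Represents.noBichromaticCycle_zero (hR : E.Represents G ed) :
    E.NoBichromaticCycle G ed (fun _ => 0) := by
  intro a b ha hb u w hw
  cases w with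
  | nil => exact absurd hw (by simp)
  | @cons _ x _ h w =>
    obtain ⟨i, hi⟩ := hR.surj s(u, x) h
    exact ⟨i, by simp [hi], ha.symm, hb.symm⟩

/-- A complete proper coloring without two-colored cycles is an acyclic edge coloring. -/
theorem exists_isAcyclicEdgeColoring (hR : E.Represents G ed) (hc : E.Proper c)
    (h : E.NoBichromaticCycle G ed c) {M : ℕ} (h0 : ∀ i : Fin E.n, c i ≠ 0)
    (hM : ∀ i : Fin E.n, c i ≤ M) :
    ∃ col : G.EdgeLabeling (Fin M), G.IsAcyclicEdgeColoring col ∧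
      ∀ (i : Fin E.n) (hi : ed i ∈ G.edgeSet), (col ⟨ed i, hi⟩ : ℕ) + 1 = c i := by
  choose f hf using hR.surj
  let col : G.EdgeLabeling (Fin M) := fun g => ⟨c (f g g.2) - 1, by
    have := h0 (f g g.2)
    have := hM (f g g.2)
    omega⟩
  have hcol : ∀ (i : Fin E.n) (hi : ed i ∈ G.edgeSet), (col ⟨ed i, hi⟩ : ℕ) + 1 = c i := by
    intro i hi
    have : f (ed i) hi = i := hR.inj (hf _ _)
    change c (f (ed i) hi) - 1 + 1 = c i
    rw [this]
    have := h0 i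
    omega
  refine ⟨col, ⟨?_, ?_⟩, hcol⟩
  · rintro ⟨g, hg⟩ ⟨g', hg'⟩ hne ⟨x, hx, hx'⟩ heq
    obtain ⟨i, rfl⟩ := hR.surj g hg
    obtain ⟨j, rfl⟩ := hR.surj g' hg'
    have h1 := hcol i hg
    have h2 := hcol j hg'
    rw [heq, h2] at h1
    refine hne ?_
    have : i = j := Fin.ext (hc i i.2 j j.2 x (h0 i) h1.symm ((hR.inc i x).2 hx)
      ((hR.inc j x).2 hx'))
    simp [this]
  · intro u w hw
    -- Three uses of the invariant produce three edges of pairwise different colors: any edge, one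
    -- that avoids its color, one that avoids both colors.
    obtain ⟨i₁, hi₁, -, -⟩ := h 1 1 one_ne_zero one_ne_zero u w hw
    obtain ⟨i₂, hi₂, h12, -⟩ := h _ _ (h0 i₁) (h0 i₁) u w hw
    obtain ⟨i₃, hi₃, h13, h23⟩ := h _ _ (h0 i₁) (h0 i₂) u w hw
    have hmem : ∀ i, ed i ∈ w.edges → col ⟨ed i, hR.mem i⟩ ∈
        col '' {g : G.edgeSet | (g : Sym2 (Fin v)) ∈ w.edges} := fun i hi => ⟨_, hi, rfl⟩
    have hne : ∀ i j : Fin E.n, c i ≠ c j → col ⟨ed i, hR.mem i⟩ ≠ col ⟨ed j, hR.mem j⟩ := by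
      intro i j hij heq
      exact hij (by rw [← hcol i (hR.mem i), heq, hcol j (hR.mem j)])
    have hsub : ({col ⟨ed i₁, hR.mem i₁⟩, col ⟨ed i₂, hR.mem i₂⟩, col ⟨ed i₃, hR.mem i₃⟩} :
        Set (Fin M)) ⊆ col '' {g : G.edgeSet | (g : Sym2 (Fin v)) ∈ w.edges} := by
      rintro k (rfl | rfl | rfl)
      · exact hmem _ hi₁
      · exact hmem _ hi₂
      · exact hmem _ hi₃
    refine lt_of_lt_of_le ?_ (Set.encard_le_encard hsub)
    rw [Set.encard_insert_of_notMem, Set.encard_pair (hne _ _ h23.symm)]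
    · norm_num
    · rintro (h' | h')
      · exact hne _ _ h12.symm h'
      · exact hne _ _ h13.symm h'

end EdgeArray

/-! ### Fair coins: independence and uniform colors -/

namespace RandRAM

open MeasureTheory ProbabilityTheory

instance : IsProbabilityMeasure coinMeasure := by
  unfold coinMeasure; infer_instance

/-- The event `s` is determined by the first `m` coins. -/
def DependsOnFirst (m : ℕ) (s : Set (ℕ → Bool)) : Prop :=
  ∀ ω ω' : ℕ → Bool, (∀ i < m, ω i = ω' i) → ω ∈ s → ω' ∈ s

/-- Reduces such events to subsets of a finite product, which are automatically measurable and to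
which independence of finite blocks of coordinates applies. -/
theorem DependsOnFirst.exists_preimage {m : ℕ} {s : Set (ℕ → Bool)} (hs : DependsOnFirst m s) :
    ∃ t : Set (Finset.range m → Bool), s = (fun ω (i : Finset.range m) => ω i) ⁻¹' t := by
  refine ⟨(fun ω (i : Finset.range m) => ω i) '' s, Set.Subset.antisymm
    (Set.subset_preimage_image _ _) ?_⟩
  rintro ω ⟨ω', hω', h⟩
  refine hs ω' ω (fun i hi => ?_) hω'
  exact congrFun h ⟨i, Finset.mem_range.2 hi⟩

theorem DependsOnFirst.measurableSet {m : ℕ} {s : Set (ℕ → Bool)} (hs : DependsOnFirst m s) :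
    MeasurableSet s := by
  obtain ⟨t, rfl⟩ := hs.exists_preimage
  exact (measurable_pi_lambda _ fun i => measurable_pi_apply _) t.toFinite.measurableSet

theorem coinMeasure_eval (m : ℕ) (b : Bool) : coinMeasure.real {ω | ω m = b} = 1 / 2 := by
  have h := (measurePreserving_eval_infinitePi
    (fun _ : ℕ => (PMF.uniformOfFintype Bool).toMeasure) m).measure_preimage
    (s := {b}) (measurableSet_singleton b).nullMeasurableSet
  rw [PMF.toMeasure_apply_singleton _ _ (measurableSet_singleton b),
    PMF.uniformOfFintype_apply] at h
  change coinMeasure {ω | ω m = b} = _ at h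
  rw [measureReal_def, h]
  simp

/-- The next coin is independent of the earlier ones. -/
theorem DependsOnFirst.measureReal_inter {m : ℕ} {s : Set (ℕ → Bool)} (hs : DependsOnFirst m s)
    (b : Bool) : coinMeasure.real (s ∩ {ω | ω m = b}) = coinMeasure.real s * (1 / 2) := by
  obtain ⟨t, rfl⟩ := hs.exists_preimage
  have hind : iIndepFun (fun (i : ℕ) (ω : ℕ → Bool) => ω i) coinMeasure :=
    iIndepFun_infinitePi (P := fun _ : ℕ => (PMF.uniformOfFintype Bool).toMeasure)
      (X := fun _ b => b) (fun _ => measurable_id)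
  have h2 := hind.indepFun_finset (Finset.range m) {m} (by simp)
    (fun i => measurable_pi_apply i)
  have h3 := h2.measure_inter_preimage_eq_mul t {f | f ⟨m, by simp⟩ = b}
    t.toFinite.measurableSet (Set.toFinite _).measurableSet
  rw [← coinMeasure_eval m b, measureReal_def, measureReal_def, measureReal_def,
    ← ENNReal.toReal_mul]
  exact congrArg ENNReal.toReal h3

/-- The number whose binary expansion is given by the coins `m, …, m + k - 1`. -/
def bits (ω : ℕ → Bool) (m : ℕ) : ℕ → ℕ
  | 0 => 0
  | k + 1 => bits ω m k + bits ω m k + (ω (m + k)).toNat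

theorem bits_lt (ω : ℕ → Bool) (m k : ℕ) : bits ω m k < 2 ^ k := by
  induction k with
  | zero => simp [bits]
  | succ k ih =>
    have := Bool.toNat_le (ω (m + k))
    rw [bits, pow_succ]
    omega

theorem bits_congr {ω ω' : ℕ → Bool} {m k : ℕ} (h : ∀ i < m + k, ω i = ω' i) :
    bits ω m k = bits ω' m k := by
  induction k with
  | zero => rfl
  | succ k ih => rw [bits, bits, ih fun i hi => h i (by omega), h (m + k) (by omega)]

/-- The last coin must equal the lowest digit of x and the earlier coins must spell x / 2; each coin
contributes a factor 1/2. Only an upper bound is needed, so x may exceed the range. -/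
theorem DependsOnFirst.measureReal_bits_le {m : ℕ} {s : Set (ℕ → Bool)}
    (hs : DependsOnFirst m s) (k x : ℕ) :
    coinMeasure.real (s ∩ {ω | bits ω m k = x}) ≤ coinMeasure.real s * (1 / 2) ^ k := by
  induction k generalizing x with
  | zero => simpa using measureReal_mono Set.inter_subset_left
  | succ k ih =>
    have hdep : DependsOnFirst (m + k) (s ∩ {ω | bits ω m k = x / 2}) := by
      rintro ω ω' h ⟨h1, h2⟩
      refine ⟨hs ω ω' (fun i hi => h i (by omega)) h1, ?_⟩
      rw [Set.mem_ofPred_eq] at h2 ⊢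
      rw [← h2, bits_congr h]
    have hsub : s ∩ {ω | bits ω m (k + 1) = x} ⊆
        (s ∩ {ω | bits ω m k = x / 2}) ∩ {ω | ω (m + k) = decide (x % 2 = 1)} := by
      rintro ω ⟨h1, h2⟩
      rw [Set.mem_ofPred_eq, bits] at h2
      rcases hb : ω (m + k) <;> rw [hb] at h2 <;> simp at h2
      · refine ⟨⟨h1, ?_⟩, ?_⟩
        · rw [Set.mem_ofPred_eq]; omega
        · rw [Set.mem_ofPred_eq, hb, eq_comm, decide_eq_false_iff_not]; omega
      · refine ⟨⟨h1, ?_⟩, ?_⟩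
        · rw [Set.mem_ofPred_eq]; omega
        · rw [Set.mem_ofPred_eq, hb, eq_comm, decide_eq_true_iff]; omega
    refine (measureReal_mono hsub).trans ?_
    rw [hdep.measureReal_inter, pow_succ, ← mul_assoc]
    gcongr
    exact ih _

end RandRAM

/-! ### The random process and the contracting potential -/

namespace EdgeArray

open MeasureTheory ProbabilityTheory RandRAM

/-- The coloring after `t` rounds, where every round uses `k` coins. -/
noncomputable def process (E : EdgeArray) (k : ℕ) (ω : ℕ → Bool) : ℕ → ℕ → ℕ
  | 0 => fun _ => 0
  | t + 1 =>
    if firstIdx E.n (fun j => E.process k ω t j = 0) = 0 then E.process k ω t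
    else E.round (E.process k ω t) (firstIdx E.n (fun j => E.process k ω t j = 0) - 1)
      (bits ω (k * t) k + 1)

/-- A proper partial coloring with colors `1, …, K`. -/
structure IsPartial (E : EdgeArray) (K : ℕ) (c : ℕ → ℕ) : Prop where
  le : ∀ i, c i ≤ K
  zero : ∀ i, E.n ≤ i → c i = 0
  proper : E.Proper c

variable {E : EdgeArray} {K : ℕ} {c : ℕ → ℕ}

theorem IsPartial.round (h : E.IsPartial K c) (hE : E.Simple) {e a : ℕ} (he : e < E.n)
    (hce : c e = 0) (ha : a ≠ 0) (haK : a ≤ K) : E.IsPartial K (E.round c e a) := by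
  obtain ⟨l, -, hu⟩ := exists_undo_round hE h.proper he hce ha
  refine ⟨fun i => ?_, fun i hi => ?_, proper_round h.proper a⟩
  · rw [hu.result]
    split_ifs
    · exact Nat.zero_le _
    · by_cases hi : i = e
      · simpa [hi]
      · simpa [hi] using h.le i
  · rw [hu.result]
    split_ifs
    · rfl
    · rw [Function.update_of_ne (by omega), h.zero i hi]

theorem isPartial_process (hE : E.Simple) (k : ℕ) (ω : ℕ → Bool) (t : ℕ) :
    E.IsPartial (2 ^ k) (E.process k ω t) := by
  induction t with
  | zero => exact ⟨fun _ => Nat.zero_le _, fun _ _ => rfl, fun i _ j _ w h => absurd rfl h⟩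
  | succ t ih =>
    rw [process]
    split_ifs with h
    · exact ih
    · have := firstIdx_pred_spec h
      exact ih.round hE this.1 this.2 (Nat.succ_ne_zero _) (bits_lt _ _ _)

/-- The first t rounds see only the first k * t coins, hence the color drawn in the next round is
independent of them. -/
theorem process_congr {k t : ℕ} {ω ω' : ℕ → Bool} (h : ∀ i < k * t, ω i = ω' i) :
    E.process k ω t = E.process k ω' t := by
  induction t with
  | zero => rfl
  | succ t ih =>
    rw [mul_add, mul_one] at h
    rw [process, process, ih fun i hi => h i (by omega), bits_congr h]

/-- The set of colored edges. -/
def supp (E : EdgeArray) (c : ℕ → ℕ) : Finset ℕ := (Finset.range E.n).filter fun j => c j ≠ 0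

/-- The least edge outside a set. -/
noncomputable def next (E : EdgeArray) (S : Finset ℕ) : ℕ := firstIdx E.n (· ∉ S) - 1

theorem mem_supp {j : ℕ} : j ∈ E.supp c ↔ j < E.n ∧ c j ≠ 0 := by simp [supp]

theorem firstIdx_supp : firstIdx E.n (fun j => c j = 0) = firstIdx E.n (· ∉ E.supp c) :=
  firstIdx_congr fun j hj => by simp [mem_supp, hj]

theorem supp_subset : E.supp c ⊆ Finset.range E.n := Finset.filter_subset _ _

theorem supp_eq_range : E.supp c = Finset.range E.n ↔ firstIdx E.n (fun j => c j = 0) = 0 := by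
  rw [firstIdx_eq_zero, supp, Finset.filter_eq_self]
  simp

theorem next_spec {S : Finset ℕ} (hS : S ⊆ Finset.range E.n) (hne : S ≠ Finset.range E.n) :
    E.next S < E.n ∧ E.next S ∉ S := by
  refine firstIdx_pred_spec (firstIdx_ne_zero.2 ?_)
  by_contra! h
  exact hne (hS.antisymm fun j hj => h j (Finset.mem_range.1 hj))

theorem next_supp : E.next (E.supp c) = firstIdx E.n (fun j => c j = 0) - 1 := by
  rw [next, firstIdx_supp]

/-- All assignments of the colors `1, …, K` to the elements of `S`. -/
noncomputable def colorings (K : ℕ) (S : Finset ℕ) : Finset (ℕ → ℕ) :=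
  open Classical in
  (S.pi fun _ => Finset.Icc 1 K).image fun g i => if h : i ∈ S then g i h else 0

theorem card_colorings_le (K : ℕ) (S : Finset ℕ) : (colorings K S).card ≤ K ^ S.card := by
  classical
  refine (Finset.card_image_le (s := S.pi fun _ => Finset.Icc 1 K)).trans ?_
  rw [Finset.card_pi]
  simp

theorem IsPartial.mem_colorings (h : E.IsPartial K c) : c ∈ colorings K (E.supp c) := by
  classical
  refine Finset.mem_image.2 ⟨fun i _ => c i, ?_, ?_⟩
  · rw [Finset.mem_pi]
    intro i hi
    exact Finset.mem_Icc.2 ⟨Nat.one_le_iff_ne_zero.2 (mem_supp.1 hi).2, h.le i⟩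
  · funext i
    split_ifs with hi
    · rfl
    · rw [mem_supp, not_and_or, not_not] at hi
      rcases hi with hi | hi
      · exact (h.zero i (by omega)).symm
      · exact hi.symm

theorem dependsOnFirst_process (k t : ℕ) (c : ℕ → ℕ) :
    DependsOnFirst (k * t) {ω | E.process k ω t = c} := by
  intro ω ω' h h'
  rw [Set.mem_ofPred_eq] at h' ⊢
  rw [← h', process_congr h]

/-- A record `l` can take the set `S'` of colored edges to the set `S`. -/
def Leads (E : EdgeArray) (S' : Finset ℕ) (l : List ℕ) (S : Finset ℕ) : Prop :=
  (l.drop 2).Nodup ∧ (l.drop 2).toFinset ⊆ insert (E.next S') S' ∧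
    S = insert (E.next S') S' \ (l.drop 2).toFinset

open Classical in
/-- The bound on the probabilities of colorings after one more round. -/
noncomputable def push (E : EdgeArray) (K : ℕ) (A : Finset ℕ → ℝ) (S : Finset ℕ) : ℝ :=
  (1 / K) * ∑ x ∈ ((Finset.range E.n).powerset.filter (· ≠ Finset.range E.n)).sigma
    fun S' => E.tags (E.next S'), if E.Leads x.1 x.2 S then A x.1 else 0

theorem push_nonneg {A : Finset ℕ → ℝ} (hA : ∀ S, 0 ≤ A S) (S : Finset ℕ) : 0 ≤ E.push K A S := by
  unfold push
  refine mul_nonneg (by positivity) (Finset.sum_nonneg fun x _ => ?_)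
  split_ifs
  · exact hA _
  · exact le_rfl

/-- The record alone determines how the set of colored edges changes, without regard to the colors.
-/
theorem Undo.leads {a : ℕ} (ha : a ≠ 0) {c' : ℕ → ℕ} {l : List ℕ}
    (hne : firstIdx E.n (fun j => c j = 0) ≠ 0)
    (h : E.Undo (Function.update c (firstIdx E.n (fun j => c j = 0) - 1) a) c' l) :
    E.Leads (E.supp c) l (E.supp c') := by
  have he := firstIdx_pred_spec hne
  unfold Leads
  rw [next_supp]
  generalize firstIdx E.n (fun j => c j = 0) - 1 = e at h he
  have hins : ∀ q, q ∈ insert e (E.supp c) ↔ q < E.n ∧ Function.update c e a q ≠ 0 := by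
    intro q
    rw [Finset.mem_insert, mem_supp]
    by_cases hq : q = e
    · simp [hq, he.1, ha]
    · simp [hq]
  refine ⟨h.nodup, fun q hq => ?_, ?_⟩
  · exact (hins q).2 (h.colored q (List.mem_toFinset.1 hq))
  · ext q
    rw [Finset.mem_sdiff, hins, mem_supp, h.result, List.mem_toFinset]
    by_cases hq : q ∈ l.drop 2 <;> simp [hq]

/-- One round preserves a bound for the probabilities of the incomplete colorings. -/
theorem measure_process_succ_le (hE : E.Simple) {k t : ℕ} {A : Finset ℕ → ℝ} (hA0 : ∀ S, 0 ≤ A S)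
    (hA : ∀ c, firstIdx E.n (fun j => c j = 0) ≠ 0 →
      coinMeasure.real {ω | E.process k ω t = c} ≤ A (E.supp c)) (c : ℕ → ℕ)
    (hc : firstIdx E.n (fun j => c j = 0) ≠ 0) :
    coinMeasure.real {ω | E.process k ω (t + 1) = c} ≤ E.push (2 ^ k) A (E.supp c) := by
  classical
  set F : Finset ((ℕ → ℕ) × ℕ) :=
    (((Finset.range E.n).powerset.biUnion fun S => colorings (2 ^ k) S) ×ˢ
      Finset.range (2 ^ k)).filter fun x => E.IsPartial (2 ^ k) x.1 ∧
        firstIdx E.n (fun j => x.1 j = 0) ≠ 0 ∧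
        E.round x.1 (firstIdx E.n (fun j => x.1 j = 0) - 1) (x.2 + 1) = c with hF
  -- Union bound over the pairs (old coloring, drawn number) that produce c. A complete coloring
  -- stays put, so an incomplete c can only come from an incomplete coloring.
  have hsub : {ω | E.process k ω (t + 1) = c} ⊆
      ⋃ x ∈ F, ({ω | E.process k ω t = x.1} ∩ {ω | bits ω (k * t) k = x.2}) := by
    intro ω hω
    rw [Set.mem_ofPred_eq, process] at hω
    split_ifs at hω with h
    · rw [hω] at h; exact absurd h hc
    · have hp := isPartial_process hE k ω t
      refine Set.mem_biUnion (x := (E.process k ω t, bits ω (k * t) k)) ?_ ⟨rfl, rfl⟩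
      rw [SetLike.mem_coe, hF, Finset.mem_filter, Finset.mem_product, Finset.mem_biUnion,
        Finset.mem_range]
      exact ⟨⟨⟨_, Finset.mem_powerset.2 supp_subset, hp.mem_colorings⟩, bits_lt _ _ _⟩, hp, h, hω⟩
  have hex : ∀ x : (ℕ → ℕ) × ℕ, x ∈ F →
      ∃ l ∈ E.tags (E.next (E.supp x.1)), E.Undo (Function.update x.1
        (firstIdx E.n (fun j => x.1 j = 0) - 1) (x.2 + 1)) c l := by
    intro x hx
    rw [hF, Finset.mem_filter] at hx
    obtain ⟨-, hp, hne, hr⟩ := hx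
    have he := firstIdx_pred_spec hne
    rw [next_supp]
    have := exists_undo_round hE hp.proper he.1 he.2 (Nat.succ_ne_zero x.2)
    rwa [hr] at this
  choose! tag htag hundo using hex
  refine (measureReal_mono hsub (measure_ne_top _ _)).trans ((measureReal_biUnion_finset_le _ _).trans ?_)
  have h1 : ∀ x ∈ F, coinMeasure.real ({ω | E.process k ω t = x.1} ∩
      {ω | bits ω (k * t) k = x.2}) ≤ A (E.supp x.1) * (1 / 2) ^ k := by
    intro x hx
    rw [hF, Finset.mem_filter] at hx
    refine ((dependsOnFirst_process k t x.1).measureReal_bits_le k x.2).trans ?_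
    gcongr
    exact hA _ hx.2.2.1
  refine (Finset.sum_le_sum h1).trans ?_
  rw [← Finset.sum_mul, mul_comm, push, Nat.cast_pow, Nat.cast_ofNat, one_div_pow]
  refine mul_le_mul_of_nonneg_left ?_ (by positivity)
  set φ : (ℕ → ℕ) × ℕ → (_ : Finset ℕ) × List ℕ := fun x => ⟨E.supp x.1, tag x⟩ with hφ
  -- The support determines e. By `Undo.unique`, c and the record determine the coloring after e was
  -- colored: its value at e gives the drawn color, its other values give the old coloring, which is
  -- 0 at e.
  have hinj : Set.InjOn φ F := by
    intro x hx y hy hxy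
    have hs : E.supp x.1 = E.supp y.1 := congrArg Sigma.fst hxy
    have ht : tag x = tag y := congrArg Sigma.snd hxy
    have hu := hundo x hx
    have hu' := hundo y hy
    rw [ht] at hu
    rw [SetLike.mem_coe, hF, Finset.mem_filter] at hx hy
    have hex := firstIdx_pred_spec hx.2.2.1
    have hey := firstIdx_pred_spec hy.2.2.1
    rw [firstIdx_supp, ← hs, ← firstIdx_supp] at hu' hey
    generalize firstIdx E.n (fun j => x.1 j = 0) - 1 = e at hex hey hu hu'
    have heq := hu.unique hu'
    have h2 : x.2 = y.2 := by simpa using congrFun heq e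
    have h3 : x.1 = y.1 := by
      funext q
      by_cases hq : q = e
      · rw [hq, hex.2, hey.2]
      · simpa [hq] using congrFun heq q
    exact Prod.ext h3 h2
  have h2 : ∑ x ∈ F, A (E.supp x.1) =
      ∑ x ∈ F.image φ, if E.Leads x.1 x.2 (E.supp c) then A x.1 else 0 := by
    rw [Finset.sum_image hinj]
    refine Finset.sum_congr rfl fun x hx => ?_
    have hu := hundo x hx
    rw [hF, Finset.mem_filter] at hx
    rw [if_pos (hu.leads (Nat.succ_ne_zero _) hx.2.2.1)]
  rw [h2]
  refine Finset.sum_le_sum_of_subset_of_nonneg ?_ fun x _ _ => ?_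
  · intro y hy
    obtain ⟨x, hx, rfl⟩ := Finset.mem_image.1 hy
    have ht := htag x hx
    rw [hF, Finset.mem_filter] at hx
    rw [Finset.mem_sigma, Finset.mem_filter, Finset.mem_powerset]
    exact ⟨⟨supp_subset, fun h => hx.2.2.1 (supp_eq_range.1 h)⟩, ht⟩
  · split_ifs
    · exact hA0 _
    · exact le_rfl

/-- The potential decreases by a constant factor in every round. -/
theorem sum_push_le {Δ H : ℕ} (hΔ : ∀ w, (E.star w).card ≤ Δ) (hH : 0 < H) (hΔH : 4 * Δ ≤ H)
    {A : Finset ℕ → ℝ} (hA : ∀ S, 0 ≤ A S) :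
    ∑ S ∈ (Finset.range E.n).powerset, (H : ℝ) ^ S.card * E.push (2 * H) A S ≤
      19 / 24 * ∑ S ∈ (Finset.range E.n).powerset, (H : ℝ) ^ S.card * A S := by
  classical
  have hH' : (0 : ℝ) < H := by exact_mod_cast hH
  have hr : (Δ : ℝ) * (1 / H) ≤ 1 / 4 := by
    have : (4 : ℝ) * Δ ≤ H := by exact_mod_cast hΔH
    rw [mul_one_div, div_le_iff₀ hH']
    linarith
  set P := (Finset.range E.n).powerset.filter (· ≠ Finset.range E.n) with hP
  -- A set and a record lead to at most one set S₀, with |S₀| = |S'| + 1 - d, where d is the number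
  -- of edges uncolored.
  have hone : ∀ x ∈ P.sigma fun S' => E.tags (E.next S'),
      ∑ S ∈ (Finset.range E.n).powerset, (H : ℝ) ^ S.card *
        (if E.Leads x.1 x.2 S then A x.1 else 0) ≤
      H ^ (x.1.card + 1) * A x.1 * (1 / H) ^ (x.2.length - 2) := by
    intro x hx
    rw [Finset.mem_sigma, hP, Finset.mem_filter, Finset.mem_powerset] at hx
    have hnx := (next_spec hx.1.1 hx.1.2).2
    by_cases hgood : (x.2.drop 2).Nodup ∧ (x.2.drop 2).toFinset ⊆ insert (E.next x.1) x.1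
    · set S₀ := insert (E.next x.1) x.1 \ (x.2.drop 2).toFinset with hS₀
      have hcard : S₀.card + (x.2.length - 2) = x.1.card + 1 := by
        rw [← Finset.card_insert_of_notMem hnx, hS₀, ← List.length_drop,
          ← List.toFinset_card_of_nodup hgood.1]
        exact Finset.card_sdiff_add_card_eq_card hgood.2
      have hpow : (H : ℝ) ^ S₀.card = H ^ (x.1.card + 1) * (1 / H) ^ (x.2.length - 2) := by
        rw [← hcard, pow_add, mul_assoc, ← mul_pow, mul_one_div_cancel hH'.ne', one_pow, mul_one]
      calc _ ≤ ∑ S ∈ (Finset.range E.n).powerset,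
            (if S = S₀ then (H : ℝ) ^ S.card * A x.1 else 0) := by
            refine Finset.sum_le_sum fun S _ => ?_
            by_cases hS : S = S₀
            · rw [if_pos hS]
              gcongr
              split_ifs
              · exact le_rfl
              · exact hA _
            · rw [if_neg hS, if_neg fun h => hS h.2.2, mul_zero]
        _ ≤ (H : ℝ) ^ S₀.card * A x.1 := by
            rw [Finset.sum_ite_eq']
            split_ifs
            · exact le_rfl
            · exact mul_nonneg (by positivity) (hA _)
        _ = _ := by rw [hpow]; ring
    · refine (Finset.sum_nonpos fun S _ => ?_).trans
        (mul_nonneg (mul_nonneg (by positivity) (hA _)) (by positivity))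
      rw [if_neg fun h => hgood ⟨h.1, h.2.1⟩, mul_zero]
  calc ∑ S ∈ (Finset.range E.n).powerset, (H : ℝ) ^ S.card * E.push (2 * H) A S
      = (1 / (2 * H)) * ∑ x ∈ P.sigma fun S' => E.tags (E.next S'),
          ∑ S ∈ (Finset.range E.n).powerset, (H : ℝ) ^ S.card *
            (if E.Leads x.1 x.2 S then A x.1 else 0) := by
        rw [Finset.sum_comm, Finset.mul_sum]
        refine Finset.sum_congr rfl fun S _ => ?_
        rw [push, ← Finset.mul_sum]
        push_cast
        ring
    _ ≤ (1 / (2 * H)) * ∑ x ∈ P.sigma fun S' => E.tags (E.next S'),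
          (H : ℝ) ^ (x.1.card + 1) * A x.1 * (1 / H) ^ (x.2.length - 2) := by
        gcongr with x hx
        exact hone x hx
    _ = (1 / (2 * H)) * ∑ S ∈ P, (H : ℝ) ^ (S.card + 1) * A S *
          ∑ l ∈ E.tags (E.next S), (1 / (H : ℝ)) ^ (l.length - 2) := by
        rw [Finset.sum_sigma]
        simp only [Finset.mul_sum]
    _ ≤ (1 / (2 * H)) * ∑ S ∈ P, (H : ℝ) ^ (S.card + 1) * A S * (19 / 12) := by
        gcongr with S hS
        · exact mul_nonneg (by positivity) (hA _)
        · exact sum_tags_le hΔ (by positivity) hr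
    -- The extra factor H for coloring e cancels against 1/(2H), leaving (1/2)(19/12).
    _ = 19 / 24 * ∑ S ∈ P, (H : ℝ) ^ S.card * A S := by
        rw [Finset.mul_sum, Finset.mul_sum]
        refine Finset.sum_congr rfl fun S _ => ?_
        rw [pow_succ]
        field_simp
        ring
    _ ≤ _ := by
        refine mul_le_mul_of_nonneg_left ?_ (by norm_num)
        refine Finset.sum_le_sum_of_subset_of_nonneg (Finset.filter_subset _ _) fun S _ _ => ?_
        exact mul_nonneg (by positivity) (hA _)

/-- Initially all mass sits on the empty coloring, with potential 1; then `push` is iterated. -/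
theorem exists_bound (hE : E.Simple) {Δ H k : ℕ} (hΔ : ∀ w, (E.star w).card ≤ Δ) (hH : 0 < H)
    (hΔH : 4 * Δ ≤ H) (hk : 2 ^ k = 2 * H) (t : ℕ) :
    ∃ A : Finset ℕ → ℝ, (∀ S, 0 ≤ A S) ∧
      (∀ c, firstIdx E.n (fun j => c j = 0) ≠ 0 →
        coinMeasure.real {ω | E.process k ω t = c} ≤ A (E.supp c)) ∧
      ∑ S ∈ (Finset.range E.n).powerset, (H : ℝ) ^ S.card * A S ≤ (19 / 24) ^ t := by
  classical
  induction t with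
  | zero =>
    refine ⟨fun S => if S = ∅ then 1 else 0, fun S => by dsimp only; split_ifs <;> simp, fun c _ => ?_, ?_⟩
    · by_cases hc : (fun _ => 0) = c
      · subst hc
        simp [supp]
      · have : {ω | E.process k ω 0 = c} = ∅ := by
          ext ω
          simpa [process] using hc
        rw [this, measureReal_empty]
        dsimp only
        split_ifs <;> simp
    · simp
  | succ t ih =>
    obtain ⟨A, h0, h1, h2⟩ := ih
    refine ⟨E.push (2 ^ k) A, push_nonneg h0, measure_process_succ_le hE h0 h1, ?_⟩
    rw [hk, pow_succ']
    refine (sum_push_le hΔ hH hΔH h0).trans ?_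
    gcongr

/-- The probability that the coloring is still incomplete after `t` rounds decays exponentially. -/
theorem measure_incomplete_le (hE : E.Simple) {Δ H k : ℕ} (hΔ : ∀ w, (E.star w).card ≤ Δ)
    (hH : 0 < H) (hΔH : 4 * Δ ≤ H) (hk : 2 ^ k = 2 * H) (t : ℕ) :
    coinMeasure.real {ω | firstIdx E.n (fun j => E.process k ω t j = 0) ≠ 0} ≤
      2 ^ E.n * (19 / 24) ^ t := by
  classical
  obtain ⟨A, h0, h1, h2⟩ := exists_bound hE hΔ hH hΔH hk t
  set P := (Finset.range E.n).powerset.filter (· ≠ Finset.range E.n) with hP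
  have hsub : {ω | firstIdx E.n (fun j => E.process k ω t j = 0) ≠ 0} ⊆
      ⋃ x ∈ P.sigma fun S => (colorings (2 ^ k) S).filter fun c => E.supp c = S,
        {ω | E.process k ω t = x.2} := by
    intro ω hω
    have hp := isPartial_process hE k ω t
    refine Set.mem_iUnion₂.2 ⟨⟨E.supp (E.process k ω t), E.process k ω t⟩, ?_, rfl⟩
    rw [Finset.mem_sigma, hP, Finset.mem_filter, Finset.mem_filter,
      Finset.mem_powerset]
    exact ⟨⟨supp_subset, fun h => hω (supp_eq_range.1 h)⟩, hp.mem_colorings, rfl⟩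
  refine (measureReal_mono hsub (measure_ne_top _ _)).trans ((measureReal_biUnion_finset_le _ _).trans ?_)
  rw [Finset.sum_sigma]
  have h3 : ∀ S ∈ P, ∑ c ∈ (colorings (2 ^ k) S).filter (fun c => E.supp c = S),
      coinMeasure.real {ω | E.process k ω t = c} ≤ 2 ^ E.n * ((H : ℝ) ^ S.card * A S) := by
    intro S hS
    rw [hP, Finset.mem_filter, Finset.mem_powerset] at hS
    have : ∑ c ∈ (colorings (2 ^ k) S).filter (fun c => E.supp c = S),
        coinMeasure.real {ω | E.process k ω t = c} ≤
        ((colorings (2 ^ k) S).filter (fun c => E.supp c = S)).card • A S := by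
      refine Finset.sum_le_card_nsmul _ _ _ fun c hc => ?_
      rw [Finset.mem_filter] at hc
      rw [← hc.2]
      refine h1 c fun h => hS.2 ?_
      rw [← hc.2, supp_eq_range, h]
    refine this.trans ?_
    rw [nsmul_eq_mul, ← mul_assoc]
    refine mul_le_mul_of_nonneg_right ?_ (h0 S)
    have hcard : S.card ≤ E.n := by simpa using Finset.card_le_card hS.1
    -- There are at most K^|S| colorings with support S. With K = 2H the power of H is absorbed by
    -- the potential and 2^|S| ≤ 2^n remains.
    calc _ ≤ (((2 * H) ^ S.card : ℕ) : ℝ) := by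
          exact_mod_cast (Finset.card_filter_le _ _).trans (by
            rw [← hk]; exact card_colorings_le _ S)
      _ = 2 ^ S.card * (H : ℝ) ^ S.card := by push_cast; rw [mul_pow]
      _ ≤ _ := by gcongr; norm_num
  refine (Finset.sum_le_sum h3).trans ?_
  rw [← Finset.mul_sum]
  gcongr
  refine le_trans ?_ h2
  refine Finset.sum_le_sum_of_subset_of_nonneg (Finset.filter_subset _ _) fun S _ _ => ?_
  exact mul_nonneg (by positivity) (h0 _)

/-- The expected number of rounds. -/
theorem tsum_measure_incomplete_le (hE : E.Simple) {Δ H k : ℕ} (hΔ : ∀ w, (E.star w).card ≤ Δ)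
    (hH : 0 < H) (hΔH : 4 * Δ ≤ H) (hk : 2 ^ k = 2 * H) :
    ∑' t, coinMeasure {ω | firstIdx E.n (fun j => E.process k ω t j = 0) ≠ 0} ≤
      ((3 * E.n + 5 : ℕ) : ℝ≥0∞) := by
  -- The first 3n probabilities are bounded by 1. Since 2 (19/24)^3 < 1, the factor 2^n is used up
  -- by then, and the remaining geometric series is 24/5 ≤ 5.
  rw [← ENNReal.summable.sum_add_tsum_nat_add' (k := 3 * E.n), Nat.cast_add]
  refine add_le_add ?_ ?_
  · calc _ ≤ ∑ i ∈ Finset.range (3 * E.n), (1 : ℝ≥0∞) :=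
          Finset.sum_le_sum fun i _ => prob_le_one
      _ = _ := by simp
  · have h1 : ∀ s, coinMeasure {ω | firstIdx E.n
        (fun j => E.process k ω (s + 3 * E.n) j = 0) ≠ 0} ≤ ENNReal.ofReal ((19 / 24) ^ s) := by
      intro s
      rw [← ofReal_measureReal]
      refine ENNReal.ofReal_le_ofReal ((measure_incomplete_le hE hΔ hH hΔH hk _).trans ?_)
      rw [pow_add, pow_mul, mul_left_comm, ← mul_pow]
      exact mul_le_of_le_one_right (by positivity) (pow_le_one₀ (by norm_num) (by norm_num))
    refine (ENNReal.tsum_le_tsum h1).trans ?_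
    rw [← ENNReal.ofReal_tsum_of_nonneg (fun s => by positivity)
      (summable_geometric_of_lt_one (by norm_num) (by norm_num)),
      tsum_geometric_of_lt_one (by norm_num) (by norm_num)]
    refine ENNReal.ofReal_le_of_le_toReal ?_
    norm_num

end EdgeArray

/-! ### Machine programs for searching and walking -/

namespace RandRAM

namespace Prog

variable {ω : ℕ → Bool}

/-- `reg q` becomes one plus the least `j < reg 1` for which `test`, run with `reg i = j`, makes
`reg b` nonzero, or `0` if there is none. -/
def search (q i b : ℕ) (test : Prog) : Prog :=
  .seq (.const q 0) (.rep i 1 (.seq test (.ite b (.seq (.const 3 1) (.add q i 3)) .skip)))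

theorem den_seq_eq (p q : Prog) (s : State) : den ω (.seq p q) s = den ω q (den ω p s) := rfl

theorem den_ite_eq (r : ℕ) (p q : Prog) (s : State) :
    den ω (.ite r p q) s = if s.reg r = 0 then den ω q s else den ω p s := by
  rw [den]; split_ifs <;> first | rfl | contradiction

/-- The counter descends, so the last hit, which overwrites the others, is the least one. The test
only has to be right in memories that agree with s outside what the search may change, which leaves
it free to use scratch space. -/
theorem den_search {q i b : ℕ} {test : Prog} {s : State} {P : ℕ → Prop} (hi : i ∉ test.regs)
    (hq : q ∉ test.regs) (hqi : q ≠ i) (hq3 : q ≠ 3) (hi3 : i ≠ 3) (hq1 : q ≠ 1)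
    (h : ∀ s' : State, s'.reg i < s.reg 1 →
      (∀ r, r ∉ (search q i b test).regs → s'.reg r = s.reg r) →
      (∀ A, A ∉ test.arrs → s'.arr A = s.arr A) →
      ((test.den ω s').reg b ≠ 0 ↔ P (s'.reg i))) :
    ((search q i b test).den ω s).reg q = firstIdx (s.reg 1) P := by
  have hs1 : (s.setReg q 0).reg 1 = s.reg 1 := by simp [State.setReg_reg, hq1.symm]
  have := den_rep_induction (ω := ω) (i := i) (m := 1) (s := s.setReg q 0)
    (p := .seq test (.ite b (.seq (.const 3 1) (.add q i 3)) .skip))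
    (by simp [regs, hi, hi3, hqi.symm])
    (fun j s' => (s'.reg q = 0 ∧ ∀ l, j ≤ l → l < s.reg 1 → ¬ P l) ∨
      ∃ m, s'.reg q = m + 1 ∧ m < s.reg 1 ∧ P m ∧ ∀ l, j ≤ l → l < m → ¬ P l)
    ?_ ?_ ?_
  · simp only [search, den]
    rcases this with ⟨h1, h2⟩ | ⟨m, h1, h2, h3, h4⟩
    · refine h1.trans (firstIdx_eq_zero.2 fun j hj => h2 j (Nat.zero_le _) hj).symm
    · exact h1.trans (firstIdx_eq_succ.2 ⟨h2, h3, fun l hl => h4 l (Nat.zero_le _) hl⟩).symm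
  · rintro j s' r x hr hj
    have : (s'.setReg r x).reg q = s'.reg q := by
      rcases hr with rfl | rfl <;> simp [State.setReg_reg, hqi, hq3]
    rwa [this]
  · left
    refine ⟨by simp [State.setReg_reg], fun l hl hl' => ?_⟩
    rw [hs1] at hl
    omega
  · intro j s' hj hreg harr hij hinv
    rw [hs1] at hj
    have hframe : ∀ r, r ∉ (search q i b test).regs → s'.reg r = s.reg r := by
      intro r hr
      simp only [search, regs, List.mem_append, List.mem_cons, not_or] at hr
      rw [hreg r (by simp only [regs, List.mem_append, List.mem_cons, not_or]; tauto)]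
      simp [State.setReg_reg, hr]
    have ht := h s' (by omega) hframe fun A hA => by
      simpa using harr A (by simpa [arrs] using hA)
    have hq' := den_reg (ω := ω) test s' q hq
    have hi' := den_reg (ω := ω) test s' i hi
    simp only [den]
    rw [hij] at ht hi'
    split_ifs with hb
    · right
      refine ⟨j, ?_, hj, ht.1 hb, fun l hl hl' => by omega⟩
      simp [State.setReg_reg, hi3, hi']
    · have hnP := ht.not.1 hb
      rw [hq']
      rcases hinv with ⟨h1, h2⟩ | ⟨m, h1, h2, h3, h4⟩
      · left
        refine ⟨h1, fun l hl hl' => ?_⟩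
        rcases Nat.eq_or_lt_of_le hl with rfl | hl
        · exact hnP
        · exact h2 l hl hl'
      · right
        refine ⟨m, h1, h2, h3, fun l hl hl' => ?_⟩
        rcases Nat.eq_or_lt_of_le hl with rfl | hl
        · exact hnP
        · exact h4 l hl hl'

/-- `reg 19` becomes nonzero iff `reg x ≠ reg y`. -/
def neqTest (x y : ℕ) : Prog := .seq (.sub 19 x y) (.seq (.sub 20 y x) (.add 19 19 20))

theorem den_neqTest {x y : ℕ} {s : State} (hx : x ≠ 19) (hy : y ≠ 19) :
    ((neqTest x y).den ω s).reg 19 = (s.reg x - s.reg y) + (s.reg y - s.reg x) := by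
  simp [neqTest, den, State.setReg_reg, hx, hy]

/-- `reg 19` becomes nonzero iff the edge `reg i` has the endpoint `reg w`. -/
def incTest (w i : ℕ) : Prog :=
  .seq (.load 26 0 i) (.seq (neqTest 26 w) (.ite 19
    (.seq (.load 26 1 i) (.seq (neqTest 26 w) (.ite 19 (.const 19 0) (.const 19 1))))
    (.const 19 1)))

theorem den_incTest {w i : ℕ} {s : State} (hw : w ∉ [19, 20, 26]) (hi : i ∉ [19, 20, 26]) :
    ((incTest w i).den ω s).reg 19 ≠ 0 ↔
      s.arr 0 (s.reg i) = s.reg w ∨ s.arr 1 (s.reg i) = s.reg w := by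
  simp only [List.mem_cons, List.not_mem_nil, or_false, not_or] at hw hi
  simp only [incTest, neqTest, den, State.setReg_reg, hw, hi, if_true, if_false, ne_eq,
    Nat.reduceEqDiff, State.setReg_arr]
  split_ifs <;> simp [State.setReg_reg] <;> omega

/-- `reg 19` becomes nonzero iff the edge `reg i` has color `reg y` and endpoint `reg w`. -/
def matchTest (y w i : ℕ) : Prog :=
  .seq (.load 26 3 i) (.seq (neqTest 26 y) (.ite 19 (.const 19 0) (incTest w i)))

theorem den_matchTest {y w i : ℕ} {s : State} (hy : y ∉ [19, 20, 26]) (hw : w ∉ [19, 20, 26])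
    (hi : i ∉ [19, 20, 26]) :
    ((matchTest y w i).den ω s).reg 19 ≠ 0 ↔ s.arr 3 (s.reg i) = s.reg y ∧
      (s.arr 0 (s.reg i) = s.reg w ∨ s.arr 1 (s.reg i) = s.reg w) := by
  simp only [List.mem_cons, List.not_mem_nil, or_false, not_or] at hy hw hi
  rw [matchTest, den_seq_eq, den_seq_eq, den_ite_eq]
  have hneq := den_neqTest (ω := ω) (x := 26) (y := y) (s := den ω (.load 26 3 i) s) (by decide)
    hy.1
  have hr : ∀ r, r ∉ [26, 19, 20, 19] →
      (den ω (neqTest 26 y) (den ω (.load 26 3 i) s)).reg r = s.reg r := fun r hr =>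
    den_reg (.seq (.load 26 3 i) (neqTest 26 y)) s r (by simpa [neqTest, regs] using hr)
  have ha : ∀ A, (den ω (neqTest 26 y) (den ω (.load 26 3 i) s)).arr A = s.arr A := fun A =>
    den_arr (.seq (.load 26 3 i) (neqTest 26 y)) s A (by simp [neqTest, arrs])
  generalize den ω (neqTest 26 y) (den ω (.load 26 3 i) s) = s' at hneq hr ha
  simp only [den, State.setReg_reg, hy, if_true, if_false] at hneq
  split_ifs with h1
  · rw [den_incTest (by simp [hw]) (by simp [hi]), ha, ha, hr w (by simp [hw]),
      hr i (by simp [hi])]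
    constructor
    · exact fun h => ⟨by omega, h⟩
    · exact fun h => h.2
  · simp only [den, State.setReg_reg, if_true, ne_eq, not_true_eq_false, false_iff]
    omega

/-- One step of the alternating walk, with its position in the registers `14`, …, `17`. -/
def stepProg : Prog :=
  .seq (neqTest 14 4) (.seq (.ite 19
    (.seq (search 22 18 19 (matchTest 16 15 18)) (.ite 22
      (.seq (.copy 14 22) (.seq (.sub 26 22 8) (.seq (.load 29 0 26) (.seq (.load 20 1 26)
        (.seq (.add 29 29 20) (.seq (.sub 15 29 15) (.seq (.copy 26 16) (.seq (.copy 16 17)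
          (.copy 17 26)))))))))
      .skip))
    .skip) (.store 5 21 14))

/-- The memory contains the graph and the coloring `c`. -/
structure Holds (E : EdgeArray) (c : ℕ → ℕ) (s : State) : Prop where
  reg_one : s.reg 1 = E.n
  reg_eight : s.reg 8 = 1
  arr_zero : s.arr 0 = E.U
  arr_one : s.arr 1 = E.W
  arr_three : s.arr 3 = c

/-- The walk position that is stored in the registers. -/
def pos (s : State) : WalkPos := ⟨s.reg 14, s.reg 15, s.reg 16, s.reg 17⟩

variable {E : EdgeArray} {c : ℕ → ℕ} {e : ℕ}

theorem Holds.of_eq {s s' : State} (h : Holds E c s) (h1 : s'.reg 1 = s.reg 1)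
    (h8 : s'.reg 8 = s.reg 8) (h0 : s'.arr 0 = s.arr 0) (ha1 : s'.arr 1 = s.arr 1)
    (h3 : s'.arr 3 = s.arr 3) : Holds E c s' :=
  ⟨h1.trans h.1, h8.trans h.2, h0.trans h.3, ha1.trans h.4, h3.trans h.5⟩

/-- The current edge is recorded in array 5 even when the walk rests, so that all n cells get
filled. Edge numbers are stored shifted by one throughout. -/
theorem den_stepProg {s : State} (h : Holds E c s) (h4 : s.reg 4 = e + 1) :
    pos (stepProg.den ω s) = E.advance c e (pos s) ∧
      (stepProg.den ω s).arr 5 =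
        Function.update (s.arr 5) (s.reg 21) (E.advance c e (pos s)).p := by
  have hneq := den_neqTest (ω := ω) (x := 14) (y := 4) (s := s) (by decide) (by decide)
  set s₁ := den ω (neqTest 14 4) s with hs₁
  have hr : ∀ r, r ∉ (neqTest 14 4).regs → s₁.reg r = s.reg r := fun r hr => den_reg _ _ _ hr
  have ha : ∀ A, s₁.arr A = s.arr A := fun A => den_arr _ _ _ (by simp [neqTest, arrs])
  have hpos : pos s₁ = pos s := by
    unfold pos
    rw [hr 14 (by decide), hr 15 (by decide), hr 16 (by decide), hr 17 (by decide)]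
  have hH₁ : Holds E c s₁ := h.of_eq (hr _ (by decide)) (hr _ (by decide)) (ha _) (ha _) (ha _)
  have hp : (pos s).p = s.reg 14 := rfl
  by_cases hend : s.reg 14 = e + 1
  · have h19 : s₁.reg 19 = 0 := by rw [hneq]; omega
    rw [EdgeArray.advance_end (s := pos s) hend]
    simp only [stepProg, den]
    rw [← hs₁, h19]
    simp only [ne_eq, not_true_eq_false, if_false]
    refine ⟨hpos, ?_⟩
    rw [State.setArr_arr, if_pos rfl, ha, hr 21 (by decide), hr 14 (by decide)]
    rfl
  · have h19 : s₁.reg 19 ≠ 0 := by rw [hneq]; omega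
    have hsearch := den_search (ω := ω) (q := 22) (i := 18) (b := 19)
      (test := matchTest 16 15 18) (s := s₁) (P := fun j => c j = s.reg 16 ∧ E.Inc j (s.reg 15))
      (by decide) (by decide) (by decide) (by decide) (by decide) (by decide) (by
        intro s' _ hs' ha'
        rw [den_matchTest (by decide) (by decide) (by decide), ha' 3 (by decide),
          ha' 0 (by decide), ha' 1 (by decide), hs' 16 (by decide), hs' 15 (by decide),
          hr 16 (by decide), hr 15 (by decide), ha, ha, ha, h.arr_zero, h.arr_one, h.arr_three]
        rfl)
    set s₂ := den ω (search 22 18 19 (matchTest 16 15 18)) s₁ with hs₂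
    have hr₂ : ∀ r, r ∉ (search 22 18 19 (matchTest 16 15 18)).regs → s₂.reg r = s₁.reg r :=
      fun r hr => den_reg _ _ _ hr
    have ha₂ : ∀ A, s₂.arr A = s₁.arr A := fun A => den_arr _ _ _ (by
      simp [search, matchTest, incTest, neqTest, arrs])
    have hadv : E.advance c e (pos s) =
        if s₂.reg 22 = 0 then pos s else ⟨s₂.reg 22, E.other (s₂.reg 22 - 1) (s.reg 15),
          s.reg 17, s.reg 16⟩ := by
      rw [hsearch, hH₁.reg_one]
      unfold EdgeArray.advance
      rw [if_neg (show ¬ (pos s).p = e + 1 from hend)]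
      rfl
    rw [hadv]
    simp only [stepProg, den]
    rw [← hs₁, if_pos h19, ← hs₂]
    have e8 : s₂.reg 8 = 1 := by rw [hr₂ 8 (by decide), hH₁.reg_eight]
    have e14 : s₂.reg 14 = s.reg 14 := by rw [hr₂ 14 (by decide), hr 14 (by decide)]
    have e15 : s₂.reg 15 = s.reg 15 := by rw [hr₂ 15 (by decide), hr 15 (by decide)]
    have e16 : s₂.reg 16 = s.reg 16 := by rw [hr₂ 16 (by decide), hr 16 (by decide)]
    have e17 : s₂.reg 17 = s.reg 17 := by rw [hr₂ 17 (by decide), hr 17 (by decide)]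
    have e21 : s₂.reg 21 = s.reg 21 := by rw [hr₂ 21 (by decide), hr 21 (by decide)]
    have a0 : s₂.arr 0 = E.U := by rw [ha₂, ha, h.arr_zero]
    have a1 : s₂.arr 1 = E.W := by rw [ha₂, ha, h.arr_one]
    have a5 : s₂.arr 5 = s.arr 5 := by rw [ha₂, ha]
    by_cases h22 : s₂.reg 22 = 0
    · simp only [h22, ne_eq, not_true_eq_false, if_false, if_true]
      refine ⟨?_, ?_⟩
      · simp only [pos, State.setArr_reg, e14, e15, e16, e17]
      · rw [State.setArr_arr, if_pos rfl, a5, e21, e14]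
        rfl
    · simp only [ne_eq, h22, not_false_eq_true, if_true, if_false]
      refine ⟨?_, ?_⟩
      · simp [pos, State.setReg_reg, e8, e15, e16, e17, a0, a1, EdgeArray.other]
      · simp [State.setArr_arr, State.setReg_reg, a5, e21]

/-- The alternating walk that goes over `W e` to the edge `reg 23`. -/
def walkProg : Prog :=
  .seq (.add 14 23 8) (.seq (.load 15 0 23) (.seq (.load 26 1 23) (.seq (.add 15 15 26)
    (.seq (.sub 15 15 10) (.seq (.copy 16 6) (.seq (.load 17 3 23) (.rep 21 1 stepProg)))))))

/-- The loop counter descends, so cell m of array 5 receives the position after n - m steps. -/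
theorem den_walkProg {s : State} (h : Holds E c s) (h4 : s.reg 4 = e + 1) (h6 : s.reg 6 = c e)
    (h10 : s.reg 10 = E.W e) :
    (walkProg.den ω s).reg 14 = (E.trace c e (s.reg 23) E.n).p ∧
      ∀ m < E.n, (walkProg.den ω s).arr 5 m = (E.trace c e (s.reg 23) (E.n - m)).p := by
  simp only [walkProg, den_seq_eq]
  generalize hs₀ : den ω (.load 17 3 23) _ = s₀
  have hH : Holds E c s₀ := by
    rw [← hs₀]
    exact h.of_eq (by simp [den, State.setReg_reg]) (by simp [den, State.setReg_reg]) rfl rfl rfl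
  have h40 : s₀.reg 4 = e + 1 := by rw [← hs₀]; simpa [den, State.setReg_reg]
  have hpos : pos s₀ = E.trace c e (s.reg 23) 0 := by
    rw [← hs₀, EdgeArray.trace_zero]
    simp [pos, den, State.setReg_reg, h.reg_eight, h.arr_zero, h.arr_one, h.arr_three, h6, h10,
      EdgeArray.other]
  have := den_rep_induction (ω := ω) (i := 21) (m := 1) (p := stepProg) (s := s₀) (by decide)
    (fun j s' => pos s' = E.trace c e (s.reg 23) (E.n - j) ∧
      ∀ m, j ≤ m → m < E.n → s'.arr 5 m = (E.trace c e (s.reg 23) (E.n - m)).p)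
    (by
      rintro j s' r x hr ⟨h1, h2⟩
      refine ⟨?_, h2⟩
      rw [← h1]
      rcases hr with rfl | rfl <;> simp [pos, State.setReg_reg])
    (by
      rw [hH.reg_one]
      exact ⟨by rw [hpos, Nat.sub_self], fun m hm hm' => by omega⟩)
    (by
      rintro j s' hj hreg harr hij ⟨h1, h2⟩
      rw [hH.reg_one] at hj
      have hH' : Holds E c s' := hH.of_eq (hreg _ (by decide)) (hreg _ (by decide))
        (harr _ (by decide)) (harr _ (by decide)) (harr _ (by decide))
      obtain ⟨h3, h5⟩ := den_stepProg (ω := ω) hH' ((hreg 4 (by decide)).trans h40)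
      have hsucc : E.n - j = (E.n - (j + 1)) + 1 := by omega
      rw [h1, ← EdgeArray.trace_succ, ← hsucc] at h3 h5
      refine ⟨h3, fun m hm hm' => ?_⟩
      rw [h5, hij]
      rcases Nat.eq_or_lt_of_le hm with rfl | hm
      · simp
      · rw [Function.update_of_ne (by omega)]
        exact h2 m hm hm')
  exact ⟨congrArg WalkPos.p this.1, fun m hm => this.2 m (Nat.zero_le _) hm⟩

end Prog

end RandRAM

namespace EdgeArray

/-- Makes the truncated subtraction `p - 1` recover the edge number. -/
theorem trace_p_ne_zero (E : EdgeArray) (c : ℕ → ℕ) (e j i : ℕ) : (E.trace c e j i).p ≠ 0 := by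
  induction i with
  | zero => simp [trace_zero]
  | succ i ih =>
    rw [trace_succ, advance]
    split_ifs with h1 h2
    · exact ih
    · exact ih
    · exact h2

end EdgeArray

/-! ### Machine programs for one round -/

namespace RandRAM

namespace Prog

variable {ω : ℕ → Bool} {E : EdgeArray} {c : ℕ → ℕ} {e : ℕ}

/-- `reg 28` becomes nonzero iff the alternating walk over the edge `reg 23` closes. -/
def closeTest : Prog :=
  .seq (.const 28 0) (.seq (.load 26 3 23) (.ite 26 (.seq (neqTest 23 5) (.ite 19
    (.seq (incTest 10 23) (.ite 19 (.seq walkProg (.seq (neqTest 14 4)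
      (.ite 19 .skip (.const 28 1)))) .skip)) .skip)) .skip))

theorem den_closeTest {s : State} (h : Holds E c s) (h4 : s.reg 4 = e + 1) (h5 : s.reg 5 = e)
    (h6 : s.reg 6 = c e) (h10 : s.reg 10 = E.W e) :
    (closeTest.den ω s).reg 28 ≠ 0 ↔ E.Closes c e (s.reg 23) := by
  rw [closeTest, den_seq_eq, den_seq_eq, den_ite_eq]
  have h₀ : ∀ r, r ∉ [26, 28] → (den ω (.load 26 3 23) (den ω (.const 28 0) s)).reg r = s.reg r :=
    fun r hr => by
      simp only [List.mem_cons, List.not_mem_nil, or_false, not_or] at hr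
      simp [den, State.setReg_reg, hr]
  have h26 : (den ω (.load 26 3 23) (den ω (.const 28 0) s)).reg 26 = c (s.reg 23) := by
    simp [den, State.setReg_reg, h.arr_three]
  have h28 : (den ω (.load 26 3 23) (den ω (.const 28 0) s)).reg 28 = 0 := by
    simp [den, State.setReg_reg]
  have ha : ∀ A, (den ω (.load 26 3 23) (den ω (.const 28 0) s)).arr A = s.arr A := fun A => rfl
  generalize den ω (.load 26 3 23) (den ω (.const 28 0) s) = s₀ at h₀ h26 h28 ha
  unfold EdgeArray.Closes
  split_ifs with hc0
  · simp only [den, h28]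
    rw [h26] at hc0
    simp [hc0]
  rw [h26] at hc0
  rw [den_seq_eq, den_ite_eq, den_neqTest (by decide) (by decide), h₀ 23 (by decide),
    h₀ 5 (by decide), h5]
  have h₁ : ∀ r, r ∉ [19, 20, 19] → (den ω (neqTest 23 5) s₀).reg r = s₀.reg r :=
    fun r hr => den_reg _ _ _ hr
  have ha₁ : ∀ A, (den ω (neqTest 23 5) s₀).arr A = s₀.arr A := fun A =>
    den_arr _ _ _ (by simp [neqTest, arrs])
  generalize den ω (neqTest 23 5) s₀ = s₁ at h₁ ha₁
  split_ifs with hje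
  · simp only [den, h₁ 28 (by decide), h28, ne_eq, not_true_eq_false, false_iff]
    rintro ⟨-, h, -⟩
    exact h (by omega)
  have hje' : s.reg 23 ≠ e := fun h => hje (by omega)
  rw [den_seq_eq, den_ite_eq]
  have hinc := den_incTest (ω := ω) (w := 10) (i := 23) (s := s₁) (by decide) (by decide)
  rw [ha₁, ha₁, ha, ha, h₁ 23 (by decide), h₁ 10 (by decide), h₀ 23 (by decide),
    h₀ 10 (by decide), h.arr_zero, h.arr_one, h10] at hinc
  have h₂ : ∀ r, r ∉ (incTest 10 23).regs → (den ω (incTest 10 23) s₁).reg r = s₁.reg r :=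
    fun r hr => den_reg _ _ _ hr
  have ha₂ : ∀ A, (den ω (incTest 10 23) s₁).arr A = s₁.arr A := fun A =>
    den_arr _ _ _ (by simp [incTest, neqTest, arrs])
  generalize den ω (incTest 10 23) s₁ = s₂ at h₂ ha₂ hinc
  split_ifs with h19
  · simp only [den, h₂ 28 (by decide), h₁ 28 (by decide), h28, ne_eq, not_true_eq_false, false_iff]
    rintro ⟨-, -, h, -⟩
    exact hinc.2 h h19
  rw [den_seq_eq, den_seq_eq, den_ite_eq, den_neqTest (by decide) (by decide)]
  have hreg : ∀ r, r ∉ [26, 28, 19, 20] → r ∉ (incTest 10 23).regs → s₂.reg r = s.reg r := by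
    intro r hr hr'
    rw [h₂ r hr', h₁ r (by simp at hr ⊢; tauto), h₀ r (by simp at hr ⊢; tauto)]
  have hH : Holds E c s₂ := h.of_eq (hreg _ (by decide) (by decide))
    (hreg _ (by decide) (by decide)) (by rw [ha₂, ha₁, ha]) (by rw [ha₂, ha₁, ha])
    (by rw [ha₂, ha₁, ha])
  have hwalk := (den_walkProg (ω := ω) hH ((hreg 4 (by decide) (by decide)).trans h4)
    ((hreg 6 (by decide) (by decide)).trans h6) ((hreg 10 (by decide) (by decide)).trans h10)).1
  rw [hreg 23 (by decide) (by decide)] at hwalk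
  have h₃ : (den ω walkProg s₂).reg 4 = e + 1 := by
    rw [den_reg _ _ _ (by decide), hreg 4 (by decide) (by decide), h4]
  have h28' : (den ω (neqTest 14 4) (den ω walkProg s₂)).reg 28 = 0 := by
    rw [den_reg _ _ _ (by decide), den_reg _ _ _ (by decide), h₂ 28 (by decide),
      h₁ 28 (by decide), h28]
  rw [hwalk, h₃]
  split_ifs with hfin
  · simp only [den, State.setReg_reg, if_true, ne_eq, one_ne_zero, not_false_eq_true, true_iff]
    exact ⟨hc0, hje', hinc.1 h19, by omega⟩
  · simp only [den, h28', ne_eq, not_true_eq_false, false_iff]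
    rintro ⟨-, -, -, h⟩
    exact hfin (by omega)

/-- Remove the colors of the edges on the recorded walk. -/
def uncolorProg : Prog :=
  .seq walkProg (.rep 21 30 (.seq (.load 26 5 21) (.seq (.sub 26 26 8) (.store 3 26 31))))

/-- The walk is run anew, because the search for j may since have overwritten array 5 with other
walks. The loop covers the cells m < n - 1, that is, the step numbers n - m ≥ 2, so the first two
edges are spared. -/
theorem den_uncolorProg {s : State} (h : Holds E c s) (h4 : s.reg 4 = e + 1)
    (h6 : s.reg 6 = c e) (h10 : s.reg 10 = E.W e) (h30 : s.reg 30 = E.n - 1)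
    (h31 : s.reg 31 = 0) :
    (uncolorProg.den ω s).arr 3 = E.uncolor c e (s.reg 23) := by
  obtain ⟨-, hpath⟩ := den_walkProg (ω := ω) h h4 h6 h10
  rw [uncolorProg, den_seq_eq]
  have hreg : ∀ r, r ∉ walkProg.regs → (den ω walkProg s).reg r = s.reg r := fun r hr =>
    den_reg _ _ _ hr
  have harr3 : (den ω walkProg s).arr 3 = c := by
    rw [den_arr _ _ _ (by decide), h.arr_three]
  generalize den ω walkProg s = s₀ at hpath hreg harr3
  have hn : s₀.reg 30 = E.n - 1 := by rw [hreg 30 (by decide), h30]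
  have := den_rep_induction (ω := ω) (i := 21) (m := 30)
    (p := .seq (.load 26 5 21) (.seq (.sub 26 26 8) (.store 3 26 31))) (s := s₀) (by decide)
    (fun j s' => ∀ q, ((∃ m, j ≤ m ∧ m < E.n - 1 ∧
        (E.trace c e (s.reg 23) (E.n - m)).p = q + 1) → s'.arr 3 q = 0) ∧
      ((¬ ∃ m, j ≤ m ∧ m < E.n - 1 ∧
        (E.trace c e (s.reg 23) (E.n - m)).p = q + 1) → s'.arr 3 q = c q))
    (fun j s' r x _ h => h)
    (by
      intro q
      constructor
      · rintro ⟨m, h1, h2, -⟩; omega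
      · intro _; rw [harr3])
    (by
      rintro j s' hj hr ha hij hinv
      rw [hn] at hj
      have hp := hpath j (by omega)
      have hp0 := E.trace_p_ne_zero c e (s.reg 23) (E.n - j)
      have hst : (den ω (.seq (.load 26 5 21) (.seq (.sub 26 26 8) (.store 3 26 31))) s').arr 3 =
          Function.update (s'.arr 3) ((E.trace c e (s.reg 23) (E.n - j)).p - 1) 0 := by
        have e8 : s'.reg 8 = 1 := by rw [hr 8 (by decide), hreg 8 (by decide), h.reg_eight]
        have e31 : s'.reg 31 = 0 := by rw [hr 31 (by decide), hreg 31 (by decide), h31]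
        simp [den, State.setArr_arr, State.setReg_reg, e8, e31, hij, ha 5 (by decide), hp]
      intro q
      rw [hst]
      by_cases hq : q = (E.trace c e (s.reg 23) (E.n - j)).p - 1
      · subst hq
        simp only [Function.update_self, implies_true, true_and]
        intro hne
        exact absurd ⟨j, le_rfl, hj, by omega⟩ hne
      · rw [Function.update_of_ne hq]
        refine ⟨?_, ?_⟩
        · rintro ⟨m, h1, h2, h3⟩
          rcases Nat.eq_or_lt_of_le h1 with rfl | h1
          · omega
          · exact (hinv q).1 ⟨m, h1, h2, h3⟩
        · intro hne
          refine (hinv q).2 fun ⟨m, h1, h2, h3⟩ => hne ⟨m, by omega, h2, h3⟩)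
  funext q
  have hiff : (∃ m, 0 ≤ m ∧ m < E.n - 1 ∧ (E.trace c e (s.reg 23) (E.n - m)).p = q + 1) ↔
      ∃ i, 2 ≤ i ∧ i ≤ E.n ∧ (E.trace c e (s.reg 23) i).p = q + 1 := by
    constructor
    · rintro ⟨m, -, h2, h3⟩
      exact ⟨E.n - m, by omega, by omega, h3⟩
    · rintro ⟨i, h1, h2, h3⟩
      exact ⟨E.n - i, Nat.zero_le _, by omega, by rwa [Nat.sub_sub_self h2]⟩
  have hq := this q
  rw [hiff] at hq
  unfold EdgeArray.uncolor
  split_ifs with hex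
  · exact hq.1 hex
  · exact hq.2 hex

/-- `reg 4` becomes one plus the least uncolored edge, or `0`. -/
def findProg : Prog :=
  search 4 18 19 (.seq (.load 26 3 18) (.ite 26 (.const 19 0) (.const 19 1)))

theorem den_findProg {s : State} (h : Holds E c s) :
    (findProg.den ω s).reg 4 = firstIdx E.n (fun j => c j = 0) := by
  rw [findProg, den_search (P := fun j => c j = 0) (by decide) (by decide) (by decide) (by decide)
    (by decide) (by decide), h.reg_one]
  intro s' _ hr ha
  rw [den_seq_eq, den_ite_eq]
  simp only [den, State.setReg_reg, if_true, ha 3 (by decide), h.arr_three]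
  split_ifs with h0 <;> simp [State.setReg_reg, h0]

/-- Flip `reg 2` coins and put the number with these binary digits into `reg 7`. -/
def flipProg : Prog :=
  .seq (.const 7 0) (.rep 24 2 (.seq (.flip 26) (.seq (.add 7 7 7) (.add 7 7 26))))

theorem den_flipProg (s : State) :
    (flipProg.den ω s).reg 7 = bits ω s.used (s.reg 2) ∧
      (flipProg.den ω s).used = s.used + s.reg 2 := by
  have := den_rep_induction (ω := ω) (i := 24) (m := 2)
    (p := .seq (.flip 26) (.seq (.add 7 7 7) (.add 7 7 26))) (s := s.setReg 7 0) (by decide)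
    (fun j s' => s'.reg 7 = bits ω s.used (s.reg 2 - j) ∧ s'.used = s.used + (s.reg 2 - j))
    (by
      rintro j s' r x hr h
      rcases hr with rfl | rfl <;> simpa [State.setReg_reg])
    (by simp [State.setReg_reg, bits])
    (by
      rintro j s' hj - - - ⟨h1, h2⟩
      simp only [State.setReg_reg, Nat.reduceEqDiff, if_false] at hj
      have hs : s.reg 2 - j = (s.reg 2 - (j + 1)) + 1 := by omega
      rw [hs, bits]
      simp [den, State.setReg_reg, h1, h2, add_assoc])
  simpa [flipProg, den] using this

/-- Choose a color for the edge `reg 4 - 1`. -/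
def chooseProg : Prog :=
  .seq (.sub 5 4 8) (.seq flipProg (.seq (.add 6 7 8) (.seq (.load 9 0 5) (.load 10 1 5))))

theorem den_chooseProg {s : State} (h : Holds E c s) (h4 : s.reg 4 = e + 1) :
    (chooseProg.den ω s).used = s.used + s.reg 2 ∧ (chooseProg.den ω s).reg 5 = e ∧
      (chooseProg.den ω s).reg 6 = bits ω s.used (s.reg 2) + 1 ∧
      (chooseProg.den ω s).reg 7 = bits ω s.used (s.reg 2) ∧
      (chooseProg.den ω s).reg 9 = E.U e ∧ (chooseProg.den ω s).reg 10 = E.W e := by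
  simp only [chooseProg, den_seq_eq]
  obtain ⟨hf1, hf2⟩ := den_flipProg (ω := ω) (den ω (.sub 5 4 8) s)
  have hf5 : (den ω flipProg (den ω (.sub 5 4 8) s)).reg 5 = e := by
    rw [den_reg _ _ _ (by decide)]
    simp [den, State.setReg_reg, h4, h.reg_eight]
  have hf8 : (den ω flipProg (den ω (.sub 5 4 8) s)).reg 8 = 1 := by
    rw [den_reg _ _ _ (by decide)]
    simp [den, State.setReg_reg, h.reg_eight]
  have hfa : ∀ A, (den ω flipProg (den ω (.sub 5 4 8) s)).arr A = s.arr A := by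
    intro A
    rw [den_arr _ _ _ (by simp [flipProg, arrs])]
    rfl
  have hu : (den ω (.sub 5 4 8) s).used = s.used := rfl
  have hk : (den ω (.sub 5 4 8) s).reg 2 = s.reg 2 := by simp [den, State.setReg_reg]
  rw [hu, hk] at hf1 hf2
  generalize den ω flipProg (den ω (.sub 5 4 8) s) = s' at hf1 hf2 hf5 hf8 hfa
  simp [den, State.setReg_reg, hf1, hf2, hf5, hf8, hfa, h.arr_zero, h.arr_one]

/-- `reg 11` becomes nonzero iff the chosen color is in use at an adjacent edge. -/
def conflictProg : Prog :=
  search 11 18 19 (.seq (matchTest 6 9 18) (.ite 19 .skip (matchTest 6 10 18)))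

theorem den_conflictProg {a : ℕ} {s : State} (h : Holds E c s) (h6 : s.reg 6 = a)
    (h9 : s.reg 9 = E.U e) (h10 : s.reg 10 = E.W e) :
    (conflictProg.den ω s).reg 11 = firstIdx E.n (E.Conflict c e a) := by
  rw [conflictProg, den_search (P := E.Conflict c e a) (by decide) (by decide) (by decide)
    (by decide) (by decide) (by decide), h.reg_one]
  intro s' _ hr ha
  have hm := den_matchTest (ω := ω) (y := 6) (w := 9) (i := 18) (s := s') (by decide)
    (by decide) (by decide)
  have hm' := den_matchTest (ω := ω) (y := 6) (w := 10) (i := 18)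
    (s := den ω (matchTest 6 9 18) s') (by decide) (by decide) (by decide)
  rw [den_reg (matchTest 6 9 18) s' 6 (by decide), den_reg (matchTest 6 9 18) s' 10 (by decide),
    den_reg (matchTest 6 9 18) s' 18 (by decide), den_arr (matchTest 6 9 18) s' 3 (by decide),
    den_arr (matchTest 6 9 18) s' 0 (by decide), den_arr (matchTest 6 9 18) s' 1 (by decide)]
    at hm'
  rw [ha 0 (by decide), ha 1 (by decide), ha 3 (by decide), hr 6 (by decide),
    h.arr_zero, h.arr_one, h.arr_three, h6] at hm hm'
  rw [hr 9 (by decide), h9] at hm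
  rw [hr 10 (by decide), h10] at hm'
  rw [den_seq_eq, den_ite_eq]
  generalize s'.reg 18 = j at hm hm' ⊢
  generalize den ω (matchTest 6 9 18) s' = s₁ at hm hm' ⊢
  change _ ↔ c j = a ∧ ((E.U j = E.U e ∨ E.W j = E.U e) ∨ (E.U j = E.W e ∨ E.W j = E.W e))
  split_ifs with h19
  · have hn : ¬ (c j = a ∧ (E.U j = E.U e ∨ E.W j = E.U e)) := fun h' => hm.2 h' h19
    rw [hm']
    exact ⟨fun h' => ⟨h'.1, .inr h'.2⟩, fun h' => ⟨h'.1, h'.2.resolve_left fun h'' =>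
      hn ⟨h'.1, h''⟩⟩⟩
  · have hp := hm.1 h19
    exact ⟨fun _ => ⟨hp.1, .inl hp.2⟩, fun _ => h19⟩

/-- Color the edge `reg 5` and destroy a two-colored cycle through it, if there is one. -/
def colorProg : Prog :=
  .seq (.store 3 5 6) (.seq (.store 2 5 7) (.seq (search 12 23 28 closeTest)
    (.ite 12 (.seq (.sub 23 12 8) uncolorProg) .skip)))

/-- Array 3 holds the working coloring, with 0 for uncolored; array 2 holds the output, shifted down
by one. The output is tied to the coloring only on colored edges, so stale entries in array 2 need
not be cleared when edges are uncolored. -/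
theorem den_colorProg {x : ℕ} {s : State} (h : Holds E c s) (h4 : s.reg 4 = e + 1)
    (h5 : s.reg 5 = e) (h6 : s.reg 6 = x + 1) (h7 : s.reg 7 = x) (h10 : s.reg 10 = E.W e)
    (h30 : s.reg 30 = E.n - 1) (h31 : s.reg 31 = 0) (hout : ∀ i, c i ≠ 0 → s.arr 2 i + 1 = c i)
    {c' : ℕ → ℕ} (hc' : c' =
      if firstIdx E.n (E.Closes (Function.update c e (x + 1)) e) = 0
      then Function.update c e (x + 1)
      else E.uncolor (Function.update c e (x + 1)) e
        (firstIdx E.n (E.Closes (Function.update c e (x + 1)) e) - 1)) :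
    Holds E c' (colorProg.den ω s) ∧
      ∀ i, c' i ≠ 0 → (colorProg.den ω s).arr 2 i + 1 = c' i := by
  rw [colorProg, den_seq_eq, den_seq_eq, den_seq_eq, den_ite_eq]
  obtain ⟨s₄, hs₄, h₄, a₄0, a₄1, a₄2, a₄3⟩ :
      ∃ s₄, den ω (.store 2 5 7) (den ω (.store 3 5 6) s) = s₄ ∧
      (∀ r, s₄.reg r = s.reg r) ∧ s₄.arr 0 = s.arr 0 ∧ s₄.arr 1 = s.arr 1 ∧
      s₄.arr 2 = Function.update (s.arr 2) e x ∧
      s₄.arr 3 = Function.update c e (x + 1) := by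
    refine ⟨_, rfl, fun r => rfl, ?_, ?_, ?_, ?_⟩
    · simp [den, State.setArr_arr]
    · simp [den, State.setArr_arr]
    · simp [den, State.setArr_arr, h5, h7]
    · simp [den, State.setArr_arr, h5, h6, h.arr_three]
  rw [hs₄]
  generalize hc₁ : Function.update c e (x + 1) = c₁ at hc' a₄3
  have hc₁e : c₁ e = x + 1 := by simp [← hc₁]
  have hH₄ : Holds E c₁ s₄ := ⟨by rw [h₄, h.reg_one], by rw [h₄, h.reg_eight],
    by rw [a₄0, h.arr_zero], by rw [a₄1, h.arr_one], a₄3⟩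
  have g4 : s₄.reg 4 = e + 1 := by rw [h₄, h4]
  have g5 : s₄.reg 5 = e := by rw [h₄, h5]
  have g6 : s₄.reg 6 = c₁ e := by rw [h₄, h6, hc₁e]
  have g10 : s₄.reg 10 = E.W e := by rw [h₄, h10]
  have hclose := den_search (ω := ω) (q := 12) (i := 23) (b := 28)
    (test := closeTest) (s := s₄) (P := E.Closes c₁ e) (by decide) (by decide) (by decide)
    (by decide) (by decide) (by decide) (by
      intro s' _ hr ha
      exact den_closeTest (hH₄.of_eq (hr _ (by decide)) (hr _ (by decide)) (ha _ (by decide))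
        (ha _ (by decide)) (ha _ (by decide))) ((hr 4 (by decide)).trans g4)
        ((hr 5 (by decide)).trans g5) ((hr 6 (by decide)).trans g6)
        ((hr 10 (by decide)).trans g10))
  rw [hH₄.reg_one] at hclose
  have h₅ : ∀ r, r ∉ (search 12 23 28 closeTest).regs →
      (den ω (search 12 23 28 closeTest) s₄).reg r = s₄.reg r := fun r hr => den_reg _ _ _ hr
  have a₅ : ∀ A, A ∉ (search 12 23 28 closeTest).arrs →
      (den ω (search 12 23 28 closeTest) s₄).arr A = s₄.arr A := fun A hA => den_arr _ _ _ hA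
  generalize den ω (search 12 23 28 closeTest) s₄ = s₅ at hclose h₅ a₅ ⊢
  have hH₅ : Holds E c₁ s₅ := hH₄.of_eq (h₅ _ (by decide)) (h₅ _ (by decide))
    (a₅ _ (by decide)) (a₅ _ (by decide)) (a₅ _ (by decide))
  have out₅ : ∀ i, c₁ i ≠ 0 → s₅.arr 2 i + 1 = c₁ i := by
    intro i hi
    rw [a₅ 2 (by decide), a₄2, ← hc₁]
    by_cases hie : i = e
    · simp [hie]
    · rw [← hc₁, Function.update_of_ne hie] at hi
      rw [Function.update_of_ne hie, Function.update_of_ne hie, hout i hi]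
  rw [hclose]
  subst hc'
  split_ifs with hcl
  · exact ⟨hH₅, out₅⟩
  · rw [den_seq_eq]
    have h₆ : ∀ r, r ≠ 23 → (den ω (.sub 23 12 8) s₅).reg r = s₅.reg r := fun r hr => by
      simp [den, State.setReg_reg, hr]
    have a₆ : ∀ A, (den ω (.sub 23 12 8) s₅).arr A = s₅.arr A := fun A => rfl
    have g23 : (den ω (.sub 23 12 8) s₅).reg 23 = firstIdx E.n (E.Closes c₁ e) - 1 := by
      simp [den, State.setReg_reg, hclose, hH₅.reg_eight]
    generalize den ω (.sub 23 12 8) s₅ = s₆ at h₆ a₆ g23 ⊢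
    have hH₆ : Holds E c₁ s₆ := hH₅.of_eq (h₆ _ (by decide)) (h₆ _ (by decide)) (a₆ _) (a₆ _)
      (a₆ _)
    have hunc := den_uncolorProg (ω := ω) (e := e) hH₆
      (by rw [h₆ 4 (by decide), h₅ 4 (by decide), g4])
      (by rw [h₆ 6 (by decide), h₅ 6 (by decide), g6])
      (by rw [h₆ 10 (by decide), h₅ 10 (by decide), g10])
      (by rw [h₆ 30 (by decide), h₅ 30 (by decide), h₄, h30])
      (by rw [h₆ 31 (by decide), h₅ 31 (by decide), h₄, h31])
    rw [g23] at hunc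
    refine ⟨⟨?_, ?_, ?_, ?_, hunc⟩, fun i hi => ?_⟩
    · rw [den_reg _ _ _ (by decide), hH₆.reg_one]
    · rw [den_reg _ _ _ (by decide), hH₆.reg_eight]
    · rw [den_arr _ _ _ (by decide), hH₆.arr_zero]
    · rw [den_arr _ _ _ (by decide), hH₆.arr_one]
    · have hi' := (EdgeArray.uncolor_eq_zero_or c₁ e _ i).resolve_left hi
      rw [den_arr _ _ _ (by decide), a₆, hi']
      exact out₅ i (by rwa [← hi'])

/-- One round of the algorithm. -/
def roundProg : Prog :=
  .seq chooseProg (.seq conflictProg (.seq (.ite 11 .skip colorProg) findProg))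

/-- The memory between two rounds. -/
structure Ready (E : EdgeArray) (c : ℕ → ℕ) (k u : ℕ) (s : State) : Prop extends Holds E c s where
  reg_two : s.reg 2 = k
  reg_four : s.reg 4 = firstIdx E.n (fun j => c j = 0)
  reg_thirty : s.reg 30 = E.n - 1
  reg_zero : s.reg 31 = 0
  out : ∀ i, c i ≠ 0 → s.arr 2 i + 1 = c i
  used : s.used = u

/-- A round consumes exactly k coins whatever its outcome, which keeps the machine in step with
`process`. -/
theorem den_roundProg {k u : ℕ} {s : State} (h : Ready E c k u s)
    (hne : firstIdx E.n (fun j => c j = 0) ≠ 0) :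
    Ready E (E.round c (firstIdx E.n (fun j => c j = 0) - 1) (bits ω u k + 1)) k (u + k)
      (roundProg.den ω s) := by
  obtain ⟨e, hfe⟩ : ∃ e, firstIdx E.n (fun j => c j = 0) = e + 1 := ⟨_, (Nat.succ_pred hne).symm⟩
  have hr4 := h.reg_four
  rw [hfe] at hr4 ⊢
  rw [Nat.add_sub_cancel]
  obtain ⟨u₁, e5, e6, e7, e9, e10⟩ := den_chooseProg (ω := ω) h.toHolds hr4
  rw [h.used, h.reg_two] at u₁ e6 e7
  generalize bits ω u k = x at e6 e7 ⊢
  rw [roundProg, den_seq_eq, den_seq_eq, den_seq_eq, den_ite_eq]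
  have h₁ : ∀ r, r ∉ chooseProg.regs → (den ω chooseProg s).reg r = s.reg r := fun r hr =>
    den_reg _ _ _ hr
  have a₁ : ∀ A, (den ω chooseProg s).arr A = s.arr A := fun A =>
    den_arr _ _ _ (by simp [chooseProg, flipProg, arrs])
  generalize den ω chooseProg s = s₁ at *
  have hH₁ : Holds E c s₁ := h.toHolds.of_eq (h₁ _ (by decide)) (h₁ _ (by decide)) (a₁ _) (a₁ _)
    (a₁ _)
  have hconf := den_conflictProg (ω := ω) hH₁ e6 e9 e10
  have h₂ : ∀ r, r ∉ conflictProg.regs → (den ω conflictProg s₁).reg r = s₁.reg r := fun r hr =>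
    den_reg _ _ _ hr
  have a₂ : ∀ A, (den ω conflictProg s₁).arr A = s₁.arr A := fun A =>
    den_arr _ _ _ (by simp [conflictProg, search, matchTest, incTest, neqTest, arrs])
  have u₂ : (den ω conflictProg s₁).used = s₁.used := den_used _ _ (by decide)
  generalize den ω conflictProg s₁ = s₂ at *
  have hH₂ : Holds E c s₂ := hH₁.of_eq (h₂ _ (by decide)) (h₂ _ (by decide)) (a₂ _) (a₂ _) (a₂ _)
  have hs₃ : ∃ s₃, (if s₂.reg 11 = 0 then den ω colorProg s₂ else den ω skip s₂) = s₃ ∧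
      (∀ r, r ∉ colorProg.regs → s₃.reg r = s₂.reg r) ∧
      s₃.used = s₂.used ∧ Holds E (E.round c e (x + 1)) s₃ ∧
      ∀ i, E.round c e (x + 1) i ≠ 0 → s₃.arr 2 i + 1 = E.round c e (x + 1) i := by
    rw [hconf]
    unfold EdgeArray.round
    by_cases hcf : firstIdx E.n (E.Conflict c e (x + 1)) = 0
    · rw [if_pos hcf, if_neg (not_not.2 hcf)]
      exact ⟨_, rfl, fun r hr => den_reg _ _ _ hr, den_used _ _ (by decide),
        den_colorProg hH₂ (by rw [h₂ 4 (by decide), h₁ 4 (by decide), hr4])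
          (by rw [h₂ 5 (by decide), e5]) (by rw [h₂ 6 (by decide), e6])
          (by rw [h₂ 7 (by decide), e7]) (by rw [h₂ 10 (by decide), e10])
          (by rw [h₂ 30 (by decide), h₁ 30 (by decide), h.reg_thirty])
          (by rw [h₂ 31 (by decide), h₁ 31 (by decide), h.reg_zero])
          (fun i hi => by rw [a₂, a₁, h.out i hi]) rfl⟩
    · rw [if_neg hcf, if_pos hcf]
      exact ⟨_, rfl, fun r _ => rfl, rfl, hH₂, fun i hi => by
        rw [den, a₂, a₁]; exact h.out i hi⟩
  obtain ⟨s₃, hs₃, h₃, u₃, hH₃, out₃⟩ := hs₃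
  rw [hs₃]
  have hr : ∀ r, r ∉ findProg.regs → (den ω findProg s₃).reg r = s₃.reg r := fun r hr =>
    den_reg _ _ _ hr
  have ha : ∀ A, (den ω findProg s₃).arr A = s₃.arr A := fun A => den_arr _ _ _ (by
    simp [findProg, search, arrs])
  refine ⟨hH₃.of_eq (hr _ (by decide)) (hr _ (by decide)) (ha _) (ha _) (ha _), ?_,
    den_findProg hH₃, ?_, ?_, ?_, ?_⟩
  · rw [hr 2 (by decide), h₃ 2 (by decide), h₂ 2 (by decide), h₁ 2 (by decide), h.reg_two]
  · rw [hr 30 (by decide), h₃ 30 (by decide), h₂ 30 (by decide), h₁ 30 (by decide), h.reg_thirty]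
  · rw [hr 31 (by decide), h₃ 31 (by decide), h₂ 31 (by decide), h₁ 31 (by decide), h.reg_zero]
  · intro i hi
    rw [ha, out₃ i hi]
  · rw [den_used _ _ (by decide), u₃, u₂, u₁]

end Prog

end RandRAM

/-! ### Initialization, number of colors, and the whole program -/

namespace RandRAM

open MeasureTheory

namespace Prog

variable {ω : ℕ → Bool} {E : EdgeArray}

/-- Increase the degree of the vertex `reg 26` and update the maximum degree `reg 32`. -/
def bumpProg : Prog :=
  .seq (.load 20 4 26) (.seq (.add 20 20 8) (.seq (.store 4 26 20) (.seq (.sub 19 20 32)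
    (.ite 19 (.copy 32 20) .skip))))

theorem den_bumpProg {s : State} (h8 : s.reg 8 = 1) :
    (bumpProg.den ω s).arr 4 =
        Function.update (s.arr 4) (s.reg 26) (s.arr 4 (s.reg 26) + 1) ∧
      (bumpProg.den ω s).reg 32 = max (s.reg 32) (s.arr 4 (s.reg 26) + 1) := by
  simp only [bumpProg, den_seq_eq, den_ite_eq]
  split_ifs with h
  · simp [den, State.setReg_reg, State.setArr_arr, h8] at h ⊢
    omega
  · simp [den, State.setReg_reg, State.setArr_arr, h8] at h ⊢
    omega

/-- Compute the maximum degree. -/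
def degProg : Prog :=
  .rep 18 1 (.seq (.load 26 0 18) (.seq bumpProg (.seq (.load 26 1 18) bumpProg)))

open Classical in
/-- The number of edges `j, …, n - 1` at the vertex `w`. -/
noncomputable def degFrom (E : EdgeArray) (j w : ℕ) : ℕ :=
  ((Finset.Ico j E.n).filter fun l => E.Inc l w).card

theorem degFrom_zero (w : ℕ) : degFrom E 0 w = (E.star w).card := by
  simp [degFrom, EdgeArray.star]

/-- One step of the degree count, which runs through the edges from last to first. As there are no
loops, at most one of the two indicators is 1. -/
theorem degFrom_eq (hE : E.Simple) {j : ℕ} (hj : j < E.n) (w : ℕ) :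
    degFrom E j w = degFrom E (j + 1) w + (if E.U j = w then 1 else 0) +
      (if E.W j = w then 1 else 0) := by
  classical
  have hne := hE.loopless j hj
  have hI : Finset.Ico j E.n = insert j (Finset.Ico (j + 1) E.n) := by
    ext x; simp only [Finset.mem_insert, Finset.mem_Ico]; omega
  unfold degFrom
  rw [hI, Finset.filter_insert]
  have hnot : j ∉ (Finset.Ico (j + 1) E.n).filter fun l => E.Inc l w := by simp
  split_ifs with h1 h2 h3 h3 h2 h3
  all_goals first
    | (exfalso; unfold EdgeArray.Inc at h1; omega)
    | rw [Finset.card_insert_of_notMem hnot]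
    | rfl

theorem den_degProg (hE : E.Simple) {s : State} (h1 : s.reg 1 = E.n) (h8 : s.reg 8 = 1)
    (h32 : s.reg 32 = 0) (a0 : s.arr 0 = E.U) (a1 : s.arr 1 = E.W) (a4 : s.arr 4 = fun _ => 0) :
    (∀ w, (E.star w).card ≤ (degProg.den ω s).reg 32) ∧
      ((degProg.den ω s).reg 32 = 0 ∨ ∃ w, (degProg.den ω s).reg 32 ≤ (E.star w).card) := by
  have := den_rep_induction (ω := ω) (i := 18) (m := 1) (s := s)
    (p := .seq (.load 26 0 18) (.seq bumpProg (.seq (.load 26 1 18) bumpProg))) (by decide)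
    (fun j s' => (∀ w, s'.arr 4 w = degFrom E j w) ∧ (∀ w, degFrom E j w ≤ s'.reg 32) ∧
      (s'.reg 32 = 0 ∨ ∃ w, s'.reg 32 ≤ degFrom E j w))
    (by
      rintro j s' r x hr h
      rcases hr with rfl | rfl <;> simpa [State.setReg_reg])
    (by
      rw [h1, h32]
      simp [degFrom, a4])
    (by
      rintro j s' hj hr ha hij ⟨h4, hle, hex⟩
      rw [h1] at hj
      have hne := hE.loopless j hj
      simp only [den_seq_eq]
      have h8' : (den ω (.load 26 0 18) s').reg 8 = 1 := by
        rw [den_reg _ _ _ (by decide), hr 8 (by decide), h8]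
      obtain ⟨b4, b32⟩ := den_bumpProg (ω := ω) h8'
      have b8 : (den ω bumpProg (den ω (.load 26 0 18) s')).reg 8 = 1 := by
        rw [den_reg _ _ _ (by decide), h8']
      have b18 : (den ω bumpProg (den ω (.load 26 0 18) s')).reg 18 = j := by
        rw [den_reg _ _ _ (by decide), den_reg _ _ _ (by decide), hij]
      have b1 : (den ω bumpProg (den ω (.load 26 0 18) s')).arr 1 = E.W := by
        rw [den_arr _ _ _ (by decide), den_arr _ _ _ (by decide), ha 1 (by decide), a1]
      have hU : (den ω (.load 26 0 18) s').reg 26 = E.U j := by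
        simp [den, State.setReg_reg, hij, ha 0 (by decide), a0]
      have h4U : (den ω (.load 26 0 18) s').arr 4 = s'.arr 4 := rfl
      have h32U : (den ω (.load 26 0 18) s').reg 32 = s'.reg 32 := by
        simp [den, State.setReg_reg]
      rw [hU, h4U] at b4
      rw [hU, h4U, h32U, h4] at b32
      generalize den ω bumpProg (den ω (.load 26 0 18) s') = s₁ at b4 b32 b8 b18 b1
      have b8' : (den ω (.load 26 1 18) s₁).reg 8 = 1 := by rw [den_reg _ _ _ (by decide), b8]
      obtain ⟨d4, d32⟩ := den_bumpProg (ω := ω) b8'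
      have hW : (den ω (.load 26 1 18) s₁).reg 26 = E.W j := by
        simp [den, State.setReg_reg, b18, b1]
      have h4W : (den ω (.load 26 1 18) s₁).arr 4 = s₁.arr 4 := rfl
      have h32W : (den ω (.load 26 1 18) s₁).reg 32 = s₁.reg 32 := by
        simp [den, State.setReg_reg]
      rw [hW, h4W, b4, Function.update_of_ne (Ne.symm hne), h4] at d4
      rw [hW, h4W, h32W, b4, Function.update_of_ne (Ne.symm hne), h4, b32] at d32
      generalize den ω bumpProg (den ω (.load 26 1 18) s₁) = s₂ at d4 d32
      have hdU := degFrom_eq hE hj (E.U j)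
      have hdW := degFrom_eq hE hj (E.W j)
      rw [if_pos rfl, if_neg (Ne.symm hne)] at hdU
      rw [if_neg hne, if_pos rfl] at hdW
      refine ⟨fun w => ?_, fun w => ?_, ?_⟩
      · rw [d4, degFrom_eq hE hj w]
        by_cases hw : w = E.W j
        · subst hw
          simp [hne, h4]
        · rw [Function.update_of_ne hw]
          by_cases hw' : w = E.U j
          · subst hw'
            simp [Ne.symm hne]
          · rw [Function.update_of_ne hw', h4, if_neg (Ne.symm hw'), if_neg (Ne.symm hw)]
            rfl
      · have := hle w
        rw [degFrom_eq hE hj w, d32]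
        split_ifs with hw hw' hw'
        · exact absurd (hw.trans hw'.symm) hne
        · subst hw; omega
        · subst hw'; omega
        · omega
      · right
        rw [d32]
        rcases le_total (degFrom E (j + 1) (E.W j)) (degFrom E (j + 1) (E.U j)) with hUW | hUW
        · rcases le_or_gt (s'.reg 32) (degFrom E (j + 1) (E.U j) + 1) with hs | hs
          · exact ⟨E.U j, by omega⟩
          · rcases hex with h0 | ⟨w, hw⟩
            · omega
            · exact ⟨w, by rw [degFrom_eq hE hj w]; omega⟩
        · rcases le_or_gt (s'.reg 32) (degFrom E (j + 1) (E.W j) + 1) with hs | hs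
          · exact ⟨E.W j, by omega⟩
          · rcases hex with h0 | ⟨w, hw⟩
            · omega
            · exact ⟨w, by rw [degFrom_eq hE hj w]; omega⟩)
  simpa only [degProg, degFrom_zero] using this.2

/-- Put `4 + i` into `reg 34`, where `2 ^ i` is the largest power of two that is at most the
maximum degree `reg 32`. -/
def powProg : Prog :=
  .seq (.const 33 1) (.seq (.const 34 4) (.rep 18 1 (.seq (.add 26 33 33) (.seq (.sub 19 26 32)
    (.ite 19 .skip (.seq (.copy 33 26) (.add 34 34 8)))))))

/-- Repeated doubling. In the invariant, either the next power already exceeds the maximum degree,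
or the exponent has grown in every iteration so far; the latter cannot persist, since n < 2^(n+1).
The alternative i = 0 covers maximum degree 0. -/
theorem den_powProg {s : State} (h8 : s.reg 8 = 1) (hle : s.reg 32 ≤ s.reg 1) :
    ∃ i ≤ s.reg 1, (powProg.den ω s).reg 34 = 4 + i ∧ (i = 0 ∨ 2 ^ i ≤ s.reg 32) ∧
      s.reg 32 < 2 ^ (i + 1) := by
  have := den_rep_induction (ω := ω) (i := 18) (m := 1) (s := (s.setReg 33 1).setReg 34 4)
    (p := .seq (.add 26 33 33) (.seq (.sub 19 26 32)
      (.ite 19 .skip (.seq (.copy 33 26) (.add 34 34 8))))) (by decide)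
    (fun j s' => ∃ i, i + j ≤ s.reg 1 ∧ s'.reg 33 = 2 ^ i ∧ s'.reg 34 = 4 + i ∧
      (i = 0 ∨ 2 ^ i ≤ s.reg 32) ∧ (s.reg 32 < 2 ^ (i + 1) ∨ i + j = s.reg 1))
    (by
      rintro j s' r x hr h
      rcases hr with rfl | rfl <;> simpa [State.setReg_reg])
    (by exact ⟨0, by simp [State.setReg_reg]⟩)
    (by
      rintro j s' hj hr - - ⟨i, h1, h33, h34, hi, hlt⟩
      have h8' : s'.reg 8 = 1 := by rw [hr 8 (by decide)]; simpa [State.setReg_reg]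
      have h32 : s'.reg 32 = s.reg 32 := by rw [hr 32 (by decide)]; simp [State.setReg_reg]
      have h19 : (den ω (.sub 19 26 32) (den ω (.add 26 33 33) s')).reg 19 =
          2 ^ (i + 1) - s.reg 32 := by
        simp [den, State.setReg_reg, h33, h32, pow_succ, mul_two]
      simp only [den_seq_eq, den_ite_eq, h19]
      split_ifs with hc
      · refine ⟨i + 1, by omega, ?_, ?_, .inr (by omega), ?_⟩
        · simp [den, State.setReg_reg, h33, pow_succ, mul_two]
        · simp [den, State.setReg_reg, h34, h8', add_assoc]
        · rcases hlt with hlt | hlt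
          · omega
          · right; omega
      · refine ⟨i, by omega, ?_, ?_, hi, .inl (by omega)⟩
        · simp [den, State.setReg_reg, h33]
        · simp [den, State.setReg_reg, h34])
  obtain ⟨i, h1, -, h34, hi, hlt⟩ := this
  refine ⟨i, by omega, h34, hi, hlt.elim id fun h => ?_⟩
  have := Nat.lt_two_pow_self (n := i + 1)
  omega

/-- Compute the number of colors and find the first uncolored edge. -/
def initProg : Prog :=
  .seq (.const 8 1) (.seq (.sub 30 1 8) (.seq degProg (.seq powProg (.seq (.copy 2 34) findProg))))

theorem den_initProg (hE : E.Simple) {s : State} (h1 : s.reg 1 = E.n)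
    (h0 : ∀ r, 1 < r → s.reg r = 0) (a0 : s.arr 0 = E.U) (a1 : s.arr 1 = E.W)
    (ha : ∀ A, 1 < A → s.arr A = fun _ => 0) (hu : s.used = 0) :
    ∃ Δ i, i ≤ E.n ∧ Ready E (fun _ => 0) (4 + i) 0 (initProg.den ω s) ∧
      (∀ w, (E.star w).card ≤ Δ) ∧ (Δ = 0 ∨ ∃ w, Δ ≤ (E.star w).card) ∧
      (i = 0 ∨ 2 ^ i ≤ Δ) ∧ Δ < 2 ^ (i + 1) := by
  simp only [initProg, den_seq_eq]
  have r₁ : ∀ r, r ∉ [8, 30] → (den ω (.sub 30 1 8) (den ω (.const 8 1) s)).reg r = s.reg r :=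
    fun r hr => den_reg (.seq (.const 8 1) (.sub 30 1 8)) s r hr
  have a₁ : ∀ A, (den ω (.sub 30 1 8) (den ω (.const 8 1) s)).arr A = s.arr A := fun A => rfl
  have u₁ : (den ω (.sub 30 1 8) (den ω (.const 8 1) s)).used = 0 := hu
  have e8 : (den ω (.sub 30 1 8) (den ω (.const 8 1) s)).reg 8 = 1 := by
    simp [den, State.setReg_reg]
  have e30 : (den ω (.sub 30 1 8) (den ω (.const 8 1) s)).reg 30 = E.n - 1 := by
    simp [den, State.setReg_reg, h1]
  generalize den ω (.sub 30 1 8) (den ω (.const 8 1) s) = s₁ at r₁ a₁ u₁ e8 e30 ⊢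
  obtain ⟨hdeg, hdeg'⟩ := den_degProg (ω := ω) hE ((r₁ 1 (by decide)).trans h1) e8
    ((r₁ 32 (by decide)).trans (h0 32 (by decide))) ((a₁ 0).trans a0) ((a₁ 1).trans a1)
    ((a₁ 4).trans (ha 4 (by decide)))
  have r₂ : ∀ r, r ∉ degProg.regs → (den ω degProg s₁).reg r = s₁.reg r := fun r hr =>
    den_reg _ _ _ hr
  have a₂ : ∀ A, A ∉ degProg.arrs → (den ω degProg s₁).arr A = s₁.arr A := fun A hA =>
    den_arr _ _ _ hA
  have u₂ : (den ω degProg s₁).used = s₁.used := den_used _ _ (by decide)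
  generalize den ω degProg s₁ = s₂ at r₂ a₂ u₂ hdeg hdeg' ⊢
  have g1 : s₂.reg 1 = E.n := by rw [r₂ 1 (by decide), r₁ 1 (by decide), h1]
  have g8 : s₂.reg 8 = 1 := by rw [r₂ 8 (by decide), e8]
  have hle : s₂.reg 32 ≤ s₂.reg 1 := by
    rw [g1]
    rcases hdeg' with h | ⟨w, h⟩
    · omega
    · refine h.trans ((Finset.card_le_card (t := Finset.range E.n) fun j hj =>
        Finset.mem_range.2 (EdgeArray.mem_star.1 hj).1).trans ?_)
      simp
  obtain ⟨i, hi, h34, hpow, hlt⟩ := den_powProg (ω := ω) g8 hle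
  have r₃ : ∀ r, r ∉ powProg.regs → (den ω powProg s₂).reg r = s₂.reg r := fun r hr =>
    den_reg _ _ _ hr
  have a₃ : ∀ A, (den ω powProg s₂).arr A = s₂.arr A := fun A =>
    den_arr _ _ _ (by simp [powProg, arrs])
  have u₃ : (den ω powProg s₂).used = s₂.used := den_used _ _ (by decide)
  generalize den ω powProg s₂ = s₃ at r₃ a₃ u₃ h34 ⊢
  have r₄ : ∀ r, r ≠ 2 → (den ω (.copy 2 34) s₃).reg r = s₃.reg r := fun r hr => by
    simp [den, State.setReg_reg, hr]
  have e2 : (den ω (.copy 2 34) s₃).reg 2 = 4 + i := by simp [den, State.setReg_reg, h34]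
  have a₄ : ∀ A, (den ω (.copy 2 34) s₃).arr A = s₃.arr A := fun A => rfl
  have u₄ : (den ω (.copy 2 34) s₃).used = s₃.used := rfl
  generalize den ω (.copy 2 34) s₃ = s₄ at r₄ e2 a₄ u₄ ⊢
  have hH : Holds E (fun _ => 0) s₄ := by
    refine ⟨?_, ?_, ?_, ?_, ?_⟩
    · rw [r₄ 1 (by decide), r₃ 1 (by decide), g1]
    · rw [r₄ 8 (by decide), r₃ 8 (by decide), g8]
    · rw [a₄, a₃, a₂ 0 (by decide), a₁, a0]
    · rw [a₄, a₃, a₂ 1 (by decide), a₁, a1]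
    · rw [a₄, a₃, a₂ 3 (by decide), a₁, ha 3 (by decide)]
  refine ⟨s₂.reg 32, i, by omega, ⟨?_, ?_, ?_, ?_, ?_, ?_, ?_⟩, hdeg, hdeg', hpow, hlt⟩
  · exact hH.of_eq (den_reg _ _ _ (by decide)) (den_reg _ _ _ (by decide))
      (den_arr _ _ _ (by decide)) (den_arr _ _ _ (by decide)) (den_arr _ _ _ (by decide))
  · rw [den_reg _ _ _ (by decide), e2]
  · exact den_findProg hH
  · rw [den_reg _ _ _ (by decide), r₄ 30 (by decide), r₃ 30 (by decide), r₂ 30 (by decide), e30]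
  · rw [den_reg _ _ _ (by decide), r₄ 31 (by decide), r₃ 31 (by decide), r₂ 31 (by decide),
      r₁ 31 (by decide), h0 31 (by decide)]
  · exact fun i hi => absurd rfl hi
  · rw [den_used _ _ (by decide), u₄, u₃, u₂, u₁]

/-- The whole algorithm. -/
def algorithm : Cmd := .seq initProg.compile (.loop 4 roundProg.compile)

/-- The memory after `t` rounds. -/
theorem reach_algorithm {s : State} {k : ℕ}
    (h : Ready E (fun _ => 0) k 0 (initProg.den ω s)) (hs1 : s.reg 1 = E.n) (hk : k ≤ E.n + 4)
    (t : ℕ) (ht : ∀ t' < t, firstIdx E.n (fun j => E.process k ω t' j = 0) ≠ 0) :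
    ∃ s' τ, Ready E (E.process k ω t) k (k * t) s' ∧ t ≤ τ ∧
      τ ≤ initProg.cost.eval E.n + 1 + t * (roundProg.cost.eval (E.n + 4) + 1) ∧
      (step ω)^[τ] ⟨[algorithm], s⟩ = ⟨[.loop 4 roundProg.compile], s'⟩ := by
  induction t with
  | zero =>
    obtain ⟨τ, hτ, hrun⟩ := runs_compile (ω := ω) initProg (by decide) E.n s (by
      intro m hm
      have : m = 1 := by
        simp only [initProg, degProg, powProg, findProg, bumpProg, search, bounds, List.mem_append,
          List.mem_cons, List.not_mem_nil, or_false, false_or, or_self] at hm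
        exact hm
      subst this
      exact ⟨by decide, hs1.le⟩)
    refine ⟨_, τ + 1, h, Nat.zero_le _, by omega, ?_⟩
    rw [Function.iterate_succ_apply]
    exact hrun _
  | succ t ih =>
    obtain ⟨s', τ, hR, h1, h2, h3⟩ := ih fun t' ht' => ht t' (by omega)
    have hne := ht t (by omega)
    -- Every loop in a round has length n, k or n - 1, all at most n + 4.
    obtain ⟨σ, hσ, hrun⟩ := runs_compile (ω := ω) roundProg (by decide) (E.n + 4) s' (by
      have hb : ∀ m ∈ roundProg.bounds, (m = 1 ∨ m = 2 ∨ m = 30) ∧ m ∉ roundProg.regs := by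
        decide
      intro m hm
      refine ⟨(hb m hm).2, ?_⟩
      rcases (hb m hm).1 with rfl | rfl | rfl
      · rw [hR.reg_one]; omega
      · rw [hR.reg_two]; exact hk
      · rw [hR.reg_thirty]; omega)
    refine ⟨roundProg.den ω s', σ + (τ + 1), ?_, by omega, ?_, ?_⟩
    · have := den_roundProg (ω := ω) hR hne
      rw [EdgeArray.process, if_neg hne]
      exact this
    · rw [Nat.succ_mul]; omega
    · rw [Function.iterate_add_apply, Function.iterate_succ_apply', h3]
      have : step ω ⟨[.loop 4 roundProg.compile], s'⟩ =
          ⟨[roundProg.compile, .loop 4 roundProg.compile], s'⟩ := by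
        simp only [step]
        rw [if_pos]
        rw [hR.reg_four]
        exact hne
      rw [this]
      exact hrun _

end Prog

/-! ### Correctness and expected running time -/

theorem iterate_step_of_halted {ω : ℕ → Bool} {x : Config} {a b : ℕ}
    (h : ((step ω)^[a] x).todo = []) (hab : a ≤ b) : (step ω)^[b] x = (step ω)^[a] x := by
  obtain ⟨d, rfl⟩ := Nat.exists_eq_add_of_le' hab
  rw [Function.iterate_add_apply]
  generalize (step ω)^[a] x = y at h
  obtain ⟨K, s⟩ := y
  obtain rfl : K = [] := h
  exact Function.iterate_fixed rfl d

/-- The edge array of a list of edges. -/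
def edgeArray {v : ℕ} (es : List (Fin v × Fin v)) : EdgeArray where
  n := es.length
  U i := (es.map fun p => (p.1 : ℕ)).getD i 0
  W i := (es.map fun p => (p.2 : ℕ)).getD i 0

theorem represents_edgeArray {v : ℕ} {G : SimpleGraph (Fin v)} {es : List (Fin v × Fin v)}
    (h : G.IsEdgeListing es) :
    (edgeArray es).Represents G fun i : Fin es.length => s(es[i].1, es[i].2) where
  mem i := (h.mem_iff _).1 (List.mem_map.2 ⟨_, List.getElem_mem i.2, rfl⟩)
  surj f hf := by
    obtain ⟨p, hp, rfl⟩ := List.mem_map.1 ((h.mem_iff f).2 hf)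
    obtain ⟨i, hi, rfl⟩ := List.getElem_of_mem hp
    exact ⟨⟨i, hi⟩, rfl⟩
  inj i j hij := by
    refine Fin.ext ((h.nodup.getElem_inj_iff (hi := by rw [List.length_map]; exact i.2)
      (hj := by rw [List.length_map]; exact j.2)).1 ?_)
    rw [List.getElem_map, List.getElem_map]
    exact hij
  inc i x := by
    have hi : (i : ℕ) < es.length := i.2
    simp [EdgeArray.Inc, edgeArray, hi, Fin.ext_iff, eq_comm]
    exact Iff.rfl
  lt i := by
    have hi : (i : ℕ) < es.length := i.2
    simp [edgeArray, hi]

theorem card_star_le_maxDegree {v : ℕ} {G : SimpleGraph (Fin v)} [DecidableRel G.Adj]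
    {E : EdgeArray} {ed : Fin E.n → Sym2 (Fin v)} (hR : E.Represents G ed) (w : ℕ) :
    (E.star w).card ≤ G.maxDegree := by
  rcases (E.star w).eq_empty_or_nonempty with h0 | ⟨j, hj⟩
  · simp [h0]
  have hw : w < v := (EdgeArray.mem_star.1 hj).2.lt hR (EdgeArray.mem_star.1 hj).1
  refine le_trans ?_ (G.degree_le_maxDegree ⟨w, hw⟩)
  rw [← G.card_incidenceFinset_eq_degree]
  refine Finset.card_le_card_of_injOn
    (fun j => if h : j < E.n then ed ⟨j, h⟩ else s(⟨w, hw⟩, ⟨w, hw⟩)) ?_ ?_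
  · intro j hj
    obtain ⟨hjn, hjw⟩ := EdgeArray.mem_star.1 hj
    simp only [hjn, dif_pos, SetLike.mem_coe, SimpleGraph.mem_incidenceFinset]
    exact ⟨hR.mem _, (hR.inc ⟨j, hjn⟩ ⟨w, hw⟩).1 hjw⟩
  · intro i hi j hj hij
    obtain ⟨hin, -⟩ := EdgeArray.mem_star.1 hi
    obtain ⟨hjn, -⟩ := EdgeArray.mem_star.1 hj
    simp only [hin, hjn, dif_pos] at hij
    simpa using hR.inj hij

theorem noBichromaticCycle_process {v : ℕ} {G : SimpleGraph (Fin v)} {E : EdgeArray}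
    {ed : Fin E.n → Sym2 (Fin v)} (hR : E.Represents G ed) (k : ℕ) (ω : ℕ → Bool) (t : ℕ) :
    E.NoBichromaticCycle G ed (E.process k ω t) := by
  induction t with
  | zero => exact hR.noBichromaticCycle_zero
  | succ t ih =>
    rw [EdgeArray.process]
    split_ifs with h
    · exact ih
    · have := firstIdx_pred_spec h
      exact EdgeArray.noBichromaticCycle_round hR
        (EdgeArray.isPartial_process hR.simple k ω t).proper ih this.1 this.2

/-- The running time is governed by the number of rounds. -/
theorem runningTime_algorithm_le {ω : ℕ → Bool} {E : EdgeArray} {s : State} {k : ℕ}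
    (h : Prog.Ready E (fun _ => 0) k 0 (Prog.initProg.den ω s)) (hs1 : s.reg 1 = E.n)
    (hk : k ≤ E.n + 4) :
    runningTime Prog.algorithm s ω ≤ ((Prog.initProg.cost.eval E.n + 2 : ℕ) : ℝ≥0∞) +
      ∑' t, ((Prog.roundProg.cost.eval (E.n + 4) + 1 : ℕ) : ℝ≥0∞) *
        {ω | firstIdx E.n (fun j => E.process k ω t j = 0) ≠ 0}.indicator 1 ω := by
  classical
  set q := Prog.roundProg.cost.eval (E.n + 4) + 1 with hq
  by_cases hex : ∃ t, firstIdx E.n (fun j => E.process k ω t j = 0) = 0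
  · set t := Nat.find hex with ht
    obtain ⟨s', τ, hR, -, hτ, hrun⟩ := Prog.reach_algorithm h hs1 hk t
      fun t' ht' => Nat.find_min hex ht'
    rw [← hq] at hτ
    have hfull : s'.reg 4 = 0 := hR.reg_four.trans (Nat.find_spec hex)
    have hhalt : HaltedBy Prog.algorithm s ω (τ + 1) := by
      unfold HaltedBy run
      rw [Function.iterate_succ_apply', hrun]
      simp [step, hfull]
    refine (iInf₂_le (τ + 1) hhalt).trans ?_
    -- The number of rounds is the number of times t at which the coloring is still incomplete, so
    -- it is a sum of indicators whose expectation can be taken termwise.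
    have h1 : ((t * q : ℕ) : ℝ≥0∞) ≤ ∑' t, (q : ℝ≥0∞) *
        {ω | firstIdx E.n (fun j => E.process k ω t j = 0) ≠ 0}.indicator 1 ω := by
      refine le_trans ?_ (ENNReal.sum_le_tsum (Finset.range t))
      have : ∀ t' ∈ Finset.range t, (q : ℝ≥0∞) *
          {ω | firstIdx E.n (fun j => E.process k ω t' j = 0) ≠ 0}.indicator 1 ω = q := by
        intro t' ht'
        have := Nat.find_min hex (Finset.mem_range.1 ht')
        rw [Set.indicator_of_mem (by exact this), Pi.one_apply, mul_one]
      rw [Finset.sum_congr rfl this]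
      simp
    refine le_trans ?_ (add_le_add_right h1 _)
    exact_mod_cast (by omega : τ + 1 ≤ Prog.initProg.cost.eval E.n + 2 + t * q)
  -- If the coloring never becomes complete, the right-hand side is infinite.
  · push Not at hex
    have : ∑' t, (q : ℝ≥0∞) *
        {ω | firstIdx E.n (fun j => E.process k ω t j = 0) ≠ 0}.indicator 1 ω = ∞ := by
      have h1 : ∀ t, (q : ℝ≥0∞) *
          {ω | firstIdx E.n (fun j => E.process k ω t j = 0) ≠ 0}.indicator 1 ω = q := by
        intro t
        rw [Set.indicator_of_mem (by exact hex t), Pi.one_apply, mul_one]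
      rw [tsum_congr h1]
      exact ENNReal.tsum_const_eq_top_of_ne_zero (by simp [hq])
    rw [this]
    simp

/-- The machine computes a power of two `2 ^ i` for which `2 ^ i ≤ Δ < 2 ^ (i + 1)`, where `Δ` is
the maximum degree, unless there are no edges. -/
theorem exists_ready_initProg {v : ℕ} {G : SimpleGraph (Fin v)} {es : List (Fin v × Fin v)}
    (hes : G.IsEdgeListing es) (ω : ℕ → Bool) :
    ∃ Δ i, i ≤ (edgeArray es).n ∧
      Prog.Ready (edgeArray es) (fun _ => 0) (4 + i) 0 (Prog.initProg.den ω (graphInput es)) ∧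
      (∀ w, ((edgeArray es).star w).card ≤ Δ) ∧
      (Δ = 0 ∨ ∃ w, Δ ≤ ((edgeArray es).star w).card) ∧
      (i = 0 ∨ 2 ^ i ≤ Δ) ∧ Δ < 2 ^ (i + 1) := by
  have hE := (represents_edgeArray hes).simple
  refine Prog.den_initProg hE rfl (fun r hr => ?_) rfl rfl (fun A hA => ?_) rfl
  · simp only [graphInput]
    rw [if_neg (by omega), if_neg (by omega)]
  · funext i
    simp only [graphInput]
    rw [if_neg (by omega), if_neg (by omega)]

/-- The output of the algorithm is correct. -/
theorem exists_holdsColoring_algorithm {v : ℕ} {G : SimpleGraph (Fin v)} [DecidableRel G.Adj]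
    {es : List (Fin v × Fin v)} (hes : G.IsEdgeListing es) {ω : ℕ → Bool} {t : ℕ}
    (hhalt : HaltedBy Prog.algorithm (graphInput es) ω t) :
    ∃ c : G.EdgeLabeling (Fin (16 * G.maxDegree)), G.IsAcyclicEdgeColoring c ∧
      HoldsColoring es c (run Prog.algorithm (graphInput es) ω t).state := by
  have hR := represents_edgeArray hes
  have hE := hR.simple
  have hs1 : (graphInput es).reg 1 = (edgeArray es).n := rfl
  obtain ⟨Δ, i, hi, hready, hΔ, hΔ', hpow, hlt⟩ := exists_ready_initProg hes ω
  have hreach := Prog.reach_algorithm hready hs1 (by omega)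
  by_cases hex : ∃ t, firstIdx (edgeArray es).n
      (fun j => (edgeArray es).process (4 + i) ω t j = 0) = 0
  · classical
    obtain ⟨s', τ, hR', -, -, hrun⟩ := hreach (Nat.find hex) fun t' ht' => Nat.find_min hex ht'
    have hfull := Nat.find_spec hex
    have hreg : s'.reg 4 = 0 := hR'.reg_four.trans hfull
    have hend : (step ω)^[τ + 1] ⟨[Prog.algorithm], graphInput es⟩ = ⟨[], s'⟩ := by
      rw [Function.iterate_succ_apply', hrun]
      simp [step, hreg]
    have hstate : (run Prog.algorithm (graphInput es) ω t).state = s' := by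
      unfold HaltedBy run at hhalt
      unfold run
      rcases le_total t (τ + 1) with hle | hle
      · rw [← iterate_step_of_halted hhalt hle, hend]
      · rw [iterate_step_of_halted (by rw [hend]) hle, hend]
    have hpart := EdgeArray.isPartial_process hE (4 + i) ω (Nat.find hex)
    rw [firstIdx_eq_zero] at hfull
    have hM : ∀ j : Fin (edgeArray es).n,
        (edgeArray es).process (4 + i) ω (Nat.find hex) j ≤ 16 * G.maxDegree := by
      intro j
      refine (hpart.le j).trans ?_
      -- The existence of an edge j forces Δ ≥ 1, so 2^i ≤ Δ also when i = 0, and 2^(4+i) ≤ 16Δ.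
      have h1 : 1 ≤ Δ := by
        refine le_trans ?_ (hΔ ((edgeArray es).U j))
        exact Finset.card_pos.2 ⟨j, EdgeArray.mem_star.2 ⟨j.2, .inl rfl⟩⟩
      have h2 : Δ ≤ G.maxDegree := by
        rcases hΔ' with h0 | ⟨w, hw⟩
        · omega
        · exact hw.trans (card_star_le_maxDegree hR w)
      have h3 : 2 ^ i ≤ Δ := by
        rcases hpow with rfl | h
        · simpa
        · exact h
      rw [pow_add]
      omega
    obtain ⟨c, hc, hcol⟩ := EdgeArray.exists_isAcyclicEdgeColoring hR hpart.proper
      (noBichromaticCycle_process hR (4 + i) ω (Nat.find hex)) (fun j => hfull j j.2) hM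
    refine ⟨c, hc, ?_⟩
    rw [hstate]
    intro j hj hmem
    have h1 := hcol ⟨j, hj⟩ hmem
    have h2 := hR'.out j (hfull j hj)
    have h3 : s'.arr 2 j + 1 = (c ⟨s(es[j].1, es[j].2), hmem⟩ : ℕ) + 1 := h2.trans h1.symm
    omega
  · push Not at hex
    -- After t rounds at least t steps have been made and the loop is still pending, so the program
    -- cannot have halted by time t.
    obtain ⟨s', τ, -, hτ, -, hrun⟩ := hreach t fun t' _ => hex t'
    unfold HaltedBy run at hhalt
    have := iterate_step_of_halted hhalt hτ
    rw [← this, hrun] at hhalt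
    exact absurd hhalt (by simp)

/-- A polynomial bound for the expected running time of the algorithm. -/
noncomputable def timeBound : Polynomial ℕ :=
  Prog.initProg.cost + 2 +
    (Prog.roundProg.cost.comp (Polynomial.X + 4) + 1) * (3 * Polynomial.X + 5)

theorem expectedTime_algorithm_le {v : ℕ} {G : SimpleGraph (Fin v)} {es : List (Fin v × Fin v)}
    (hes : G.IsEdgeListing es) :
    expectedTime Prog.algorithm (graphInput es) ≤ ((timeBound.eval es.length : ℕ) : ℝ≥0∞) := by
  have hE := (represents_edgeArray hes).simple
  have hs1 : (graphInput es).reg 1 = (edgeArray es).n := rfl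
  -- Fixes Δ and i independently of the coins: any coin sequence gives the same maximum degree, and
  -- the conditions on i determine it.
  obtain ⟨Δ, i, hi, -, hΔ, hΔ', hpow, hlt⟩ := exists_ready_initProg hes fun _ => false
  have hready : ∀ ω, Prog.Ready (edgeArray es) (fun _ => 0) (4 + i) 0
      (Prog.initProg.den ω (graphInput es)) := by
    intro ω
    obtain ⟨Δ₁, i₁, -, hready, hΔ₁, hΔ₁', hpow₁, hlt₁⟩ := exists_ready_initProg hes ω
    have h1 : Δ ≤ Δ₁ := hΔ'.elim (fun h => by omega) fun ⟨w, hw⟩ => hw.trans (hΔ₁ w)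
    have h2 : Δ₁ ≤ Δ := hΔ₁'.elim (fun h => by omega) fun ⟨w, hw⟩ => hw.trans (hΔ w)
    obtain rfl := le_antisymm h1 h2
    have key : ∀ a b, (a = 0 ∨ 2 ^ a ≤ Δ) → Δ < 2 ^ (b + 1) → a ≤ b := fun a b ha hb =>
      ha.elim (fun h => h ▸ Nat.zero_le _) fun h =>
        Nat.lt_succ_iff.1 ((Nat.pow_lt_pow_iff_right one_lt_two).1 (h.trans_lt hb))
    rwa [le_antisymm (key i i₁ hpow hlt₁) (key i₁ i hpow₁ hlt)]
  set E := edgeArray es with hEdef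
  have hmeas : ∀ t, MeasurableSet
      {ω | firstIdx E.n (fun j => E.process (4 + i) ω t j = 0) ≠ 0} := fun t =>
    DependsOnFirst.measurableSet (m := (4 + i) * t) fun ω ω' hω hmem => by
      rw [Set.mem_ofPred_eq] at hmem ⊢
      rwa [← EdgeArray.process_congr hω]
  -- With H = 2^(i+3), the number of colors 2^(4+i) is 2H, and Δ < 2^(i+1) gives 4Δ ≤ H.
  have hrounds := EdgeArray.tsum_measure_incomplete_le hE hΔ (H := 2 ^ (i + 3)) (k := 4 + i)
    (by positivity) (by rw [pow_succ, pow_succ]; omega) (by ring)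
  calc expectedTime Prog.algorithm (graphInput es)
      ≤ ∫⁻ ω, (((Prog.initProg.cost.eval E.n + 2 : ℕ) : ℝ≥0∞) +
        ∑' t, ((Prog.roundProg.cost.eval (E.n + 4) + 1 : ℕ) : ℝ≥0∞) *
          {ω | firstIdx E.n (fun j => E.process (4 + i) ω t j = 0) ≠ 0}.indicator 1 ω)
          ∂coinMeasure :=
        lintegral_mono fun ω => runningTime_algorithm_le (hready ω) hs1 (by omega)
    _ = ((Prog.initProg.cost.eval E.n + 2 : ℕ) : ℝ≥0∞) +
        ((Prog.roundProg.cost.eval (E.n + 4) + 1 : ℕ) : ℝ≥0∞) *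
          ∑' t, coinMeasure {ω | firstIdx E.n (fun j => E.process (4 + i) ω t j = 0) ≠ 0} := by
        rw [lintegral_add_left measurable_const, lintegral_const, measure_univ, mul_one,
          lintegral_tsum fun t =>
            ((measurable_one.indicator (hmeas t)).const_mul _).aemeasurable,
          ← ENNReal.tsum_mul_left]
        congr 2
        funext t
        rw [lintegral_const_mul _ (measurable_one.indicator (hmeas t)),
          lintegral_indicator_one (hmeas t)]
    _ ≤ ((Prog.initProg.cost.eval E.n + 2 : ℕ) : ℝ≥0∞) +
        ((Prog.roundProg.cost.eval (E.n + 4) + 1 : ℕ) : ℝ≥0∞) * ((3 * E.n + 5 : ℕ) : ℝ≥0∞) := by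
        gcongr
    _ = _ := by
        simp only [timeBound, Polynomial.eval_add, Polynomial.eval_mul, Polynomial.eval_comp,
          Polynomial.eval_X, Polynomial.eval_one, Polynomial.eval_ofNat]
        push_cast
        rfl

end RandRAM

theorem theorem6p1 :
    ∃ (P : RandRAM.Cmd) (p : Polynomial ℕ),
      ∀ (v : ℕ) (G : SimpleGraph (Fin v)) [DecidableRel G.Adj] (es : List (Fin v × Fin v)),
        G.IsEdgeListing es →
          (∀ (ω : ℕ → Bool) (t : ℕ), RandRAM.HaltedBy P (RandRAM.graphInput es) ω t →
            ∃ c : G.EdgeLabeling (Fin (16 * G.maxDegree)),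
              G.IsAcyclicEdgeColoring c ∧
                RandRAM.HoldsColoring es c (RandRAM.run P (RandRAM.graphInput es) ω t).state) ∧
          RandRAM.expectedTime P (RandRAM.graphInput es) ≤ ((p.eval es.length : ℕ) : ℝ≥0∞) := by
  refine ⟨RandRAM.Prog.algorithm, RandRAM.timeBound, fun v G _ es hes => ⟨fun ω t h => ?_, ?_⟩⟩
  · exact RandRAM.exists_holdsColoring_algorithm hes h
  · exact RandRAM.expectedTime_algorithm_le hes
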